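/- **Setting.** Macro ($\mathrm m$) and small ($\mathrm s$) base stations form independent homogeneous Poisson point processes $\Phi_{\mathrm m},\Phi_{\mathrm s}$ in $\mathbb R^2$ with intensities $\lambda_k>0$, powers $P_k>0$, bias factors $B_k>0$ and antenna heights $h_k$; the user's antenna has height $h_{\mathrm u}$ and the path loss exponent is $\eta>2$. Put $h_{\mathrm uk}=|h_{\mathrm u}-h_k|$ and, for $k\ne j$ in $\{\mathrm m,\mathrm s\}$, $\beta_{kj}=\big(\tfrac{B_kP_k}{B_jP_j}\big)^{2/\eta}$. At $x\in\mathbb R^2$ the user receives from the tier-$k$ station at $p$ the biased signal $B_kP_k\,(|x-p|^2+h_{\mathrm uk}^2)^{-\eta/2}$, and is served by the tier whose best signal is stronger. Let $\mathcal T$ be the set of points $x$ at which the best signals of the two tiers are equal, and $\mathcal T^{(\Delta d)}=\{u:\exists v\in\mathcal T,\ |u-v|<\Delta d\}$. The area intensity $\mu(\mathcal T^{(\Delta d)})$ is the expected area of $\mathcal T^{(\Delta d)}\cap[0,1]^2$, and the length intensity is $\mu(\mathcal T)=\lim_{\Delta d\to0^+}\mu(\mathcal T^{(\Delta d)})/(2\Delta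 d)$. **Explicit functions.** For $k\neq j$ let $$\vartheta(\alpha_{kj},r)=\frac1{\beta_{kj}}\int_0^\pi\sqrt{r^2(\beta_{kj}+1)+h_{\mathrm uk}^2\beta_{kj}-h_{\mathrm uj}^2\beta_{kj}^2-2\beta_{kj}\,r\cos\theta\,\sqrt{\tfrac{r^2+h_{\mathrm uk}^2}{\beta_{kj}}-h_{\mathrm uj}^2}}\;d\theta ,$$ $$A_k=\begin{cases}1-e^{\pi\lambda_k(h_{\mathrm uk}^2-\beta_{kj}h_{\mathrm uj}^2)}+\dfrac{\lambda_k}{\lambda_k+\lambda_j\beta_{jk}}\,e^{\pi\lambda_k(h_{\mathrm uk}^2-\beta_{kj}h_{\mathrm uj}^2)},& h_{\mathrm uk}^2\le\beta_{kj}h_{\mathrm uj}^2,\\[2mm] \dfrac{\lambda_k}{\lambda_k+\lambda_j\beta_{jk}}\,e^{\pi\lambda_j(h_{\mathrm uj}^2-\beta_{jk}h_{\mathrm uk}^2)},&\text{otherwise,}\end{cases}$$ and, with $L_k=\sqrt{\max(\beta_{kj}h_{\mathrm uj}^2-h_{\mathrm uk}^2,\,0)}$, $$f_{X_k}(x)=\begin{cases}\dfrac{2\pi\lambda_k}{A_k}\,x\,e^{-\pi\lambda_kx^2},&0\le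 x\le L_k,\\[2mm] \dfrac{2\pi\lambda_k}{A_k}\,x\,e^{-\pi x^2(\lambda_k+\lambda_j\beta_{jk})-\pi\lambda_j(h_{\mathrm uk}^2\beta_{jk}-h_{\mathrm uj}^2)},&x>L_k,\end{cases}$$ with $f_{X_k}(x)=0$ for $x<0$. **Theorem.** $A_k$ is the probability that the user at the origin is served by tier $k$, and, given this event, the horizontal distance from the user to the serving station has probability density $f_{X_k}$. For every $\Delta d>0$ and every $x\in\mathbb R^2$, $\mathbb P[x\in\mathcal T^{(\Delta d)}]=\mu(\mathcal T^{(\Delta d)})$. As $\Delta d\to0^+$, $$\mu(\mathcal T^{(\Delta d)})=\int_{a_{\mathrm m}}^\infty 2\lambda_{\mathrm s}\Delta d\,\vartheta(\alpha_{\mathrm{ms}},x)\,A_{\mathrm m}f_{X_{\mathrm m}}(x)\,dx+\int_{a_{\mathrm s}}^\infty 2\lambda_{\mathrm m}\Delta d\,\vartheta(\alpha_{\mathrm{sm}},x)\,A_{\mathrm s}f_{X_{\mathrm s}}(x)\,dx+\mathcal O(\Delta d^2),$$ where $$(a_{\mathrm m},a_{\mathrm s})=\begin{cases}\big(\sqrt{h_{\mathrm{us}}^2\beta_{\mathrm{ms}}-h_{\mathrm{um}}^2},\,0\big),&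 h_{\mathrm{um}}^2\le\beta_{\mathrm{ms}}h_{\mathrm{us}}^2,\\[1mm] \big(0,\,\sqrt{h_{\mathrm{um}}^2\beta_{\mathrm{sm}}-h_{\mathrm{us}}^2}\big),& h_{\mathrm{um}}^2>\beta_{\mathrm{ms}}h_{\mathrm{us}}^2.\end{cases}$$ Consequently the length intensity exists and is $$\mu(\mathcal T)=\int_{a_{\mathrm m}}^\infty \lambda_{\mathrm s}\,\vartheta(\alpha_{\mathrm{ms}},x)\,A_{\mathrm m}f_{X_{\mathrm m}}(x)\,dx+\int_{a_{\mathrm s}}^\infty \lambda_{\mathrm m}\,\vartheta(\alpha_{\mathrm{sm}},x)\,A_{\mathrm s}f_{X_{\mathrm s}}(x)\,dx ,$$ and for every deterministic trajectory travelled at constant speed $v\ge 0$ during a time interval $[0,T]$, $T>0$, the handover rate from tier $k$ to tier $j\ne k$ (the expected number of changes of the serving tier from $k$ to $j$ during $[0,T]$, divided by $T$) equals $H_{kj}=\frac1\pi\,\mu(\mathcal T)\,v$. -/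

import Mathlib

open Set Filter Topology MeasureTheory ProbabilityTheory Asymptotics
open scoped ENNReal NNReal Real

noncomputable section

/-- The horizontal plane with its Euclidean norm. -/
abbrev Plane : Type := EuclideanSpace ℝ (Fin 2)

/-- The two tiers: macro base stations and small base stations. -/
inductive Tier : Type
  | mbs
  | sbs

/-- The tier different from the given one. -/
def Tier.other : Tier → Tier
  | .mbs => .sbs
  | .sbs => .mbs

/-! ### Poisson point processes in the plane -/

/-- The number of points of the random point set `Φ` in the region `A`. -/
def pointCount {Ω : Type*} (Φ : Ω → Set Plane) (A : Set Plane) (ω : Ω) : ℕ∞ :=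
  (Φ ω ∩ A).encard

/-- The random point set `Φ` is a homogeneous Poisson point process with intensity `lam`:
the counts are random variables, the count in a bounded Borel region is Poisson distributed with
mean `lam * area`, and the counts in pairwise disjoint bounded Borel regions are independent. -/
structure IsPoissonPointProcess {Ω : Type*} [MeasurableSpace Ω] (P : Measure Ω)
    (Φ : Ω → Set Plane) (lam : ℝ) : Prop where
  measurable_count : ∀ A : Set Plane, MeasurableSet A → Measurable (pointCount Φ A)
  count_law : ∀ A : Set Plane, MeasurableSet A → Bornology.IsBounded A → ∀ n : ℕ,
    P {ω | pointCount Φ A ω = n} =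
      poissonMeasure (Real.toNNReal (lam * (volume A).toReal)) {n}
  count_indep : ∀ (n : ℕ) (A : Fin n → Set Plane), (∀ i, MeasurableSet (A i)) →
    (∀ i, Bornology.IsBounded (A i)) → Pairwise (fun i j => Disjoint (A i) (A j)) →
    iIndepFun (fun i => pointCount Φ (A i)) P

/-- The σ-algebra generated by a random point set, that is, by all its counts. -/
abbrev pointSigma {Ω : Type*} (Φ : Ω → Set Plane) : MeasurableSpace Ω :=
  ⨆ A : {A : Set Plane // MeasurableSet A},
    MeasurableSpace.comap (pointCount Φ A.1) inferInstance

/-! ### The network -/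

/-- Parameters of a two-tier network: per tier the intensity `lam`, the transmission power, the
bias factor and the antenna height; and the path loss exponent and the height of the user. -/
structure Network where
  lam : Tier → ℝ
  power : Tier → ℝ
  bias : Tier → ℝ
  bsHeight : Tier → ℝ
  eta : ℝ
  userHeight : ℝ
  lam_pos : ∀ k, 0 < lam k
  power_pos : ∀ k, 0 < power k
  bias_pos : ∀ k, 0 < bias k
  eta_gt_two : 2 < eta

/-- The base stations of the two tiers form independent Poisson point processes with the
intensities of the network. -/
structure Network.IsDeployment (N : Network) {Ω : Type*} [MeasurableSpace Ω] (P : Measure Ω)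
    (Φ : Tier → Ω → Set Plane) : Prop where
  poisson : ∀ k, IsPoissonPointProcess P (Φ k) (N.lam k)
  indep : iIndep (fun k => pointSigma (Φ k)) P

namespace Network

variable (N : Network)

/-- Height difference between the user and the tier-`k` antennas. -/
def hdiff (k : Tier) : ℝ := |N.userHeight - N.bsHeight k|

/-- Biased signal strength, received by a user above `x`, of the tier-`k` base station above `p`
(it is `∞` if the two antennas are at the same place). -/
def signal (k : Tier) (p x : Plane) : ℝ≥0∞ :=
  ENNReal.ofReal (N.bias k * N.power k) /
    ENNReal.ofReal ((dist x p ^ 2 + N.hdiff k ^ 2) ^ (N.eta / 2))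

/-- The best biased signal strength received above `x` from the stations `S` of tier `k`. -/
def bestSignal (k : Tier) (S : Set Plane) (x : Plane) : ℝ≥0∞ := ⨆ p ∈ S, N.signal k p x

/-- The set of positions at which the user is served by tier `k`; `S` gives the stations. -/
def servedBy (S : Tier → Set Plane) (k : Tier) : Set Plane :=
  {x | N.bestSignal k.other (S k.other) x < N.bestSignal k (S k) x}

/-- The inter-tier cell boundaries: the best signals of the two tiers are equally strong. -/
def boundary (S : Tier → Set Plane) : Set Plane :=
  {x | N.bestSignal .mbs (S .mbs) x = N.bestSignal .sbs (S .sbs) x}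

/-- The cell boundaries extended by `δ`. -/
def extBoundary (S : Tier → Set Plane) (δ : ℝ) : Set Plane :=
  {u | ∃ v ∈ N.boundary S, dist u v < δ}

/-- Area intensity of the extended boundaries: their expected area in the unit square. -/
def areaIntensity {Ω : Type*} [MeasurableSpace Ω] (P : Measure Ω) (Φ : Tier → Ω → Set Plane)
    (δ : ℝ) : ℝ≥0∞ :=
  ∫⁻ ω, volume (N.extBoundary (fun k => Φ k ω) δ ∩ {x : Plane | ∀ i, x i ∈ Icc (0 : ℝ) 1}) ∂P

/-- `ell` is the length intensity (mean Minkowski content per unit area) of the boundaries: the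
limit of the area intensity divided by the width `2 * δ` of the extended boundaries. -/
def HasLengthIntensity {Ω : Type*} [MeasurableSpace Ω] (P : Measure Ω)
    (Φ : Tier → Ω → Set Plane) (ell : ℝ) : Prop :=
  Tendsto (fun δ : ℝ => (N.areaIntensity P Φ δ).toReal / (2 * δ)) (𝓝[>] 0) (𝓝 ell)

/-- The number of handovers from tier `k` to the other tier along the trajectory `γ` during the
time interval `[0, T]`: the supremum of all `n` for which there are times
`s 0 < t 0 < s 1 < t 1 < ⋯ < t (n - 1)` such that the user is served by tier `k` at the times
`s i` and by the other tier at the times `t i`. -/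
def handoverCount (S : Tier → Set Plane) (k : Tier) (γ : ℝ → Plane) (T : ℝ) : ℕ∞ :=
  ⨆ (n : ℕ) (_ : ∃ s t : ℕ → ℝ,
    (∀ i < n, 0 ≤ s i ∧ s i < t i ∧ t i ≤ T) ∧ (∀ i, i + 1 < n → t i < s (i + 1)) ∧
    (∀ i < n, γ (s i) ∈ N.servedBy S k ∧ γ (t i) ∈ N.servedBy S k.other)), (n : ℕ∞)

/-- The rate per unit time, during `[0, T]`, of the handovers from tier `k` to the other tier. -/
def handoverRate {Ω : Type*} [MeasurableSpace Ω] (P : Measure Ω) (Φ : Tier → Ω → Set Plane)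
    (k : Tier) (γ : ℝ → Plane) (T : ℝ) : ℝ≥0∞ :=
  (∫⁻ ω, (N.handoverCount (fun j => Φ j ω) k γ T : ℝ≥0∞) ∂P) / ENNReal.ofReal T

/-! ### The explicit expressions -/

/-- The ratio `β_{kj}` of biased powers. -/
def beta (k j : Tier) : ℝ :=
  ((N.bias k * N.power k) / (N.bias j * N.power j)) ^ (2 / N.eta)

/-- The probability that the user is associated with tier `k`. -/
def assocProb (k : Tier) : ℝ :=
  let j := k.other
  let q := N.lam k / (N.lam k + N.lam j * N.beta j k)
  if N.hdiff k ^ 2 ≤ N.beta k j * N.hdiff j ^ 2 then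
    (1 - Real.exp (π * N.lam k * (N.hdiff k ^ 2 - N.beta k j * N.hdiff j ^ 2))) +
      q * Real.exp (π * N.lam k * (N.hdiff k ^ 2 - N.beta k j * N.hdiff j ^ 2))
  else
    q * Real.exp (π * N.lam j * (N.hdiff j ^ 2 - N.beta j k * N.hdiff k ^ 2))

/-- The number `L_k`: up to this horizontal distance, the nearest tier-`k` station wins the
association wherever the other stations are. It is `0` if the radicand is negative. -/
def critDist (k : Tier) : ℝ :=
  √(N.hdiff k.other ^ 2 * N.beta k k.other - N.hdiff k ^ 2)

/-- The density of the horizontal distance between the user and the serving base station, given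
that the user is associated with tier `k`. -/
def servicePDF (k : Tier) (x : ℝ) : ℝ :=
  let j := k.other
  if x < 0 then 0
  else if x ≤ N.critDist k then
    2 * π * N.lam k / N.assocProb k * x * Real.exp (-π * N.lam k * x ^ 2)
  else
    2 * π * N.lam k / N.assocProb k * x *
      Real.exp (-π * x ^ 2 * (N.lam k + N.lam j * N.beta j k) -
        π * N.lam j * (N.hdiff k ^ 2 * N.beta j k - N.hdiff j ^ 2))

/-- The function `ϑ(α_{kj}, r)` for different tiers `k` and `j`. -/
def vartheta (k j : Tier) (r : ℝ) : ℝ :=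
  1 / N.beta k j * ∫ θ in (0 : ℝ)..π,
    √(r ^ 2 * (N.beta k j + 1) + N.hdiff k ^ 2 * N.beta k j - N.hdiff j ^ 2 * N.beta k j ^ 2 -
      2 * N.beta k j * r * Real.cos θ *
        √((r ^ 2 + N.hdiff k ^ 2) / N.beta k j - N.hdiff j ^ 2))

/-- The leading term of the area intensity. -/
def areaLeadingTerm (δ : ℝ) : ℝ :=
  if N.hdiff .mbs ^ 2 ≤ N.beta .mbs .sbs * N.hdiff .sbs ^ 2 then
    (∫ x in Ioi √(N.hdiff .sbs ^ 2 * N.beta .mbs .sbs - N.hdiff .mbs ^ 2),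
      2 * N.lam .sbs * δ * N.vartheta .mbs .sbs x *
        (N.assocProb .mbs * N.servicePDF .mbs x)) +
    ∫ x in Ioi (0 : ℝ),
      2 * N.lam .mbs * δ * N.vartheta .sbs .mbs x *
        (N.assocProb .sbs * N.servicePDF .sbs x)
  else
    (∫ x in Ioi (0 : ℝ),
      2 * N.lam .sbs * δ * N.vartheta .mbs .sbs x *
        (N.assocProb .mbs * N.servicePDF .mbs x)) +
    ∫ x in Ioi √(N.hdiff .mbs ^ 2 * N.beta .sbs .mbs - N.hdiff .sbs ^ 2),
      2 * N.lam .mbs * δ * N.vartheta .sbs .mbs x *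
        (N.assocProb .sbs * N.servicePDF .sbs x)

/-- The leading term of the area intensity divided by `2 * δ`. -/
def lengthTerm : ℝ :=
  if N.hdiff .mbs ^ 2 ≤ N.beta .mbs .sbs * N.hdiff .sbs ^ 2 then
    (∫ x in Ioi √(N.hdiff .sbs ^ 2 * N.beta .mbs .sbs - N.hdiff .mbs ^ 2),
      N.lam .sbs * N.vartheta .mbs .sbs x *
        (N.assocProb .mbs * N.servicePDF .mbs x)) +
    ∫ x in Ioi (0 : ℝ),
      N.lam .mbs * N.vartheta .sbs .mbs x *
        (N.assocProb .sbs * N.servicePDF .sbs x)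
  else
    (∫ x in Ioi (0 : ℝ),
      N.lam .sbs * N.vartheta .mbs .sbs x *
        (N.assocProb .mbs * N.servicePDF .mbs x)) +
    ∫ x in Ioi √(N.hdiff .mbs ^ 2 * N.beta .sbs .mbs - N.hdiff .sbs ^ 2),
      N.lam .mbs * N.vartheta .sbs .mbs x *
        (N.assocProb .sbs * N.servicePDF .sbs x)

end Network

end

/-! Almost surely both station sets are closed and nonempty, so the best signal of a tier comes from
its nearest station. Comparing signals then means comparing weighted squared distances, that is,
reading the sign of `gap`. Fix the nearest tier-k station p, write j for the other tier, and put β =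
β_{jk} and τ = β(‖p‖² + h_k²) − h_j². The user at the origin is served by tier k exactly if no
tier-j station z has ‖z‖² ≤ τ. Integrating this void probability against the law of ‖p‖ gives A_k
and the service density.

For a displacement v that keeps p nearest, tier j is at least as good at v exactly if some tier-j
station z satisfies ‖z‖² − τ − 2⟨v, z − βp⟩ + (1 − β)‖v‖² ≤ 0 (`sq_dist_sub_exclSq`). So, up to
O(δ²), a change of tier requires a station in a thin band around the circle of radius √τ, of width
2δH(z − βp) in ‖z‖². Optimizing over all ‖v‖ < δ gives H = norm, which describes the extended
boundary. A prescribed displacement δu gives H = ⟨u, ·⟩, which describes a handover between two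
given points. To first order the area of the band is δ times the integral over the angle of the
positive part of H on the circle, and this integral is the origin of ϑ. Averaged over the direction
u, the positive part of ⟨u, w⟩ is ‖w‖/π. This accounts for the factor 1/π between length intensity
and handover rate.

The errors are O(δ²). The relative error 1/√τ is integrable in ‖p‖. The range where τ is slightly
negative has probability O(δ) and contributes O(δ). The same holds for configurations in which a
second tier-k station competes with p (`exists_lintegral_close_pair_le`). The lemmas
`exists_cross_bounds` and `exists_first_order` combine these facts for both choices of H.

Conditioning is replaced by resampling: void probabilities determine the joint law of all distances
(`map_distPath_eq`). Hence the two tiers may be taken from independent copies of the probability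
space, and the law is invariant under isometries.

For a trajectory, the handovers visible on a uniform time grid have an expectation that is a sum of
two-point probabilities, each (1/π)μ(𝒯) times a chord length up to a quadratic error. The chords add
up to the length vT. Grid counts never exceed the handover count, and Fatou's lemma gives the other
inequality. -/

/-- Both tiers form closed nonempty sets, so that nearest stations exist. -/
def IsGood (S : Tier → Set Plane) : Prop := ∀ k, IsClosed (S k) ∧ (S k).Nonempty

/-! ### The two tiers and the comparison of their best signals -/

@[simp] lemma Tier.other_other (k : Tier) : k.other.other = k := by cases k <;> rfl

lemma Tier.other_ne (k : Tier) : k.other ≠ k := by cases k <;> simp [Tier.other]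

lemma Tier.eq_or_eq_other (k i : Tier) : i = k ∨ i = k.other := by
  cases k <;> cases i <;> simp [Tier.other]

lemma Tier.forall_iff (k : Tier) {p : Tier → Prop} : (∀ i, p i) ↔ p k ∧ p k.other :=
  ⟨fun h => ⟨h _, h _⟩, fun h i => by
    rcases Tier.eq_or_eq_other k i with rfl | rfl
    exacts [h.1, h.2]⟩

instance : Finite Tier :=
  Finite.of_injective (fun k : Tier => match k with | .mbs => true | .sbs => false) (by
    rintro ⟨⟩ ⟨⟩ h <;> simp_all)

/-- Powers with positive exponent are monotone, so the comparison passes to s-th roots; for s = η/2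
the resulting factor is β. The values u = 0 and v = 0 stand for infinite signals and need no
exception: two infinite signals tie, just as 0 < 0 fails. -/
lemma ofReal_div_rpow_lt_iff {A B s u v : ℝ} (hA : 0 < A) (hB : 0 < B) (hs : 0 < s)
    (hu : 0 ≤ u) (hv : 0 ≤ v) :
    ENNReal.ofReal B / ENNReal.ofReal (v ^ s) < ENNReal.ofReal A / ENNReal.ofReal (u ^ s) ↔
      u < (A / B) ^ (1 / s) * v := by
  have hAB : 0 < (A / B) ^ (1 / s) := by positivity
  rcases hu.eq_or_lt with rfl | hu
  · rw [Real.zero_rpow hs.ne', ENNReal.ofReal_zero, ENNReal.div_zero (by simpa using hA),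
      lt_top_iff_ne_top]
    rcases hv.eq_or_lt with rfl | hv
    · rw [Real.zero_rpow hs.ne', ENNReal.ofReal_zero, ENNReal.div_zero (by simpa using hB)]
      simp
    · have : 0 < v ^ s := by positivity
      simp only [ne_eq, ENNReal.div_eq_top, ENNReal.ofReal_eq_zero, not_le, ENNReal.ofReal_ne_top,
        false_and, or_false, not_and, this, implies_true, true_iff]
      positivity
  · have hu' : 0 < u ^ s := by positivity
    rcases hv.eq_or_lt with rfl | hv
    · rw [Real.zero_rpow hs.ne', ENNReal.ofReal_zero, ENNReal.div_zero (by simpa using hB)]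
      simp [hu.le]
    · have hv' : 0 < v ^ s := by positivity
      rw [← ENNReal.ofReal_div_of_pos hv', ← ENNReal.ofReal_div_of_pos hu',
        ENNReal.ofReal_lt_ofReal_iff (by positivity), div_lt_div_iff₀ hv' hu']
      have h1 : (A / B) ^ (1 / s) * v = (A / B * v ^ s) ^ (1 / s) := by
        rw [Real.mul_rpow (by positivity) (by positivity), ← Real.rpow_mul hv.le,
          mul_one_div_cancel hs.ne', Real.rpow_one]
      have h2 : u = (u ^ s) ^ (1 / s) := by
        rw [← Real.rpow_mul hu.le, mul_one_div_cancel hs.ne', Real.rpow_one]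
      rw [h1]
      nth_rw 2 [h2]
      rw [Real.rpow_lt_rpow_iff (by positivity) (by positivity) (by positivity), div_mul_eq_mul_div,
        lt_div_iff₀ hB, mul_comm]

namespace Network

variable (N : Network)

lemma biasPower_pos (k : Tier) : 0 < N.bias k * N.power k := mul_pos (N.bias_pos k) (N.power_pos k)

lemma eta_pos : 0 < N.eta := by linarith [N.eta_gt_two]

lemma beta_pos (k j : Tier) : 0 < N.beta k j :=
  Real.rpow_pos_of_pos (div_pos (N.biasPower_pos k) (N.biasPower_pos j)) _

lemma beta_mul_beta (k j : Tier) : N.beta k j * N.beta j k = 1 := by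
  have hk := N.biasPower_pos k
  have hj := N.biasPower_pos j
  unfold beta
  rw [← Real.mul_rpow (by positivity) (by positivity), div_mul_div_cancel₀ hj.ne', div_self hk.ne',
    Real.one_rpow]

lemma beta_eq_inv (k j : Tier) : N.beta k j = (N.beta j k)⁻¹ :=
  eq_inv_of_mul_eq_one_left (N.beta_mul_beta k j)

/-- The signal decreases with the distance, and in a closed nonempty set the nearest station exists,
so the supremum is attained there. -/
lemma bestSignal_eq (k : Tier) {S : Set Plane} (hS : IsClosed S) (hne : S.Nonempty) (x : Plane) :
    N.bestSignal k S x = ENNReal.ofReal (N.bias k * N.power k) /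
      ENNReal.ofReal ((Metric.infDist x S ^ 2 + N.hdiff k ^ 2) ^ (N.eta / 2)) := by
  have hη := N.eta_pos
  apply le_antisymm
  · refine iSup₂_le fun p hp => ?_
    unfold signal
    gcongr
    · exact Metric.infDist_nonneg
    · exact Metric.infDist_le_dist_of_mem hp
  · obtain ⟨p, hp, h⟩ := hS.exists_infDist_eq_dist hne x
    rw [h]
    exact le_iSup₂ (f := fun p _ => N.signal k p x) p hp

/-- The excess of the (squared, weighted) distance to the nearest station of tier `k` over that to
the nearest station of the other tier, as a function of the horizontal distances. -/
noncomputable def gap (k : Tier) (r r' : ℝ) : ℝ :=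
  r ^ 2 + N.hdiff k ^ 2 - N.beta k k.other * (r' ^ 2 + N.hdiff k.other ^ 2)

lemma mem_servedBy_iff {S : Tier → Set Plane} (hS : IsGood S) (k : Tier) (x : Plane) :
    x ∈ N.servedBy S k ↔
      N.gap k (Metric.infDist x (S k)) (Metric.infDist x (S k.other)) < 0 := by
  unfold servedBy
  rw [mem_ofPred_eq, N.bestSignal_eq k (hS k).1 (hS k).2, N.bestSignal_eq _ (hS _).1 (hS _).2,
    ofReal_div_rpow_lt_iff (N.biasPower_pos k) (N.biasPower_pos _) (half_pos N.eta_pos)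
      (by positivity) (by positivity), gap, sub_neg, one_div_div]
  rfl

lemma gap_other (k : Tier) (r r' : ℝ) :
    N.gap k.other r' r = - N.beta k.other k * N.gap k r r' := by
  unfold gap
  rw [Tier.other_other]
  linear_combination (r' ^ 2 + N.hdiff k.other ^ 2) * N.beta_mul_beta k.other k * (-1)

lemma mem_boundary_iff_not {S : Tier → Set Plane} (k : Tier) (x : Plane) :
    x ∈ N.boundary S ↔ x ∉ N.servedBy S k ∧ x ∉ N.servedBy S k.other := by
  cases k <;> simp only [boundary, servedBy, Tier.other, mem_ofPred_eq, not_lt]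
  · exact ⟨fun h => ⟨h.le, h.ge⟩, fun h => le_antisymm h.1 h.2⟩
  · exact ⟨fun h => ⟨h.ge, h.le⟩, fun h => le_antisymm h.2 h.1⟩

lemma mem_boundary_iff {S : Tier → Set Plane} (hS : IsGood S) (k : Tier) (x : Plane) :
    x ∈ N.boundary S ↔
      N.gap k (Metric.infDist x (S k)) (Metric.infDist x (S k.other)) = 0 := by
  rw [N.mem_boundary_iff_not k, N.mem_servedBy_iff hS, N.mem_servedBy_iff hS, gap_other,
    Tier.other_other]
  have := N.beta_pos k.other k
  set g := N.gap k (Metric.infDist x (S k)) (Metric.infDist x (S k.other))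
  constructor
  · rintro ⟨h1, h2⟩
    push Not at h1 h2
    nlinarith
  · rintro h
    simp [h]

lemma disjoint_servedBy (S : Tier → Set Plane) (k : Tier) :
    Disjoint (N.servedBy S k) (N.servedBy S k.other) := by
  rw [Set.disjoint_left]
  intro x h1 h2
  simp only [servedBy, mem_ofPred_eq, Tier.other_other] at h1 h2
  exact lt_asymm h1 h2

lemma continuous_gap (S : Tier → Set Plane) (k : Tier) :
    Continuous fun x => N.gap k (Metric.infDist x (S k)) (Metric.infDist x (S k.other)) := by
  unfold gap
  have := Metric.continuous_infDist_pt (S k)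
  have := Metric.continuous_infDist_pt (S k.other)
  fun_prop

lemma isOpen_servedBy {S : Tier → Set Plane} (hS : IsGood S) (k : Tier) :
    IsOpen (N.servedBy S k) := by
  have : N.servedBy S k =
      {x | N.gap k (Metric.infDist x (S k)) (Metric.infDist x (S k.other)) < 0} := by
    ext x; exact N.mem_servedBy_iff hS k x
  rw [this]
  exact isOpen_lt (N.continuous_gap S k) continuous_const

/-- A ball is connected and the gap is continuous, so a zero exists once both weak signs occur. The
equation is thereby replaced by two inequalities, and when the centre is served by tier k only the
first of them is a condition. -/
lemma mem_extBoundary_iff {S : Tier → Set Plane} (hS : IsGood S) (k : Tier) (x : Plane) (δ : ℝ) :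
    x ∈ N.extBoundary S δ ↔
      (∃ v ∈ Metric.ball x δ,
        0 ≤ N.gap k (Metric.infDist v (S k)) (Metric.infDist v (S k.other))) ∧
      (∃ v ∈ Metric.ball x δ,
        N.gap k (Metric.infDist v (S k)) (Metric.infDist v (S k.other)) ≤ 0) := by
  unfold extBoundary
  simp only [mem_ofPred_eq, Metric.mem_ball, N.mem_boundary_iff hS k]
  constructor
  · rintro ⟨v, h0, hv⟩
    rw [dist_comm] at hv
    exact ⟨⟨v, hv, h0.ge⟩, ⟨v, hv, h0.le⟩⟩
  · rintro ⟨⟨u, hu, hu0⟩, ⟨v, hv, hv0⟩⟩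
    obtain ⟨w, hw, h⟩ := (convex_ball x δ).isPreconnected.intermediate_value
      (Metric.mem_ball.2 hv) (Metric.mem_ball.2 hu) (N.continuous_gap S k).continuousOn
      ⟨hv0, hu0⟩
    exact ⟨w, h, by rw [dist_comm]; exact hw⟩

end Network

/-! ### Void probabilities and almost sure regularity of a Poisson process -/

section Poisson

variable {Ω : Type*} {Φ : Ω → Set Plane}

lemma pointCount_eq_zero_iff {A : Set Plane} {ω : Ω} :
    pointCount Φ A ω = 0 ↔ Φ ω ∩ A = ∅ := Set.encard_eq_zero

lemma measurable_pointCount_pointSigma {A : Set Plane} (hA : MeasurableSet A) :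
    Measurable[pointSigma Φ] (pointCount Φ A) :=
  Measurable.mono (comap_measurable _)
    (le_iSup (fun A : {A : Set Plane // MeasurableSet A} =>
      MeasurableSpace.comap (pointCount Φ A.1) inferInstance) ⟨A, hA⟩) le_rfl

lemma measurableSet_void_pointSigma {A : Set Plane} (hA : MeasurableSet A) :
    MeasurableSet[pointSigma Φ] {ω | Φ ω ∩ A = ∅} := by
  have : {ω | Φ ω ∩ A = ∅} = pointCount Φ A ⁻¹' {0} := by
    ext ω; simp [pointCount_eq_zero_iff]
  rw [this]
  exact measurable_pointCount_pointSigma hA (measurableSet_singleton _)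

/-- The extended distance to the empty set is ∞, so no nonemptiness is required, unlike for the real
distance, which is then 0. -/
lemma le_infEDist_iff_void {S : Set Plane} {q : Plane} {r : ℝ≥0∞} :
    r ≤ Metric.infEDist q S ↔ S ∩ Metric.eball q r = ∅ := by
  rw [Metric.le_infEDist, Set.eq_empty_iff_forall_notMem]
  simp only [mem_inter_iff, Metric.mem_eball, not_and, not_lt, edist_comm q]

lemma measurable_infEDist_pointSigma (q : Plane) :
    Measurable[pointSigma Φ] fun ω => Metric.infEDist q (Φ ω) := by
  refine @measurable_of_Ici _ _ _ _ _ (pointSigma Φ) _ _ _ _ fun r => ?_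
  have : (fun ω => Metric.infEDist q (Φ ω)) ⁻¹' Ici r = {ω | Φ ω ∩ Metric.eball q r = ∅} := by
    ext ω; simp [le_infEDist_iff_void]
  rw [this]
  exact measurableSet_void_pointSigma Metric.isOpen_eball.measurableSet

namespace IsPoissonPointProcess

variable [MeasurableSpace Ω] {P : Measure Ω} {lam : ℝ}

lemma pointSigma_le (h : IsPoissonPointProcess P Φ lam) :
    pointSigma Φ ≤ (inferInstance : MeasurableSpace Ω) :=
  iSup_le fun A => (h.measurable_count A.1 A.2).comap_le

lemma measurableSet_void (h : IsPoissonPointProcess P Φ lam) {A : Set Plane}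
    (hA : MeasurableSet A) : MeasurableSet {ω | Φ ω ∩ A = ∅} :=
  h.pointSigma_le _ (measurableSet_void_pointSigma hA)

lemma measurable_infEDist (h : IsPoissonPointProcess P Φ lam) (q : Plane) :
    Measurable fun ω => Metric.infEDist q (Φ ω) :=
  (measurable_infEDist_pointSigma q).mono h.pointSigma_le le_rfl

lemma measurable_infDist (h : IsPoissonPointProcess P Φ lam) (q : Plane) :
    Measurable fun ω => Metric.infDist q (Φ ω) :=
  (h.measurable_infEDist q).ennreal_toReal

lemma void_prob (h : IsPoissonPointProcess P Φ lam) (hl : 0 < lam) {A : Set Plane}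
    (hA : MeasurableSet A) (hb : Bornology.IsBounded A) :
    P {ω | Φ ω ∩ A = ∅} = ENNReal.ofReal (Real.exp (-(lam * (volume A).toReal))) := by
  have := h.count_law A hA hb 0
  simp only [Nat.cast_zero, pointCount_eq_zero_iff] at this
  rw [this, poissonMeasure_singleton]
  congr 1
  rw [Real.coe_toNNReal _ (by positivity)]
  simp

lemma void_ball (h : IsPoissonPointProcess P Φ lam) (hl : 0 < lam) (q : Plane) {r : ℝ}
    (hr : 0 ≤ r) :
    P {ω | Φ ω ∩ Metric.ball q r = ∅} = ENNReal.ofReal (Real.exp (-(π * lam * r ^ 2))) := by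
  rw [h.void_prob hl measurableSet_ball Metric.isBounded_ball, EuclideanSpace.volume_ball_fin_two]
  congr 3
  rw [ENNReal.toReal_mul, ENNReal.toReal_pow, ENNReal.toReal_ofReal hr,
    ENNReal.toReal_ofReal Real.pi_pos.le]
  ring

/-- Counts take values in `ℕ∞`, but the Poisson masses of the natural numbers already sum to 1 and
leave nothing for the value ∞. -/
lemma ae_finite [IsProbabilityMeasure P] (h : IsPoissonPointProcess P Φ lam) {A : Set Plane}
    (hA : MeasurableSet A) (hb : Bornology.IsBounded A) : ∀ᵐ ω ∂P, (Φ ω ∩ A).Finite := by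
  have hm := h.measurable_count A hA
  have : P {ω | ∃ n : ℕ, pointCount Φ A ω = n} = 1 := by
    have : {ω | ∃ n : ℕ, pointCount Φ A ω = n} = ⋃ n : ℕ, pointCount Φ A ⁻¹' {(n : ℕ∞)} := by
      ext ω; simp
    rw [this, measure_iUnion (fun i j hij => Disjoint.preimage _ (by simpa using hij))
      (fun n => hm (measurableSet_singleton _))]
    have h1 : ∀ n : ℕ, P (pointCount Φ A ⁻¹' {(n : ℕ∞)}) =
        poissonMeasure (Real.toNNReal (lam * (volume A).toReal)) {n} := fun n =>
      h.count_law A hA hb n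
    simp_rw [h1]
    rw [← measure_iUnion (fun i j hij => by simpa using hij) (fun n => measurableSet_singleton _)]
    have : (⋃ i : ℕ, {i}) = (univ : Set ℕ) := by ext; simp
    rw [this, measure_univ]
  have h2 := (prob_compl_eq_zero_iff (μ := P) (s := {ω | ∃ n : ℕ, pointCount Φ A ω = n}) (by
    have : {ω | ∃ n : ℕ, pointCount Φ A ω = n} = ⋃ n : ℕ, pointCount Φ A ⁻¹' {(n : ℕ∞)} := by
      ext ω; simp
    rw [this]
    exact MeasurableSet.iUnion fun n => hm (measurableSet_singleton _))).2 this
  filter_upwards [compl_mem_ae_iff.2 h2] with ω hω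
  simp only [compl_compl, mem_ofPred_eq] at hω
  obtain ⟨n, hn⟩ := hω
  exact Set.finite_of_encard_eq_coe hn

/-- A set with finitely many points in every ball of integer radius contains all its limit points.
-/
lemma ae_isClosed [IsProbabilityMeasure P] (h : IsPoissonPointProcess P Φ lam) :
    ∀ᵐ ω ∂P, IsClosed (Φ ω) := by
  have : ∀ᵐ ω ∂P, ∀ n : ℕ, (Φ ω ∩ Metric.closedBall 0 n).Finite :=
    ae_all_iff.2 fun n => h.ae_finite measurableSet_closedBall Metric.isBounded_closedBall
  filter_upwards [this] with ω hω
  refine isClosed_of_closure_subset fun x hx => ?_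
  obtain ⟨n, hn⟩ := exists_nat_gt ‖x‖
  have h1 : x ∈ closure (Φ ω ∩ Metric.closedBall 0 n) := by
    rw [mem_closure_iff_nhds] at hx ⊢
    intro t ht
    have : Metric.ball 0 (n : ℝ) ∈ 𝓝 x := Metric.isOpen_ball.mem_nhds (by simpa using hn)
    obtain ⟨y, hy, hy'⟩ := hx _ (inter_mem ht this)
    exact ⟨y, hy.1, hy', Metric.ball_subset_closedBall hy.2⟩
  rw [(hω n).isClosed.closure_eq] at h1
  exact h1.1

lemma ae_nonempty [IsProbabilityMeasure P] (h : IsPoissonPointProcess P Φ lam) (hl : 0 < lam) :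
    ∀ᵐ ω ∂P, (Φ ω).Nonempty := by
  have h0 : P {ω | Φ ω = ∅} = 0 := by
    refine le_antisymm (ge_of_tendsto' (x := atTop)
      (f := fun n : ℕ => ENNReal.ofReal (Real.exp (-(π * lam * (n : ℝ) ^ 2)))) ?_ fun n => ?_)
      zero_le
    · rw [← ENNReal.ofReal_zero]
      refine ENNReal.tendsto_ofReal (Real.tendsto_exp_neg_atTop_nhds_zero.comp ?_)
      exact Tendsto.const_mul_atTop (by positivity)
        ((tendsto_pow_atTop two_ne_zero).comp tendsto_natCast_atTop_atTop)
    · rw [← h.void_ball hl 0 (Nat.cast_nonneg n)]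
      refine measure_mono fun ω (hω : Φ ω = ∅) => ?_
      simp [hω]
  filter_upwards [compl_mem_ae_iff.2 h0] with ω hω
  exact Set.nonempty_iff_ne_empty.2 hω

end IsPoissonPointProcess
end Poisson

/-! ### The distance to the nearest station -/

/-- The law of the distance from a point to the nearest point of a Poisson process of
intensity `lam`. -/
noncomputable def contactLaw (lam : ℝ) : Measure ℝ :=
  (volume.restrict (Ioi 0)).withDensity
    fun r => ENNReal.ofReal (2 * π * lam * r * Real.exp (-(π * lam * r ^ 2)))

lemma hasDerivAt_exp_neg_sq (c x : ℝ) :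
    HasDerivAt (fun r => -Real.exp (-(c * r ^ 2))) (2 * c * x * Real.exp (-(c * x ^ 2))) x := by
  have h : HasDerivAt (fun r => -Real.exp (-(c * r ^ 2)))
      (-(Real.exp (-(c * x ^ 2)) * -(c * (((2 : ℕ) : ℝ) * x ^ (2 - 1))))) x :=
    (((hasDerivAt_pow 2 x).const_mul c).neg.exp).neg
  have e : 2 * c * x * Real.exp (-(c * x ^ 2)) =
      -(Real.exp (-(c * x ^ 2)) * -(c * (((2 : ℕ) : ℝ) * x ^ (2 - 1)))) := by
    norm_num
    ring
  rw [e]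
  exact h

lemma tendsto_neg_exp_neg_sq {c : ℝ} (hc : 0 < c) :
    Tendsto (fun r => -Real.exp (-(c * r ^ 2))) atTop (𝓝 0) := by
  rw [← neg_zero]
  refine (Real.tendsto_exp_neg_atTop_nhds_zero.comp ?_).neg
  exact Tendsto.const_mul_atTop hc (tendsto_pow_atTop two_ne_zero)

lemma integrableOn_mul_exp_neg_sq {c : ℝ} (hc : 0 < c) {a : ℝ} (ha : 0 ≤ a) :
    IntegrableOn (fun r => 2 * c * r * Real.exp (-(c * r ^ 2))) (Ioi a) :=
  integrableOn_Ioi_deriv_of_nonneg' (fun x _ => hasDerivAt_exp_neg_sq c x)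
    (fun x hx => by have : 0 < x := ha.trans_lt hx; positivity) (tendsto_neg_exp_neg_sq hc)

lemma integral_mul_exp_neg_sq {c : ℝ} (hc : 0 < c) {a : ℝ} (ha : 0 ≤ a) :
    ∫ r in Ioi a, 2 * c * r * Real.exp (-(c * r ^ 2)) = Real.exp (-(c * a ^ 2)) := by
  rw [integral_Ioi_of_hasDerivAt_of_nonneg' (fun x _ => hasDerivAt_exp_neg_sq c x)
    (fun x hx => by have : 0 < x := ha.trans_lt hx; positivity) (tendsto_neg_exp_neg_sq hc)]
  simp

lemma lintegral_mul_exp_neg_sq {c : ℝ} (hc : 0 < c) {a : ℝ} (ha : 0 ≤ a) :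
    ∫⁻ r in Ioi a, ENNReal.ofReal (2 * c * r * Real.exp (-(c * r ^ 2))) =
      ENNReal.ofReal (Real.exp (-(c * a ^ 2))) := by
  rw [← integral_mul_exp_neg_sq hc ha, ofReal_integral_eq_lintegral_ofReal
    (integrableOn_mul_exp_neg_sq hc ha)]
  filter_upwards [ae_restrict_mem measurableSet_Ioi] with r hr
  have : 0 < r := ha.trans_lt hr
  positivity

lemma contactLaw_Ioi {lam : ℝ} (hl : 0 < lam) {a : ℝ} (ha : 0 ≤ a) :
    contactLaw lam (Ioi a) = ENNReal.ofReal (Real.exp (-(π * lam * a ^ 2))) := by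
  rw [contactLaw, withDensity_apply _ measurableSet_Ioi, Measure.restrict_restrict measurableSet_Ioi,
    Ioi_inter_Ioi, max_eq_left ha, ← lintegral_mul_exp_neg_sq (by positivity) ha]
  simp only [mul_assoc]

lemma contactLaw_Ioi_of_neg {lam : ℝ} {a : ℝ} (ha : a ≤ 0) :
    contactLaw lam (Ioi a) = contactLaw lam (Ioi 0) := by
  rw [contactLaw, withDensity_apply _ measurableSet_Ioi, withDensity_apply _ measurableSet_Ioi,
    Measure.restrict_restrict measurableSet_Ioi, Measure.restrict_restrict measurableSet_Ioi,
    Ioi_inter_Ioi, Ioi_inter_Ioi, max_eq_right ha, max_self]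

lemma contactLaw_ac (lam : ℝ) : contactLaw lam ≪ volume :=
  (withDensity_absolutelyContinuous _ _).trans Measure.absolutelyContinuous_restrict

lemma contactLaw_Ici (lam : ℝ) (a : ℝ) : contactLaw lam (Ici a) = contactLaw lam (Ioi a) :=
  measure_congr ((contactLaw_ac lam).ae_le Ioi_ae_eq_Ici.symm)

lemma contactLaw_univ {lam : ℝ} (hl : 0 < lam) : contactLaw lam univ = 1 := by
  have h : contactLaw lam univ = contactLaw lam (Ioi 0) := by
    rw [contactLaw, withDensity_apply _ MeasurableSet.univ, withDensity_apply _ measurableSet_Ioi,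
      Measure.restrict_restrict measurableSet_Ioi, Measure.restrict_univ, Ioi_inter_Ioi, max_self]
  rw [h, contactLaw_Ioi hl le_rfl]
  simp

lemma isProbabilityMeasure_contactLaw {lam : ℝ} (hl : 0 < lam) :
    IsProbabilityMeasure (contactLaw lam) := ⟨contactLaw_univ hl⟩

lemma infDist_lt_iff_inter_nonempty {S : Set Plane} (hne : S.Nonempty) {q : Plane} {r : ℝ} :
    r ≤ Metric.infDist q S ↔ S ∩ Metric.ball q r = ∅ := by
  rw [Metric.le_infDist hne, Set.eq_empty_iff_forall_notMem]
  simp only [mem_inter_iff, Metric.mem_ball, not_and, not_lt, dist_comm q]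

/-- The tails determine the law: the nearest point is at distance at least a exactly if the open
ball of radius a is void. For a ≤ 0 both tails equal 1. -/
lemma IsPoissonPointProcess.map_infDist {Ω : Type*} {Φ : Ω → Set Plane} [MeasurableSpace Ω]
    {P : Measure Ω} {lam : ℝ} [IsProbabilityMeasure P] (h : IsPoissonPointProcess P Φ lam)
    (hl : 0 < lam) (q : Plane) :
    P.map (fun ω => Metric.infDist q (Φ ω)) = contactLaw lam := by
  have := isProbabilityMeasure_contactLaw hl
  have := Measure.isProbabilityMeasure_map (μ := P) (h.measurable_infDist q).aemeasurable
  refine Measure.ext_of_Ici _ _ fun a => ?_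
  rw [Measure.map_apply (h.measurable_infDist q) measurableSet_Ici, contactLaw_Ici]
  rcases le_total a 0 with ha | ha
  · rw [contactLaw_Ioi_of_neg ha, contactLaw_Ioi hl le_rfl]
    have : (fun ω => Metric.infDist q (Φ ω)) ⁻¹' Ici a = univ := by
      ext ω; simpa using ha.trans Metric.infDist_nonneg
    rw [this]; simp
  · rw [contactLaw_Ioi hl ha, ← h.void_ball hl q ha]
    refine measure_congr ?_
    filter_upwards [h.ae_nonempty hl] with ω hω
    exact propext (infDist_lt_iff_inter_nonempty hω)

/-! ### Two stations at almost the same minimal distance are rare -/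

lemma exists_pow_mul_exp_neg_sq_le (n : ℕ) {c : ℝ} (hc : 0 < c) :
    ∃ K : ℝ, 0 < K ∧ ∀ y : ℝ, 0 ≤ y → (1 + y) ^ n * Real.exp (-(c * y ^ 2)) ≤ K * Real.exp (-y) := by
  refine ⟨n.factorial * Real.exp (1 + 1 / c), by positivity, fun y hy => ?_⟩
  have h1 : (1 + y) ^ n ≤ n.factorial * Real.exp (1 + y) := by
    have := Real.pow_div_factorial_le_exp (1 + y) (by positivity) n
    rwa [div_le_iff₀ (by positivity), mul_comm] at this
  calc (1 + y) ^ n * Real.exp (-(c * y ^ 2))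
      ≤ n.factorial * Real.exp (1 + y) * Real.exp (-(c * y ^ 2)) := by gcongr
    _ = n.factorial * Real.exp (1 + y + -(c * y ^ 2)) := by rw [mul_assoc, ← Real.exp_add]
    _ ≤ n.factorial * Real.exp (1 + 1 / c + -y) := by
        refine mul_le_mul_of_nonneg_left (Real.exp_le_exp.2 ?_) (by positivity)
        -- Completing the square: 2y − cy² ≤ 1/c.
        have : 0 ≤ (c * y - 1) ^ 2 / c := by positivity
        have e : (c * y - 1) ^ 2 / c = c * y ^ 2 - 2 * y + 1 / c := by field_simp; ring
        linarith
    _ = _ := by rw [Real.exp_add, mul_assoc]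

/-- Apart from its missing factor δ, the sum is a Riemann sum of mesh δ for the integral of exp(−t),
hence of order 1/δ. -/
lemma tsum_exp_neg_mul_le {δ : ℝ} (h0 : 0 < δ) (h1 : δ ≤ 1) :
    ∑' i : ℕ, ENNReal.ofReal (Real.exp (-(i * δ))) ≤ ENNReal.ofReal (2 / δ) := by
  have hlt : Real.exp (-δ) < 1 := by simpa using h0
  have e : ∀ i : ℕ, Real.exp (-(i * δ)) = Real.exp (-δ) ^ i := fun i => by
    rw [← Real.exp_nat_mul]; ring_nf
  simp_rw [e]
  have hs := summable_geometric_of_lt_one (Real.exp_nonneg (-δ)) hlt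
  rw [← ENNReal.ofReal_tsum_of_nonneg (fun n => by positivity) hs,
    tsum_geometric_of_lt_one (Real.exp_nonneg (-δ)) hlt]
  refine ENNReal.ofReal_le_ofReal ?_
  have h2 : Real.exp (-δ) ≤ 1 / (1 + δ) := by
    rw [Real.exp_neg, inv_eq_one_div]
    exact one_div_le_one_div_of_le (by positivity) (by linarith [Real.add_one_le_exp δ])
  have h3 : δ / 2 ≤ 1 - Real.exp (-δ) := by
    have : 1 / (1 + δ) ≤ 1 - δ / 2 := by
      rw [div_le_iff₀ (by positivity)]
      nlinarith
    linarith
  calc (1 - Real.exp (-δ))⁻¹ ≤ (δ / 2)⁻¹ := inv_anti₀ (by positivity) h3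
    _ = 2 / δ := by rw [inv_div]

namespace IsPoissonPointProcess

variable {Ω : Type*} {Φ : Ω → Set Plane} [MeasurableSpace Ω] {P : Measure Ω} {lam : ℝ}

lemma two_le_count (h : IsPoissonPointProcess P Φ lam) [IsProbabilityMeasure P] (hl : 0 < lam)
    {A : Set Plane} (hA : MeasurableSet A) (hb : Bornology.IsBounded A) :
    P {ω | 2 ≤ pointCount Φ A ω} ≤ ENNReal.ofReal ((lam * (volume A).toReal) ^ 2) := by
  set μ := lam * (volume A).toReal with hμ
  have hμ0 : 0 ≤ μ := by positivity
  have hm := h.measurable_count A hA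
  have h0 := h.count_law A hA hb 0
  have h1 := h.count_law A hA hb 1
  rw [poissonMeasure_singleton, Real.coe_toNNReal _ hμ0] at h0 h1
  have hset : {ω | 2 ≤ pointCount Φ A ω} =
      ({ω | pointCount Φ A ω = (0 : ℕ)} ∪ {ω | pointCount Φ A ω = (1 : ℕ)})ᶜ := by
    ext ω
    simp only [mem_ofPred_eq, mem_compl_iff, mem_union, not_or]
    generalize pointCount Φ A ω = c
    induction c using ENat.recTopCoe with
    | top => simp
    | coe n =>
      norm_cast
      omega
  have m0 : MeasurableSet {ω | pointCount Φ A ω = (0 : ℕ)} := hm (measurableSet_singleton _)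
  have m1 : MeasurableSet {ω | pointCount Φ A ω = (1 : ℕ)} := hm (measurableSet_singleton _)
  have hd : Disjoint {ω | pointCount Φ A ω = (0 : ℕ)} {ω | pointCount Φ A ω = (1 : ℕ)} := by
    rw [Set.disjoint_left]
    intro ω h2 h3
    rw [mem_ofPred_eq] at h2 h3
    rw [h2] at h3
    simp at h3
  rw [hset, prob_compl_eq_one_sub (m0.union m1), measure_union hd m1, h0, h1,
    ← ENNReal.ofReal_add (by positivity) (by positivity), ← ENNReal.ofReal_one,
    ← ENNReal.ofReal_sub _ (by positivity)]
  refine ENNReal.ofReal_le_ofReal ?_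
  simp only [pow_zero, Nat.factorial, pow_one]
  -- From exp(−μ) ≥ 1 − μ follows 1 − exp(−μ)(1 + μ) ≤ 1 − (1 − μ)(1 + μ) = μ².
  have := Real.add_one_le_exp (-μ)
  push_cast
  nlinarith

lemma void_and_two_le_count (h : IsPoissonPointProcess P Φ lam) [IsProbabilityMeasure P]
    (hl : 0 < lam) {r s : ℝ} (hr : 0 ≤ r) (hrs : r ≤ s) :
    P {ω | Φ ω ∩ Metric.ball 0 r = ∅ ∧ 2 ≤ pointCount Φ (Metric.ball 0 s \ Metric.ball 0 r) ω} ≤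
      ENNReal.ofReal (Real.exp (-(π * lam * r ^ 2)) * (lam * (π * (s ^ 2 - r ^ 2))) ^ 2) := by
  set A : Fin 2 → Set Plane := ![Metric.ball 0 r, Metric.ball 0 s \ Metric.ball 0 r] with hA
  have hbd : Bornology.IsBounded (Metric.ball (0 : Plane) s \ Metric.ball 0 r) :=
    Metric.isBounded_ball.subset sdiff_subset
  have hms : MeasurableSet (Metric.ball (0 : Plane) s \ Metric.ball 0 r) :=
    measurableSet_ball.diff measurableSet_ball
  have hi := h.count_indep 2 A
    (by intro i; fin_cases i; exacts [measurableSet_ball, hms])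
    (by intro i; fin_cases i; exacts [Metric.isBounded_ball, hbd])
    (by
      intro i j hij
      fin_cases i <;> fin_cases j
      · exact absurd rfl hij
      · exact disjoint_sdiff_right
      · exact disjoint_sdiff_left
      · exact absurd rfl hij)
  have hi2 := hi.indepFun (i := 0) (j := 1) (by simp)
  have h3 := hi2.measure_inter_preimage_eq_mul {0} {n | 2 ≤ n} (measurableSet_singleton _)
    (MeasurableSet.of_discrete)
  have e : {ω | Φ ω ∩ Metric.ball 0 r = ∅ ∧
      2 ≤ pointCount Φ (Metric.ball 0 s \ Metric.ball 0 r) ω} =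
      pointCount Φ (A 0) ⁻¹' {0} ∩ pointCount Φ (A 1) ⁻¹' {n | 2 ≤ n} := by
    ext ω
    simp [hA, pointCount_eq_zero_iff]
  have e0 : pointCount Φ (A 0) ⁻¹' {0} = {ω | Φ ω ∩ Metric.ball 0 r = ∅} := by
    ext ω; simp [hA, pointCount_eq_zero_iff]
  have hv : (volume (Metric.ball (0 : Plane) s \ Metric.ball 0 r)).toReal =
      π * (s ^ 2 - r ^ 2) := by
    rw [measure_sdiff (Metric.ball_subset_ball hrs) measurableSet_ball.nullMeasurableSet
      measure_ball_lt_top.ne, EuclideanSpace.volume_ball_fin_two,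
      EuclideanSpace.volume_ball_fin_two, ← ENNReal.ofReal_pow hr, ← ENNReal.ofReal_pow (hr.trans hrs),
      ← ENNReal.ofReal_mul (by positivity), ← ENNReal.ofReal_mul (by positivity),
      ← ENNReal.ofReal_sub _ (by positivity), ENNReal.toReal_ofReal]
    · ring
    · have : r ^ 2 ≤ s ^ 2 := by gcongr
      nlinarith [Real.pi_pos]
  rw [e, h3, e0, h.void_ball hl 0 hr, ENNReal.ofReal_mul (by positivity)]
  gcongr
  have := h.two_le_count hl hms hbd
  rwa [hv] at this

/-- Two points are rarely at almost the same minimal distance from the origin. -/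
lemma exists_lintegral_close_pair_le (h : IsPoissonPointProcess P Φ lam) [IsProbabilityMeasure P]
    (hl : 0 < lam) : ∃ K : ℝ, 0 < K ∧ ∀ δ : ℝ, 0 < δ → δ ≤ 1 → ∃ g : Ω → ℝ≥0∞, Measurable g ∧
      ∫⁻ ω, g ω ∂P ≤ ENNReal.ofReal (K * δ) ∧
      ∀ ω, ∀ p ∈ Φ ω, ∀ p' ∈ Φ ω, p ≠ p' → ‖p‖ = Metric.infDist 0 (Φ ω) →
        ‖p'‖ < ‖p‖ + 2 * δ → ENNReal.ofReal (1 + ‖p‖) ≤ g ω := by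
  obtain ⟨K, hK, hKy⟩ := exists_pow_mul_exp_neg_sq_le 3 (c := π * lam) (by positivity)
  refine ⟨2 * (2 * (lam * π * 9) ^ 2 * K), by positivity, fun δ h0 h1 => ?_⟩
  -- If the minimal norm lies in [iδ, (i+1)δ), the inner ball is void and a second point less than
  -- 2δ farther out still lies in the ball of radius (i+3)δ. Each `E i` has probability O(δ²) times
  -- a Gaussian weight, and about 1/δ indices matter, so the total is O(δ).
  set E : ℕ → Set Ω := fun i => {ω | Φ ω ∩ Metric.ball 0 (i * δ) = ∅ ∧
    2 ≤ pointCount Φ (Metric.ball 0 ((i + 3) * δ) \ Metric.ball 0 (i * δ)) ω} with hE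
  have hEm : ∀ i, MeasurableSet (E i) := fun i =>
    (h.measurableSet_void measurableSet_ball).inter
      (h.measurable_count _ (measurableSet_ball.diff measurableSet_ball)
        (MeasurableSet.of_discrete (s := {n | 2 ≤ n})))
  refine ⟨fun ω => ∑' i : ℕ, (E i).indicator (fun _ => ENNReal.ofReal (1 + (i + 1) * δ)) ω,
    Measurable.tsum fun i => measurable_const.indicator (hEm i), ?_, ?_⟩
  · rw [lintegral_tsum fun i => (measurable_const.indicator (hEm i)).aemeasurable]
    have hterm : ∀ i : ℕ, ∫⁻ ω, (E i).indicator (fun _ => ENNReal.ofReal (1 + (i + 1) * δ)) ω ∂P ≤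
        ENNReal.ofReal (2 * (lam * π * 9) ^ 2 * K * δ ^ 2) *
          ENNReal.ofReal (Real.exp (-(i * δ))) := by
      intro i
      rw [lintegral_indicator_const (hEm i)]
      refine (mul_le_mul_right (h.void_and_two_le_count hl (r := i * δ) (s := (i + 3) * δ)
        (by positivity) (by gcongr; linarith)) _).trans ?_
      rw [← ENNReal.ofReal_mul (by positivity), ← ENNReal.ofReal_mul (by positivity)]
      refine ENNReal.ofReal_le_ofReal ?_
      set y := (i : ℝ) * δ with hy
      have hy0 : 0 ≤ y := by positivity
      have e1 : (i + 1) * δ = y + δ := by ring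
      have e2 : ((i + 3) * δ) ^ 2 - y ^ 2 = δ * (6 * y + 9 * δ) := by rw [hy]; ring
      rw [e1, e2]
      have b1 : 1 + (y + δ) ≤ 2 * (1 + y) := by linarith
      have b2 : δ * (6 * y + 9 * δ) ≤ δ * (9 * (1 + y)) := by gcongr; linarith
      calc (1 + (y + δ)) * (Real.exp (-(π * lam * y ^ 2)) *
              (lam * (π * (δ * (6 * y + 9 * δ)))) ^ 2)
          ≤ (2 * (1 + y)) * (Real.exp (-(π * lam * y ^ 2)) *
              (lam * (π * (δ * (9 * (1 + y))))) ^ 2) := by gcongr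
        _ = 2 * (lam * π * 9) ^ 2 * δ ^ 2 *
              ((1 + y) ^ 3 * Real.exp (-(π * lam * y ^ 2))) := by ring
        _ ≤ 2 * (lam * π * 9) ^ 2 * δ ^ 2 * (K * Real.exp (-y)) := by
            exact mul_le_mul_of_nonneg_left (hKy y hy0) (by positivity)
        _ = _ := by ring
    refine (ENNReal.tsum_le_tsum hterm).trans ?_
    rw [ENNReal.tsum_mul_left]
    refine (mul_le_mul_right (tsum_exp_neg_mul_le h0 h1) _).trans ?_
    rw [← ENNReal.ofReal_mul (by positivity)]
    refine ENNReal.ofReal_le_ofReal (le_of_eq ?_)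
    field_simp
  · intro ω p hp p' hp' hne hpR hp'R
    set i := ⌊‖p‖ / δ⌋₊ with hi
    have hi1 : i * δ ≤ ‖p‖ := by
      rw [← le_div_iff₀ h0]; exact Nat.floor_le (by positivity)
    have hi2 : ‖p‖ < (i + 1) * δ := by
      rw [← div_lt_iff₀ h0]; exact Nat.lt_floor_add_one _
    have hfar : ∀ z ∈ Φ ω, z ∉ Metric.ball (0 : Plane) (i * δ) := by
      intro z hz hz'
      have := Metric.infDist_le_dist_of_mem (x := (0 : Plane)) hz
      rw [← hpR, dist_zero_left] at this
      rw [mem_ball_zero_iff] at hz'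
      linarith
    have hω : ω ∈ E i := by
      refine ⟨?_, ?_⟩
      · rw [Set.eq_empty_iff_forall_notMem]
        rintro z ⟨hz, hz'⟩
        exact hfar z hz hz'
      · have hsub : ({p, p'} : Set Plane) ⊆
            Φ ω ∩ (Metric.ball 0 ((i + 3) * δ) \ Metric.ball 0 (i * δ)) := by
          rintro z (rfl | rfl)
          · exact ⟨hp, by rw [mem_ball_zero_iff]; nlinarith, hfar _ hp⟩
          · exact ⟨hp', by rw [mem_ball_zero_iff]; nlinarith, hfar _ hp'⟩
        have := Set.encard_le_encard hsub
        rwa [Set.encard_pair hne] at this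
    refine le_trans ?_ (ENNReal.le_tsum i)
    rw [Set.indicator_of_mem hω]
    exact ENNReal.ofReal_le_ofReal (by linarith)

end IsPoissonPointProcess

/-! ### The joint law of all distances is determined by void probabilities -/

/-- The distances of all locations to the points of both tiers. -/
noncomputable def distPath (S : Tier → Set Plane) : Tier × Plane → ℝ≥0∞ :=
  fun i => Metric.infEDist i.2 (S i.1)

/-- Joint void probabilities of two independent planar Poisson processes. -/
structure HasPoissonVoids {Ω : Type*} [MeasurableSpace Ω] (P : Measure Ω)
    (Φ : Tier → Ω → Set Plane) (lam : Tier → ℝ) : Prop where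
  measurableSet : ∀ k A, MeasurableSet A → MeasurableSet {ω | Φ k ω ∩ A = ∅}
  prob : ∀ A : Tier → Set Plane, (∀ k, MeasurableSet (A k)) → (∀ k, Bornology.IsBounded (A k)) →
    P {ω | ∀ k, Φ k ω ∩ A k = ∅} = ENNReal.ofReal (Real.exp (-(lam .mbs *
      (volume (A .mbs)).toReal))) * ENNReal.ofReal (Real.exp (-(lam .sbs *
      (volume (A .sbs)).toReal)))

lemma isPiSystem_Ici_cylinders (ι : Type*) : IsPiSystem {T : Set (ι → ℝ≥0∞) |
    ∃ (F : Finset ι) (r : ι → ℝ≥0∞), T = {x | ∀ i ∈ F, r i ≤ x i}} := by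
  classical
  rintro _ ⟨F, r, rfl⟩ _ ⟨F', r', rfl⟩ -
  -- The threshold 0 imposes no condition on coordinates absent from one of the two index sets.
  refine ⟨F ∪ F', fun i => max (if i ∈ F then r i else 0) (if i ∈ F' then r' i else 0), ?_⟩
  ext x
  simp only [mem_inter_iff, mem_ofPred_eq, Finset.mem_union, max_le_iff]
  constructor
  · rintro ⟨h, h'⟩ i -
    constructor <;> split_ifs with hi
    exacts [h i hi, zero_le, h' i hi, zero_le]
  · intro h
    exact ⟨fun i hi => by simpa [hi] using (h i (Or.inl hi)).1,
      fun i hi => by simpa [hi] using (h i (Or.inr hi)).2⟩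

lemma measurableSpace_pi_eq_generateFrom (ι : Type*) :
    (MeasurableSpace.pi : MeasurableSpace (ι → ℝ≥0∞)) =
      MeasurableSpace.generateFrom {T : Set (ι → ℝ≥0∞) |
        ∃ (F : Finset ι) (r : ι → ℝ≥0∞), T = {x | ∀ i ∈ F, r i ≤ x i}} := by
  apply le_antisymm
  · refine iSup_le fun i => ?_
    rw [← measurable_iff_comap_le]
    refine measurable_of_Ici fun r => ?_
    refine MeasurableSpace.measurableSet_generateFrom ⟨{i}, fun _ => r, ?_⟩
    ext x
    simp
  · refine MeasurableSpace.generateFrom_le ?_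
    rintro _ ⟨F, r, rfl⟩
    have : {x : ι → ℝ≥0∞ | ∀ i ∈ F, r i ≤ x i} = ⋂ i ∈ F, {x | r i ≤ x i} := by ext; simp
    rw [this]
    exact F.measurableSet_biInter fun i _ => measurableSet_le measurable_const (measurable_pi_apply i)

namespace HasPoissonVoids

variable {Ω Ω' : Type*} [MeasurableSpace Ω] [MeasurableSpace Ω'] {P : Measure Ω} {P' : Measure Ω'}
  {Φ : Tier → Ω → Set Plane} {Φ' : Tier → Ω' → Set Plane} {lam : Tier → ℝ}

lemma measurable_distPath (h : HasPoissonVoids P Φ lam) :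
    Measurable fun ω => distPath fun k => Φ k ω := by
  refine measurable_pi_lambda _ fun i => measurable_of_Ici fun r => ?_
  have : (fun ω => distPath (fun k => Φ k ω) i) ⁻¹' Ici r =
      {ω | Φ i.1 ω ∩ Metric.eball i.2 r = ∅} := by
    ext ω; simp [distPath, le_infEDist_iff_void]
  rw [this]
  exact h.measurableSet _ _ Metric.isOpen_eball.measurableSet

lemma measurableSet_forall (h : HasPoissonVoids P Φ lam) {A : Tier → Set Plane}
    (hA : ∀ k, MeasurableSet (A k)) : MeasurableSet {ω | ∀ k, Φ k ω ∩ A k = ∅} := by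
  have : {ω | ∀ k, Φ k ω ∩ A k = ∅} = ⋂ k, {ω | Φ k ω ∩ A k = ∅} := by ext; simp
  rw [this]
  exact MeasurableSet.iInter fun k => h.measurableSet k _ (hA k)

/-- Void probabilities are prescribed for bounded regions only. Exhaustion by balls reaches the
unbounded ones, which occur because a threshold on an extended distance may be ∞. -/
lemma tendsto_void [IsProbabilityMeasure P] (h : HasPoissonVoids P Φ lam) {A : Tier → Set Plane}
    (hA : ∀ k, MeasurableSet (A k)) :
    Tendsto (fun n : ℕ => P {ω | ∀ k, Φ k ω ∩ (A k ∩ Metric.ball 0 n) = ∅}) atTop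
      (𝓝 (P {ω | ∀ k, Φ k ω ∩ A k = ∅})) := by
  have e : {ω | ∀ k, Φ k ω ∩ A k = ∅} =
      ⋂ n : ℕ, {ω | ∀ k, Φ k ω ∩ (A k ∩ Metric.ball 0 n) = ∅} := by
    ext ω
    simp only [mem_ofPred_eq, mem_iInter, Set.eq_empty_iff_forall_notMem, mem_inter_iff]
    constructor
    · rintro h n k z ⟨h1, h2, -⟩
      exact h k z ⟨h1, h2⟩
    · rintro h k z ⟨h1, h2⟩
      obtain ⟨n, hn⟩ := exists_nat_gt ‖z‖
      exact h n k z ⟨h1, h2, by simpa using hn⟩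
  rw [e]
  refine tendsto_measure_iInter_atTop
    (fun n => (h.measurableSet_forall fun k =>
      (hA k).inter measurableSet_ball).nullMeasurableSet) ?_ ⟨0, measure_ne_top _ _⟩
  intro m n hmn ω hω k
  refine Set.subset_eq_empty ?_ (hω k)
  gcongr

lemma void_eq [IsProbabilityMeasure P] [IsProbabilityMeasure P'] (h : HasPoissonVoids P Φ lam)
    (h' : HasPoissonVoids P' Φ' lam) {A : Tier → Set Plane} (hA : ∀ k, MeasurableSet (A k)) :
    P {ω | ∀ k, Φ k ω ∩ A k = ∅} = P' {ω | ∀ k, Φ' k ω ∩ A k = ∅} := by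
  refine tendsto_nhds_unique (h.tendsto_void hA) ?_
  have : ∀ n : ℕ, P {ω | ∀ k, Φ k ω ∩ (A k ∩ Metric.ball 0 n) = ∅} =
      P' {ω | ∀ k, Φ' k ω ∩ (A k ∩ Metric.ball 0 n) = ∅} := fun n => by
    rw [h.prob _ (fun k => (hA k).inter measurableSet_ball)
        (fun k => Metric.isBounded_ball.subset inter_subset_right),
      h'.prob _ (fun k => (hA k).inter measurableSet_ball)
        (fun k => Metric.isBounded_ball.subset inter_subset_right)]
  simp_rw [this]
  exact h'.tendsto_void hA

/-- Void probabilities determine the law of all distances. -/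
lemma map_distPath_eq [IsProbabilityMeasure P] [IsProbabilityMeasure P']
    (h : HasPoissonVoids P Φ lam) (h' : HasPoissonVoids P' Φ' lam) :
    P.map (fun ω => distPath fun k => Φ k ω) = P'.map (fun ω => distPath fun k => Φ' k ω) := by
  have := Measure.isProbabilityMeasure_map (μ := P) h.measurable_distPath.aemeasurable
  have := Measure.isProbabilityMeasure_map (μ := P') h'.measurable_distPath.aemeasurable
  refine ext_of_generate_finite _ (measurableSpace_pi_eq_generateFrom _)
    (isPiSystem_Ici_cylinders _) ?_ (by simp)
  rintro _ ⟨F, r, rfl⟩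
  have hm : MeasurableSet {x : Tier × Plane → ℝ≥0∞ | ∀ i ∈ F, r i ≤ x i} := by
    rw [measurableSpace_pi_eq_generateFrom]
    exact MeasurableSpace.measurableSet_generateFrom ⟨F, r, rfl⟩
  rw [Measure.map_apply h.measurable_distPath hm, Measure.map_apply h'.measurable_distPath hm]
  -- Prescribed lower bounds for finitely many distances say that a union of balls is void, for each
  -- tier. So the cylinder event is a void event.
  set A : Tier → Set Plane := fun k => ⋃ i ∈ F, ⋃ (_ : i.1 = k), Metric.eball i.2 (r i)
  have key : ∀ S : Tier → Set Plane,
      (∀ i ∈ F, r i ≤ distPath S i) ↔ ∀ k, S k ∩ A k = ∅ := by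
    intro S
    simp only [distPath, le_infEDist_iff_void, A, Set.eq_empty_iff_forall_notMem, mem_inter_iff,
      mem_iUnion, not_and, not_exists]
    constructor
    · rintro h k z hz i hi rfl hz'
      exact h i hi z hz hz'
    · intro h i hi z hz hz'
      exact h i.1 z hz i hi rfl hz'
  have hA : ∀ k, MeasurableSet (A k) := fun k =>
    (isOpen_biUnion fun i _ => isOpen_iUnion fun _ => Metric.isOpen_eball).measurableSet
  have e1 : (fun ω => distPath fun k => Φ k ω) ⁻¹' {x | ∀ i ∈ F, r i ≤ x i} =
      {ω | ∀ k, Φ k ω ∩ A k = ∅} := by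
    ext ω; exact key _
  have e2 : (fun ω => distPath fun k => Φ' k ω) ⁻¹' {x | ∀ i ∈ F, r i ≤ x i} =
      {ω | ∀ k, Φ' k ω ∩ A k = ∅} := by
    ext ω; exact key _
  rw [e1, e2, h.void_eq h' hA]

end HasPoissonVoids

/-! ### Independent resampling of one tier, and isometries -/

/-- The configuration with the stations of tier `k` from `S` and the other stations from `S'`. -/
noncomputable def splitConfig (k : Tier) (S S' : Tier → Set Plane) : Tier → Set Plane :=
  fun i => by classical exact if i = k then S i else S' i

@[simp] lemma splitConfig_self (k : Tier) (S S' : Tier → Set Plane) :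
    splitConfig k S S' k = S k := by simp [splitConfig]

@[simp] lemma splitConfig_other (k : Tier) (S S' : Tier → Set Plane) :
    splitConfig k S S' k.other = S' k.other := by simp [splitConfig, Tier.other_ne]

lemma IsGood.splitConfig {S S' : Tier → Set Plane} (h : IsGood S) (h' : IsGood S') (k : Tier) :
    IsGood (splitConfig k S S') := by
  rw [IsGood, Tier.forall_iff k]
  simpa using ⟨h k, h' k.other⟩

lemma Network.IsDeployment.ae_isGood {N : Network} {Ω : Type*} [MeasurableSpace Ω] {P : Measure Ω}
    [IsProbabilityMeasure P] {Φ : Tier → Ω → Set Plane} (hΦ : N.IsDeployment P Φ) :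
    ∀ᵐ ω ∂P, IsGood fun k => Φ k ω := by
  filter_upwards [ae_all_iff.2 fun k => (hΦ.poisson k).ae_isClosed,
    ae_all_iff.2 fun k => (hΦ.poisson k).ae_nonempty (N.lam_pos k)] with ω h1 h2 k
  exact ⟨h1 k, h2 k⟩

lemma Network.IsDeployment.hasPoissonVoids {N : Network} {Ω : Type*} [MeasurableSpace Ω]
    {P : Measure Ω} {Φ : Tier → Ω → Set Plane} (hΦ : N.IsDeployment P Φ) :
    HasPoissonVoids P Φ N.lam where
  measurableSet k A hA := (hΦ.poisson k).measurableSet_void hA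
  prob A hA hb := by
    have hi : Indep (pointSigma (Φ .mbs)) (pointSigma (Φ .sbs)) P := hΦ.indep.indep (by simp)
    have e : {ω | ∀ k, Φ k ω ∩ A k = ∅} =
        {ω | Φ .mbs ω ∩ A .mbs = ∅} ∩ {ω | Φ .sbs ω ∩ A .sbs = ∅} := by
      ext ω; exact Tier.forall_iff .mbs
    rw [e, (Indep_iff _ _ _).1 hi _ _ (measurableSet_void_pointSigma (hA _))
      (measurableSet_void_pointSigma (hA _)),
      (hΦ.poisson _).void_prob (N.lam_pos _) (hA _) (hb _),
      (hΦ.poisson _).void_prob (N.lam_pos _) (hA _) (hb _)]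

namespace HasPoissonVoids

variable {Ω Ω' : Type*} [MeasurableSpace Ω] [MeasurableSpace Ω'] {P : Measure Ω} {P' : Measure Ω'}
  {Φ : Tier → Ω → Set Plane} {Φ' : Tier → Ω' → Set Plane} {lam : Tier → ℝ}

lemma prob_one [IsProbabilityMeasure P] (h : HasPoissonVoids P Φ lam) (k : Tier) {A : Set Plane}
    (hA : MeasurableSet A) (hb : Bornology.IsBounded A) :
    P {ω | Φ k ω ∩ A = ∅} = ENNReal.ofReal (Real.exp (-(lam k * (volume A).toReal))) := by
  cases k
  · have := h.prob (fun i => match i with | .mbs => A | .sbs => ∅)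
      (by rintro ⟨⟩; exacts [hA, MeasurableSet.empty])
      (by rintro ⟨⟩; exacts [hb, Bornology.isBounded_empty])
    simpa [Tier.forall_iff .mbs, Tier.other] using this
  · have := h.prob (fun i => match i with | .mbs => ∅ | .sbs => A)
      (by rintro ⟨⟩; exacts [MeasurableSet.empty, hA])
      (by rintro ⟨⟩; exacts [Bornology.isBounded_empty, hb])
    simpa [Tier.forall_iff .mbs, Tier.other] using this

/-- Independence of the tiers makes the joint void probability a product, which is also what two
independent copies give. Fixing tier k while the other tier stays random thus becomes Fubini's
theorem on `P.prod P`. -/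
lemma split [IsProbabilityMeasure P] (h : HasPoissonVoids P Φ lam) (k : Tier) :
    HasPoissonVoids (P.prod P)
      (fun i z => splitConfig k (fun j => Φ j z.1) (fun j => Φ j z.2) i) lam where
  measurableSet i A hA := by
    rcases Tier.eq_or_eq_other k i with rfl | rfl
    · simp only [splitConfig_self]
      exact measurable_fst (h.measurableSet _ A hA)
    · simp only [splitConfig_other]
      exact measurable_snd (h.measurableSet _ A hA)
  prob A hA hb := by
    have e : {z : Ω × Ω | ∀ i, splitConfig k (fun j => Φ j z.1) (fun j => Φ j z.2) i ∩ A i = ∅} =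
        {ω | Φ k ω ∩ A k = ∅} ×ˢ {ω | Φ k.other ω ∩ A k.other = ∅} := by
      ext z
      simp [Tier.forall_iff k]
    rw [e, Measure.prod_prod, h.prob_one k (hA _) (hb _), h.prob_one _ (hA _) (hb _)]
    cases k
    · rfl
    · exact mul_comm _ _

lemma preimage (h : HasPoissonVoids P Φ lam) (g : Plane ≃ᵢ Plane)
    (hg : MeasurePreserving g.symm) : HasPoissonVoids P (fun k ω => g ⁻¹' Φ k ω) lam := by
  have key : ∀ S A : Set Plane, g ⁻¹' S ∩ A = ∅ ↔ S ∩ g.symm ⁻¹' A = ∅ := by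
    intro S A
    rw [Set.eq_empty_iff_forall_notMem, Set.eq_empty_iff_forall_notMem,
      g.symm.surjective.forall]
    simp
  refine ⟨fun k A hA => ?_, fun A hA hb => ?_⟩
  · simp only [key]
    exact h.measurableSet k _ (hg.measurable hA)
  · simp only [key]
    rw [h.prob _ (fun k => hg.measurable (hA k))
      (fun k => by
        have : g.symm ⁻¹' A k = g '' A k := (g.toEquiv.image_eq_preimage_symm (A k)).symm
        rw [this]
        exact g.isometry.lipschitz.isBounded_image (hb k))]
    simp only [hg.measure_preimage (hA _).nullMeasurableSet]

lemma prob_distPath_mem_eq [IsProbabilityMeasure P] [IsProbabilityMeasure P']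
    (h : HasPoissonVoids P Φ lam) (h' : HasPoissonVoids P' Φ' lam)
    {T : Set (Tier × Plane → ℝ≥0∞)} (hT : MeasurableSet T) :
    P {ω | (distPath fun k => Φ k ω) ∈ T} = P' {ω | (distPath fun k => Φ' k ω) ∈ T} := by
  have := congrArg (fun m => m T) (h.map_distPath_eq h')
  rwa [Measure.map_apply h.measurable_distPath hT,
    Measure.map_apply h'.measurable_distPath hT] at this

/-- Events determined by the distances have the same probability under equal void
probabilities. -/
lemma prob_eq [IsProbabilityMeasure P] [IsProbabilityMeasure P']
    (h : HasPoissonVoids P Φ lam) (h' : HasPoissonVoids P' Φ' lam)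
    (hg : ∀ᵐ ω ∂P, IsGood fun k => Φ k ω) (hg' : ∀ᵐ ω ∂P', IsGood fun k => Φ' k ω)
    {p : (Tier → Set Plane) → Prop} {T : Set (Tier × Plane → ℝ≥0∞)} (hT : MeasurableSet T)
    (hp : ∀ S, IsGood S → (p S ↔ distPath S ∈ T)) :
    P {ω | p fun k => Φ k ω} = P' {ω | p fun k => Φ' k ω} := by
  rw [measure_congr (t := {ω | (distPath fun k => Φ k ω) ∈ T}), h.prob_distPath_mem_eq h' hT]
  · refine measure_congr ?_
    filter_upwards [hg'] with ω hω
    exact propext (hp _ hω).symm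
  · filter_upwards [hg] with ω hω
    exact propext (hp _ hω)

end HasPoissonVoids

lemma IsGood.preimage {S : Tier → Set Plane} (h : IsGood S) (g : Plane ≃ᵢ Plane) :
    IsGood fun k => g ⁻¹' S k :=
  fun k => ⟨(h k).1.preimage g.continuous, (h k).2.preimage g.surjective⟩

lemma infDist_preimage (g : Plane ≃ᵢ Plane) (x : Plane) (S : Set Plane) :
    Metric.infDist x (g ⁻¹' S) = Metric.infDist (g x) S := by
  rw [← Metric.infDist_image g.isometry (x := x) (t := g ⁻¹' S), image_preimage_eq _ g.surjective]

/-- A quantifier over an uncountable ball is replaced by countable ones, for the sake of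
measurability. The slack 1/(n+1) in the radius is independent of m: it keeps a limit of the
approximate solutions, which exists by compactness, strictly inside the open ball. -/
lemma exists_mem_ball_nonneg_iff {F : Plane → ℝ} (hF : Continuous F) {x : Plane} {δ : ℝ} :
    (∃ v ∈ Metric.ball x δ, 0 ≤ F v) ↔ ∃ n : ℕ, ∀ m : ℕ, ∃ i : ℕ,
      dist (TopologicalSpace.denseSeq Plane i) x < δ - 1 / (n + 1) ∧
        -(1 / (m + 1) : ℝ) < F (TopologicalSpace.denseSeq Plane i) := by
  constructor
  · rintro ⟨v, hv, h0⟩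
    obtain ⟨n, hn⟩ := exists_nat_one_div_lt (sub_pos.2 (Metric.mem_ball.1 hv))
    refine ⟨n, fun m => ?_⟩
    have ho : IsOpen ({y | dist y x < δ - 1 / (n + 1)} ∩ {y | -(1 / (m + 1) : ℝ) < F y}) :=
      (isOpen_lt (by fun_prop) continuous_const).inter (isOpen_lt continuous_const hF)
    obtain ⟨i, hi⟩ := (TopologicalSpace.denseRange_denseSeq Plane).exists_mem_open ho
      ⟨v, by simp only [mem_ofPred_eq]; linarith,
        lt_of_lt_of_le (neg_lt_zero.2 Nat.one_div_pos_of_nat) h0⟩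
    exact ⟨i, hi⟩
  · rintro ⟨n, h⟩
    choose i hi hF' using h
    have hc : IsCompact (Metric.closedBall x (δ - 1 / (n + 1))) := isCompact_closedBall _ _
    obtain ⟨v, hv, φ, hφ, hlim⟩ := hc.tendsto_subseq
      (x := fun m => TopologicalSpace.denseSeq Plane (i m)) fun m => (hi m).le
    refine ⟨v, Metric.mem_ball.2 (lt_of_le_of_lt hv (sub_lt_self _ Nat.one_div_pos_of_nat)), ?_⟩
    have h1 : Tendsto (fun m : ℕ => -(1 / ((φ m : ℕ) + 1) : ℝ)) atTop (𝓝 0) := by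
      rw [← neg_zero]
      exact (tendsto_one_div_add_atTop_nhds_zero_nat.comp hφ.tendsto_atTop).neg
    exact le_of_tendsto_of_tendsto' h1 ((hF.tendsto v).comp hlim) fun m => (hF' (φ m)).le

/-! ### Measurability and invariance of service and boundary events -/

namespace Network

variable (N : Network)

/-- The gap at location `x` as a function of all distances. -/
noncomputable def pathGap (k : Tier) (x : Plane) (ξ : Tier × Plane → ℝ≥0∞) : ℝ :=
  N.gap k (ξ (k, x)).toReal (ξ (k.other, x)).toReal

lemma pathGap_distPath (k : Tier) (x : Plane) (S : Tier → Set Plane) :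
    N.pathGap k x (distPath S) =
      N.gap k (Metric.infDist x (S k)) (Metric.infDist x (S k.other)) := rfl

lemma continuous_gap_uncurry (k : Tier) : Continuous fun z : ℝ × ℝ => N.gap k z.1 z.2 := by
  unfold gap; fun_prop

lemma measurable_pathGap (k : Tier) (x : Plane) : Measurable (N.pathGap k x) := by
  refine (N.continuous_gap_uncurry k).measurable.comp (Measurable.prodMk ?_ ?_)
  · exact (measurable_pi_apply _).ennreal_toReal
  · exact (measurable_pi_apply _).ennreal_toReal

lemma mem_servedBy_iff_pathGap {S : Tier → Set Plane} (hS : IsGood S) (k : Tier) (x : Plane) :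
    x ∈ N.servedBy S k ↔ N.pathGap k x (distPath S) < 0 := N.mem_servedBy_iff hS k x

lemma mem_servedBy_other_iff {S : Tier → Set Plane} (hS : IsGood S) (k : Tier) (x : Plane) :
    x ∈ N.servedBy S k.other ↔
      0 < N.gap k (Metric.infDist x (S k)) (Metric.infDist x (S k.other)) := by
  rw [N.mem_servedBy_iff hS, gap_other, Tier.other_other]
  have := N.beta_pos k.other k
  simp only [neg_mul, neg_lt_zero, mul_pos_iff_of_pos_left this]

/-- The extended boundary in terms of the distances from countably many locations. -/
def extPath (k : Tier) (δ : ℝ) : Set (Plane × (Tier × Plane → ℝ≥0∞)) :=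
  (⋃ n : ℕ, ⋂ m : ℕ, ⋃ i : ℕ,
      {z | dist (TopologicalSpace.denseSeq Plane i) z.1 < δ - 1 / (n + 1)} ∩
        {z | -(1 / (m + 1) : ℝ) < N.pathGap k (TopologicalSpace.denseSeq Plane i) z.2}) ∩
    ⋃ n : ℕ, ⋂ m : ℕ, ⋃ i : ℕ,
      {z | dist (TopologicalSpace.denseSeq Plane i) z.1 < δ - 1 / (n + 1)} ∩
        {z | -(1 / (m + 1) : ℝ) < -N.pathGap k (TopologicalSpace.denseSeq Plane i) z.2}

lemma measurableSet_extPath (k : Tier) (δ : ℝ) : MeasurableSet (N.extPath k δ) := by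
  have h1 : ∀ i, Measurable fun z : Plane × (Tier × Plane → ℝ≥0∞) =>
      N.pathGap k (TopologicalSpace.denseSeq Plane i) z.2 :=
    fun i => (N.measurable_pathGap k _).comp measurable_snd
  have h2 : ∀ i, Measurable fun z : Plane × (Tier × Plane → ℝ≥0∞) =>
      dist (TopologicalSpace.denseSeq Plane i) z.1 :=
    fun i => measurable_const.dist measurable_fst
  refine MeasurableSet.inter ?_ ?_
  · exact .iUnion fun n => .iInter fun m => .iUnion fun i =>
      (measurableSet_lt (h2 i) measurable_const).inter (measurableSet_lt measurable_const (h1 i))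
  · exact .iUnion fun n => .iInter fun m => .iUnion fun i =>
      (measurableSet_lt (h2 i) measurable_const).inter
        (measurableSet_lt measurable_const (h1 i).neg)

lemma mem_extBoundary_iff_extPath {S : Tier → Set Plane} (hS : IsGood S) (k : Tier) (x : Plane)
    (δ : ℝ) : x ∈ N.extBoundary S δ ↔ (x, distPath S) ∈ N.extPath k δ := by
  rw [N.mem_extBoundary_iff hS k, exists_mem_ball_nonneg_iff (N.continuous_gap S k)]
  have h := exists_mem_ball_nonneg_iff (N.continuous_gap S k).neg (x := x) (δ := δ)
  simp only [Pi.neg_apply, neg_nonneg] at h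
  rw [h]
  simp [extPath, pathGap_distPath]

namespace IsDeployment

variable {N} {Ω : Type*} [MeasurableSpace Ω] {P : Measure Ω} [IsProbabilityMeasure P]
  {Φ : Tier → Ω → Set Plane}

lemma ae_isGood_preimage (hΦ : N.IsDeployment P Φ) (g : Plane ≃ᵢ Plane) :
    ∀ᵐ ω ∂P, IsGood fun k => g ⁻¹' Φ k ω := by
  filter_upwards [hΦ.ae_isGood] with ω hω using hω.preimage g

lemma ae_isGood_split (hΦ : N.IsDeployment P Φ) (k : Tier) :
    ∀ᵐ z ∂(P.prod P), IsGood fun i => splitConfig k (fun j => Φ j z.1) (fun j => Φ j z.2) i := by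
  filter_upwards [Measure.quasiMeasurePreserving_fst.ae hΦ.ae_isGood,
    Measure.quasiMeasurePreserving_snd.ae hΦ.ae_isGood] with z h1 h2 using h1.splitConfig h2 k

lemma prob_mem_extBoundary (hΦ : N.IsDeployment P Φ) (δ : ℝ) (x : Plane) :
    P {ω | x ∈ N.extBoundary (fun k => Φ k ω) δ} =
      P {ω | (0 : Plane) ∈ N.extBoundary (fun k => Φ k ω) δ} := by
  set g : Plane ≃ᵢ Plane := IsometryEquiv.addRight x
  have hg : MeasurePreserving g.symm := by
    have : (g.symm : Plane → Plane) = fun y => y + -x := by ext1 y; rfl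
    rw [this]
    exact measurePreserving_add_right volume (-x)
  have hT : MeasurableSet {ξ | ((0 : Plane), ξ) ∈ N.extPath .mbs δ} :=
    measurable_prodMk_left (N.measurableSet_extPath .mbs δ)
  rw [hΦ.hasPoissonVoids.prob_eq (hΦ.hasPoissonVoids.preimage g hg) hΦ.ae_isGood
    (hΦ.ae_isGood_preimage g) (p := fun S => (0 : Plane) ∈ N.extBoundary S δ) hT
    fun S hS => N.mem_extBoundary_iff_extPath hS .mbs 0 δ]
  refine measure_congr ?_
  filter_upwards [hΦ.ae_isGood] with ω hω
  refine propext ?_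
  have e : ∀ v, (v ∈ N.boundary fun k => g ⁻¹' Φ k ω) ↔ g v ∈ N.boundary fun k => Φ k ω := by
    intro v
    rw [N.mem_boundary_iff (hω.preimage g) .mbs, N.mem_boundary_iff hω .mbs]
    simp only [infDist_preimage]
  have hg0 : g 0 = x := zero_add x
  change (∃ v, v ∈ _ ∧ dist x v < δ) ↔ ∃ v, v ∈ _ ∧ dist 0 v < δ
  rw [g.surjective.exists]
  refine exists_congr fun v => ?_
  rw [e, ← g.dist_eq 0 v, hg0]

/-- Fubini: the expected area is the integral over the unit square of the probability that x is
covered, which is the same for all x. -/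
lemma areaIntensity_eq (hΦ : N.IsDeployment P Φ) (δ : ℝ) :
    N.areaIntensity P Φ δ = P {ω | (0 : Plane) ∈ N.extBoundary (fun k => Φ k ω) δ} := by
  set Q : Set Plane := {x : Plane | ∀ i, x i ∈ Icc (0 : ℝ) 1}
  have hQ : MeasurableSet Q := by
    have : Q = ⋂ i, {x : Plane | x i ∈ Icc (0 : ℝ) 1} := by ext; simp [Q]
    rw [this]
    exact MeasurableSet.iInter fun i =>
      measurableSet_Icc.preimage (EuclideanSpace.proj (𝕜 := ℝ) i).continuous.measurable
  have hQ1 : volume Q = 1 := by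
    have : Q = WithLp.ofLp ⁻¹' (Set.pi univ fun _ : Fin 2 => Icc (0 : ℝ) 1) := by
      ext; simp [Q, -Set.pi_univ_Icc]
    rw [this, (PiLp.volume_preserving_ofLp (Fin 2)).measure_preimage
      (MeasurableSet.univ_pi fun _ => measurableSet_Icc).nullMeasurableSet, volume_pi_pi]
    simp
  set T : Set (Ω × Plane) := {z | (z.2, distPath fun k => Φ k z.1) ∈ N.extPath .mbs δ}
  have hT : MeasurableSet T :=
    (measurable_snd.prodMk (hΦ.hasPoissonVoids.measurable_distPath.comp measurable_fst))
      (N.measurableSet_extPath .mbs δ)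
  have h1 : N.areaIntensity P Φ δ = (P.prod (volume.restrict Q)) T := by
    rw [Measure.prod_apply hT]
    refine lintegral_congr_ae ?_
    filter_upwards [hΦ.ae_isGood] with ω hω
    change _ = (volume.restrict Q) (Prod.mk ω ⁻¹' T)
    rw [Measure.restrict_apply (measurable_prodMk_left hT)]
    congr 2
    ext x
    exact N.mem_extBoundary_iff_extPath hω .mbs x δ
  rw [h1, Measure.prod_apply_symm hT]
  have h2 : ∀ x : Plane, P ((fun ω => (ω, x)) ⁻¹' T) =
      P {ω | (0 : Plane) ∈ N.extBoundary (fun k => Φ k ω) δ} := by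
    intro x
    rw [← hΦ.prob_mem_extBoundary δ x]
    refine measure_congr ?_
    filter_upwards [hΦ.ae_isGood] with ω hω
    exact propext (N.mem_extBoundary_iff_extPath hω .mbs x δ).symm
  simp_rw [h2]
  simp [hQ1]

/-- A translation moves x to 0, the reflection that exchanges the equally long vectors y − x and y'
− x' follows, and a translation moves 0 to x'. The case of x and y interchanged is included. -/
lemma exists_isometryEquiv {x y x' y' : Plane} (h : dist x y = dist x' y') :
    ∃ g : Plane ≃ᵢ Plane, g x = x' ∧ g y = y' ∧ MeasurePreserving g.symm := by
  have hn : ‖y - x‖ = ‖y' - x'‖ := by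
    rw [← dist_eq_norm, ← dist_eq_norm, dist_comm y, dist_comm y', h]
  set L := (ℝ ∙ ((y - x) - (y' - x')))ᗮ.reflection
  have hL : L (y - x) = y' - x' := Submodule.reflection_sub hn
  refine ⟨((IsometryEquiv.addRight (-x)).trans L.toIsometryEquiv).trans
    (IsometryEquiv.addRight x'), ?_, ?_, ?_⟩
  · simp
  · simp [← sub_eq_add_neg, hL]
  · have e : ((((IsometryEquiv.addRight (-x)).trans L.toIsometryEquiv).trans
        (IsometryEquiv.addRight x')).symm : Plane → Plane) =
        (fun z => z + - -x) ∘ L.symm ∘ fun z => z + -x' := by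
      ext1 z; rfl
    rw [e]
    exact (measurePreserving_add_right volume _).comp
      (L.symm.measurePreserving.comp (measurePreserving_add_right volume _))

/-- The probability of being served by different tiers at two locations depends only on their
distance. -/
lemma prob_servedBy_pair_congr (hΦ : N.IsDeployment P Φ) (k : Tier) {x y x' y' : Plane}
    (h : dist x y = dist x' y') :
    P {ω | x ∈ N.servedBy (fun i => Φ i ω) k ∧ y ∈ N.servedBy (fun i => Φ i ω) k.other} =
      P {ω | x' ∈ N.servedBy (fun i => Φ i ω) k ∧ y' ∈ N.servedBy (fun i => Φ i ω) k.other} := by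
  obtain ⟨g, hx, hy, hg⟩ := exists_isometryEquiv h
  have hT : MeasurableSet {ξ | N.pathGap k x ξ < 0 ∧ N.pathGap k.other y ξ < 0} :=
    (measurableSet_lt (N.measurable_pathGap k x) measurable_const).inter
      (measurableSet_lt (N.measurable_pathGap _ y) measurable_const)
  rw [hΦ.hasPoissonVoids.prob_eq (hΦ.hasPoissonVoids.preimage g hg) hΦ.ae_isGood
    (hΦ.ae_isGood_preimage g)
    (p := fun S => x ∈ N.servedBy S k ∧ y ∈ N.servedBy S k.other) hT
    fun S hS => and_congr (N.mem_servedBy_iff hS k x) (N.mem_servedBy_iff hS _ y)]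
  refine measure_congr ?_
  filter_upwards [hΦ.ae_isGood] with ω hω
  refine propext ?_
  change (_ ∧ _) ↔ (_ ∧ _)
  rw [N.mem_servedBy_iff (hω.preimage g), N.mem_servedBy_iff (hω.preimage g),
    N.mem_servedBy_iff hω, N.mem_servedBy_iff hω]
  simp only [infDist_preimage, hx, hy]

/-- Decoupling of the two tiers. -/
lemma prob_eq_lintegral_split (hΦ : N.IsDeployment P Φ) (k : Tier)
    {p : (Tier → Set Plane) → Prop} {T : Set (Tier × Plane → ℝ≥0∞)} (hT : MeasurableSet T)
    (hp : ∀ S, IsGood S → (p S ↔ distPath S ∈ T)) :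
    P {ω | p fun i => Φ i ω} = ∫⁻ ω, P {ω' | p (splitConfig k (fun i => Φ i ω) fun i => Φ i ω')} ∂P := by
  have hs := hΦ.hasPoissonVoids.split k
  rw [hΦ.hasPoissonVoids.prob_eq hs hΦ.ae_isGood (hΦ.ae_isGood_split k) hT hp]
  have hm : MeasurableSet {z : Ω × Ω |
      (distPath fun i => splitConfig k (fun j => Φ j z.1) (fun j => Φ j z.2) i) ∈ T} :=
    hs.measurable_distPath hT
  rw [measure_congr (t := {z : Ω × Ω |
      (distPath fun i => splitConfig k (fun j => Φ j z.1) (fun j => Φ j z.2) i) ∈ T}),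
    Measure.prod_apply hm]
  · refine lintegral_congr_ae ?_
    filter_upwards [hΦ.ae_isGood] with ω hω
    refine measure_congr ?_
    filter_upwards [hΦ.ae_isGood] with ω' hω'
    exact propext (hp _ (hω.splitConfig hω' k)).symm
  · filter_upwards [hΦ.ae_isGood_split k] with z hz
    exact propext (hp _ hz)

end IsDeployment

end Network

/-! ### Polar coordinates and averages over circles -/

/-- The unit vector with polar angle `θ`. -/
noncomputable def unitVec (θ : ℝ) : Plane := !₂[Real.cos θ, Real.sin θ]

lemma continuous_unitVec : Continuous unitVec := by
  unfold unitVec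
  refine (PiLp.continuous_toLp 2 _).comp (continuous_pi fun i => ?_)
  fin_cases i
  · exact Real.continuous_cos
  · exact Real.continuous_sin

lemma inner_unitVec (θ α : ℝ) : inner ℝ (unitVec θ) (unitVec α) = Real.cos (θ - α) := by
  simp [unitVec, PiLp.inner_apply, Fin.sum_univ_two, Real.cos_sub]
  ring

lemma norm_unitVec (θ : ℝ) : ‖unitVec θ‖ = 1 := by
  have : ‖unitVec θ‖ ^ 2 = 1 := by
    rw [← real_inner_self_eq_norm_sq, inner_unitVec, sub_self, Real.cos_zero]
  exact (pow_eq_one_iff_of_nonneg (norm_nonneg _) two_ne_zero).1 this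

lemma exists_eq_smul_unitVec (w : Plane) : ∃ α, w = ‖w‖ • unitVec α := by
  set z : ℂ := ⟨w 0, w 1⟩
  have hz : ‖z‖ = ‖w‖ := by
    rw [EuclideanSpace.norm_eq, Complex.norm_def, Complex.normSq_mk]
    simp [Fin.sum_univ_two, sq]
  refine ⟨z.arg, ?_⟩
  rw [← hz]
  ext i
  fin_cases i
  · simp [unitVec, z]
  · simp [unitVec, z]

/-- Area in polar coordinates. -/
lemma volume_eq_lintegral_polar {A : Set Plane} (hA : MeasurableSet A) :
    volume A = ∫⁻ θ in Ioo (-π) π, ∫⁻ r in Ioi (0 : ℝ),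
      ENNReal.ofReal r * A.indicator 1 (r • unitVec θ) := by
  set L : ℂ ≃ₗᵢ[ℝ] Plane := Complex.orthonormalBasisOneI.repr
  have h1 : volume A = ∫⁻ z : ℂ, A.indicator 1 (L z) := by
    rw [L.measurePreserving.lintegral_comp (f := A.indicator 1)
      (measurable_one.indicator hA), lintegral_indicator_one hA]
  have h2 : ∀ p : ℝ × ℝ, L (Complex.polarCoord.symm p) = p.1 • unitVec p.2 := by
    intro p
    ext i
    fin_cases i <;> simp [L, unitVec, Complex.polarCoord_symm_apply, Complex.cos_ofReal_re,
      Complex.sin_ofReal_re]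
  rw [h1, ← Complex.lintegral_comp_polarCoord_symm]
  simp only [h2, smul_eq_mul]
  have hm : Measurable fun p : ℝ × ℝ =>
      ENNReal.ofReal p.1 * A.indicator (1 : Plane → ℝ≥0∞) (p.1 • unitVec p.2) := by
    refine (ENNReal.measurable_ofReal.comp measurable_fst).mul ?_
    refine (measurable_one.indicator hA).comp ?_
    exact (continuous_fst.smul (continuous_unitVec.comp continuous_snd)).measurable
  rw [polarCoord_target, Measure.volume_eq_prod, ← Measure.prod_restrict, lintegral_prod_symm _
    hm.aemeasurable]

/-- The weight r dr is half of d(r²), so conditions on r² integrate exactly. The truncations at 0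
allow τ and τ + F to be negative, and `ENNReal.ofReal` returns 0 when the range is empty. -/
lemma lintegral_ring (τ F : ℝ) :
    ∫⁻ r in Ioi (0 : ℝ), ENNReal.ofReal r *
      {r : ℝ | τ < r ^ 2 ∧ r ^ 2 < τ + F}.indicator 1 r =
      ENNReal.ofReal ((max (τ + F) 0 - max τ 0) / 2) := by
  have hm : MeasurableSet {r : ℝ | τ < r ^ 2 ∧ r ^ 2 < τ + F} := by
    have : {r : ℝ | τ < r ^ 2 ∧ r ^ 2 < τ + F} = (fun r => r ^ 2) ⁻¹' Ioo τ (τ + F) := by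
      ext; simp
    rw [this]
    exact measurableSet_Ioo.preimage (by fun_prop)
  have e : ∀ r : ℝ, ENNReal.ofReal r * {r : ℝ | τ < r ^ 2 ∧ r ^ 2 < τ + F}.indicator 1 r =
      {r : ℝ | τ < r ^ 2 ∧ r ^ 2 < τ + F}.indicator (fun r => ENNReal.ofReal r) r := by
    intro r
    by_cases h : r ∈ {r : ℝ | τ < r ^ 2 ∧ r ^ 2 < τ + F} <;> simp only [h, indicator_of_mem,
      indicator_of_notMem, not_false_eq_true, Pi.one_apply, mul_one, mul_zero]
  simp_rw [e]
  rw [lintegral_indicator hm, Measure.restrict_restrict hm]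
  have hs : {r : ℝ | τ < r ^ 2 ∧ r ^ 2 < τ + F} ∩ Ioi 0 = Ioo √τ √(τ + F) := by
    ext r
    simp only [mem_inter_iff, mem_ofPred_eq, mem_Ioi, mem_Ioo]
    constructor
    · rintro ⟨⟨h1, h2⟩, h3⟩
      exact ⟨(Real.sqrt_lt' h3).2 h1, (Real.lt_sqrt h3.le).2 h2⟩
    · rintro ⟨h1, h2⟩
      have h3 : 0 < r := (Real.sqrt_nonneg _).trans_lt h1
      exact ⟨⟨(Real.sqrt_lt' h3).1 h1, (Real.lt_sqrt h3.le).1 h2⟩, h3⟩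
  have hsq : ∀ x : ℝ, √x ^ 2 = max x 0 := by
    intro x
    rcases le_total x 0 with h | h
    · rw [Real.sqrt_eq_zero_of_nonpos h, max_eq_right h]; simp
    · rw [Real.sq_sqrt h, max_eq_left h]
  rw [hs]
  rcases le_total √(τ + F) √τ with h | h
  · rw [Ioo_eq_empty (not_lt.2 h), Measure.restrict_empty, lintegral_zero_measure,
      ENNReal.ofReal_of_nonpos]
    have := pow_le_pow_left₀ (Real.sqrt_nonneg _) h 2
    rw [hsq, hsq] at this
    linarith
  · rw [← ofReal_integral_eq_lintegral_ofReal]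
    · congr 1
      rw [← integral_Ioc_eq_integral_Ioo, ← intervalIntegral.integral_of_le h, integral_id, hsq,
        hsq]
    · exact (continuous_id.integrableOn_Icc (a := √τ) (b := √(τ + F))).mono_set Ioo_subset_Icc_self
    · filter_upwards [ae_restrict_mem measurableSet_Ioo] with r hr
      exact (Real.sqrt_nonneg τ).trans hr.1.le

lemma lintegral_angle_eq {G : ℝ → ℝ} (hG : Continuous G) (h0 : ∀ θ, 0 ≤ G θ) :
    ∫⁻ θ in Ioo (-π) π, ENNReal.ofReal (G θ) = ENNReal.ofReal (∫ θ in (-π)..π, G θ) := by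
  rw [intervalIntegral.integral_of_le (by linarith [Real.pi_pos]), integral_Ioc_eq_integral_Ioo,
    ofReal_integral_eq_lintegral_ofReal]
  · exact (hG.integrableOn_Icc (a := -π) (b := π)).mono_set Ioo_subset_Icc_self
  · exact Eventually.of_forall h0

lemma integral_cos_shift {g : ℝ → ℝ} (hg : Continuous g) (α : ℝ) :
    ∫ θ in (-π)..π, g (Real.cos (θ - α)) = 2 * ∫ θ in (0 : ℝ)..π, g (Real.cos θ) := by
  have hper : Function.Periodic (fun θ => g (Real.cos θ)) (2 * π) := fun θ => by
    simp only [Real.cos_add_two_pi]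
  have hc : Continuous fun θ => g (Real.cos θ) := hg.comp Real.continuous_cos
  rw [intervalIntegral.integral_comp_sub_right (fun θ => g (Real.cos θ))]
  have h1 := hper.intervalIntegral_add_eq (-π - α) (-π)
  rw [show -π - α + 2 * π = π - α by ring, show -π + 2 * π = π by ring] at h1
  rw [h1, ← intervalIntegral.integral_add_adjacent_intervals (b := 0) (hc.intervalIntegrable _ _)
    (hc.intervalIntegrable _ _)]
  have h2 : ∫ θ in (-π)..0, g (Real.cos θ) = ∫ θ in (0 : ℝ)..π, g (Real.cos θ) := by
    have := intervalIntegral.integral_comp_neg (a := 0) (b := π) (fun θ => g (Real.cos θ))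
    simp only [Real.cos_neg, neg_zero] at this
    exact this.symm
  rw [h2]; ring

lemma norm_smul_unitVec_sub (s : ℝ) {w : Plane} {α : ℝ} (hw : w = ‖w‖ • unitVec α) (θ : ℝ) :
    ‖s • unitVec θ - w‖ = √(s ^ 2 + ‖w‖ ^ 2 - 2 * s * ‖w‖ * Real.cos (θ - α)) := by
  rw [← Real.sqrt_sq (norm_nonneg (s • unitVec θ - w)), norm_sub_sq_real, norm_smul, norm_unitVec]
  congr 1
  nth_rw 1 [hw]
  rw [inner_smul_left, inner_smul_right, inner_unitVec]
  simp
  ring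

/-- The mean distance from a point to the points of a circle. -/
lemma lintegral_norm_circle_sub (s : ℝ) (w : Plane) :
    ∫⁻ θ in Ioo (-π) π, ENNReal.ofReal ‖s • unitVec θ - w‖ =
      ENNReal.ofReal (2 * ∫ θ in (0 : ℝ)..π, √(s ^ 2 + ‖w‖ ^ 2 - 2 * s * ‖w‖ * Real.cos θ)) := by
  rw [lintegral_angle_eq (by have := continuous_unitVec; fun_prop) fun θ => norm_nonneg _]
  obtain ⟨α, hα⟩ := exists_eq_smul_unitVec w
  simp_rw [norm_smul_unitVec_sub s hα]
  rw [integral_cos_shift (g := fun c => √(s ^ 2 + ‖w‖ ^ 2 - 2 * s * ‖w‖ * c)) (by fun_prop)]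

lemma integral_max_cos : ∫ θ in (0 : ℝ)..π, max (Real.cos θ) 0 = 1 := by
  have hc : Continuous fun θ => max (Real.cos θ) 0 := by fun_prop
  have hpi := Real.pi_pos
  rw [← intervalIntegral.integral_add_adjacent_intervals (b := π / 2) (hc.intervalIntegrable _ _)
    (hc.intervalIntegrable _ _)]
  have h1 : ∫ θ in (0 : ℝ)..(π / 2), max (Real.cos θ) 0 = ∫ θ in (0 : ℝ)..(π / 2), Real.cos θ := by
    refine intervalIntegral.integral_congr fun θ hθ => ?_
    rw [uIcc_of_le (by linarith)] at hθ
    exact max_eq_left (Real.cos_nonneg_of_neg_pi_div_two_le_of_le (by linarith [hθ.1]) hθ.2)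
  have h2 : ∫ θ in (π / 2)..π, max (Real.cos θ) 0 = ∫ θ in (π / 2)..π, (0 : ℝ) := by
    refine intervalIntegral.integral_congr fun θ hθ => ?_
    rw [uIcc_of_le (by linarith)] at hθ
    exact max_eq_right (Real.cos_nonpos_of_pi_div_two_le_of_le hθ.1 (by linarith [hθ.2]))
  rw [h1, h2]
  simp

/-- The mean positive part of the projections of a vector. -/
lemma lintegral_inner_unitVec (w : Plane) :
    ∫⁻ φ in Ioo (-π) π, ENNReal.ofReal (inner ℝ (unitVec φ) w) = ENNReal.ofReal (2 * ‖w‖) := by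
  obtain ⟨α, hα⟩ := exists_eq_smul_unitVec w
  have e : ∀ φ, ENNReal.ofReal (inner ℝ (unitVec φ) w) =
      ENNReal.ofReal (‖w‖ * max (Real.cos (φ - α)) 0) := by
    intro φ
    nth_rw 1 [hα]
    rw [inner_smul_right, inner_unitVec, mul_max_of_nonneg _ _ (norm_nonneg w), mul_zero]
    rcases le_total (‖w‖ * Real.cos (φ - α)) 0 with h | h
    · rw [max_eq_right h, ENNReal.ofReal_of_nonpos h, ENNReal.ofReal_zero]
    · rw [max_eq_left h]
  simp_rw [e]
  rw [lintegral_angle_eq (by fun_prop) fun θ => by positivity,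
    intervalIntegral.integral_const_mul, integral_cos_shift (g := fun c => max c 0) (by fun_prop),
    integral_max_cos]
  ring_nf

/-! ### The area of thin bands around the exclusion circle -/

/-- The signed squared radius of the disc around the user that must not contain stations of the
other tier. -/
def exclSq (β a b r : ℝ) : ℝ := β * (r ^ 2 + a ^ 2) - b ^ 2

/-- A constant controlling the width of the bands below. -/
def bandConst (β a c : ℝ) : ℝ := 2 * (2 + (β * (1 + a ^ 2) + 2 * β + c) + β) + c

/-- The planar band `τ < ‖z‖² < τ + 2 δ H (z - β p) + c δ²`. -/
def band (β τ : ℝ) (p : Plane) (H : Plane → ℝ) (δ c : ℝ) : Set Plane :=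
  {z | τ < ‖z‖ ^ 2 ∧ ‖z‖ ^ 2 < τ + 2 * δ * H (z - β • p) + c * δ ^ 2}

lemma measurableSet_band {β τ : ℝ} {p : Plane} {H : Plane → ℝ} (hH : Continuous H) (δ c : ℝ) :
    MeasurableSet (band β τ p H δ c) := by
  have e : band β τ p H δ c = {z : Plane | τ < ‖z‖ ^ 2} ∩
      {z : Plane | ‖z‖ ^ 2 < τ + 2 * δ * H (z - β • p) + c * δ ^ 2} := by
    ext z; simp [band]
  rw [e]
  exact ((isOpen_lt (by fun_prop) (by fun_prop)).inter
    (isOpen_lt (by fun_prop) (by fun_prop))).measurableSet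

section Radial

variable {β a b c₀ r δ : ℝ}

lemma bandConst_pos (hβ : 0 < β) (hc₀ : 0 ≤ c₀) : 0 < bandConst β a c₀ := by
  unfold bandConst; positivity

lemma exclSq_le (hβ : 0 < β) (hr : 0 ≤ r) : exclSq β a b r ≤ β * (1 + a ^ 2) * (1 + r) ^ 2 := by
  unfold exclSq
  have : r ^ 2 + a ^ 2 ≤ (1 + a ^ 2) * (1 + r) ^ 2 := by nlinarith [sq_nonneg a, mul_nonneg (sq_nonneg a) hr, mul_nonneg (sq_nonneg a) (sq_nonneg r)]
  nlinarith [sq_nonneg b]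

lemma sqrt_exclSq_add_le (hβ : 0 < β) (hc₀ : 0 ≤ c₀) (hr : 0 ≤ r) :
    2 * (√(exclSq β a b r) + β * r) ≤ bandConst β a c₀ * (1 + r) := by
  have h1 : √(exclSq β a b r) ≤ (1 + β * (1 + a ^ 2)) * (1 + r) := by
    refine Real.sqrt_le_iff.2 ⟨by positivity, (exclSq_le hβ hr).trans ?_⟩
    rw [mul_pow]
    gcongr
    nlinarith [sq_nonneg a, mul_pos hβ (by positivity : 0 < 1 + a ^ 2)]
  have h2 : β * r ≤ β * (1 + r) := by gcongr; linarith
  have h3 : 2 * ((1 + β * (1 + a ^ 2)) + β) ≤ bandConst β a c₀ := by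
    unfold bandConst; linarith
  nlinarith [mul_le_mul_of_nonneg_right h3 (by positivity : 0 ≤ 1 + r)]

/-- The condition bounds ρ² by a quantity linear in ρ, which first forces ρ = O(1 + r). Inserting
this in the linear term leaves an excess of only O(δ(1 + r)). -/
lemma radius_sq_lt (hβ : 0 < β) (hr : 0 ≤ r) (h0 : 0 < δ) (h1 : δ ≤ 1)
    {c ρ h : ℝ} (hc₀ : 0 ≤ c₀) (hc : c ≤ c₀) (hρ : 0 ≤ ρ) (hh : h ≤ ρ + β * r)
    (hlt : ρ ^ 2 < exclSq β a b r + 2 * δ * h + c * δ ^ 2) :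
    ρ ^ 2 < exclSq β a b r + δ * (bandConst β a c₀ * (1 + r)) := by
  set M := β * (1 + a ^ 2) + 2 * β + c₀ with hM
  have hM0 : 0 < M := by positivity
  have hb1 : 2 * δ * h ≤ 2 * δ * (ρ + β * r) := by gcongr
  have hb2 : c * δ ^ 2 ≤ c₀ * δ := by
    calc c * δ ^ 2 ≤ c₀ * δ ^ 2 := by gcongr
      _ ≤ c₀ * δ := by gcongr; nlinarith
  -- For larger ρ, with δ ≤ 1, the hypothesis would give ρ² < 2ρ + M(1 + r)², which is impossible.
  have hρM : ρ ≤ (2 + M) * (1 + r) := by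
    by_contra! hcon
    have e1 := exclSq_le (a := a) (b := b) hβ hr
    have e2 : 2 * δ * (ρ + β * r) ≤ 2 * (ρ + β * r) := by
      have : 0 ≤ ρ + β * r := by positivity
      nlinarith
    have e3 : c₀ * δ ≤ c₀ := by nlinarith
    have e4 : ρ ^ 2 < 2 * ρ + M * (1 + r) ^ 2 := by
      have : β * (1 + a ^ 2) * (1 + r) ^ 2 + 2 * (β * r) + c₀ ≤ M * (1 + r) ^ 2 := by
        rw [hM]
        nlinarith [mul_nonneg hc₀ hr, mul_nonneg hc₀ (sq_nonneg r), mul_nonneg hβ.le hr,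
          mul_nonneg hβ.le (sq_nonneg r)]
      linarith
    have e5 : 1 + r ≤ ρ := by nlinarith
    nlinarith [mul_le_mul e5 e5 (by positivity) hρ, mul_nonneg hM0.le (sub_nonneg.2 e5)]
  have : 2 * δ * (ρ + β * r) + c₀ * δ ≤ δ * (bandConst β a c₀ * (1 + r)) := by
    have : 2 * (ρ + β * r) + c₀ ≤ bandConst β a c₀ * (1 + r) := by
      unfold bandConst
      rw [← hM]
      nlinarith [mul_nonneg hc₀ hr]
    nlinarith
  linarith

/-- In the narrow range around the circle of radius `√τ`, the radius is almost `√τ`. -/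
lemma abs_radius_sub_le {τ ρ w : ℝ} (hτ : 0 < τ) (hρ : 0 ≤ ρ) (h1 : τ < ρ ^ 2)
    (h2 : ρ ^ 2 < τ + w) : |ρ - √τ| ≤ w / √τ := by
  have hs := Real.sqrt_pos.2 hτ
  have hlt : √τ < ρ := (Real.sqrt_lt' (by nlinarith [Real.sq_sqrt hτ.le, hρ.lt_of_ne (by rintro rfl; nlinarith)])).2 h1
  rw [abs_of_pos (sub_pos.2 hlt), le_div_iff₀ hs]
  nlinarith [Real.sq_sqrt hτ.le]

end Radial

section BandVolume

variable {β a b c₀ δ c : ℝ} {p : Plane} {H : Plane → ℝ}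

lemma indicator_polar_le {A : Set Plane} {B : Set ℝ} {θ : ℝ}
    (h : ∀ r, 0 < r → r • unitVec θ ∈ A → r ∈ B) :
    ∫⁻ r in Ioi (0 : ℝ), ENNReal.ofReal r * A.indicator 1 (r • unitVec θ) ≤
      ∫⁻ r in Ioi (0 : ℝ), ENNReal.ofReal r * B.indicator 1 r := by
  refine setLIntegral_mono' measurableSet_Ioi fun r hr => ?_
  gcongr
  by_cases hA : r • unitVec θ ∈ A
  · rw [indicator_of_mem hA, indicator_of_mem (h r hr hA)]; simp
  · rw [indicator_of_notMem hA]; exact zero_le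

lemma le_indicator_polar {A : Set Plane} {B : Set ℝ} {θ : ℝ}
    (h : ∀ r, 0 < r → r ∈ B → r • unitVec θ ∈ A) :
    ∫⁻ r in Ioi (0 : ℝ), ENNReal.ofReal r * B.indicator 1 r ≤
      ∫⁻ r in Ioi (0 : ℝ), ENNReal.ofReal r * A.indicator 1 (r • unitVec θ) := by
  refine setLIntegral_mono' measurableSet_Ioi fun r hr => ?_
  gcongr
  by_cases hB : r ∈ B
  · rw [indicator_of_mem hB, indicator_of_mem (h r hr hB)]; simp
  · rw [indicator_of_notMem hB]; exact zero_le

lemma norm_smul_unitVec {r : ℝ} (hr : 0 ≤ r) (θ : ℝ) : ‖r • unitVec θ‖ = r := by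
  rw [norm_smul, norm_unitVec, mul_one, Real.norm_of_nonneg hr]

lemma volume_angles : volume (Ioo (-π) π) = ENNReal.ofReal (2 * π) := by
  rw [Real.volume_Ioo]; ring_nf

variable (hβ : 0 < β) (hH : Continuous H) (hH0 : ∀ w, H w ≤ ‖w‖)
  (h0 : 0 < δ) (h1 : δ ≤ 1) (hc₀ : 0 ≤ c₀)

include hβ hH0 h0 h1 hc₀ in
lemma band_norm_sq_lt (hc : c ≤ c₀) {z : Plane}
    (hz : z ∈ band β (exclSq β a b ‖p‖) p H δ c) :
    ‖z‖ ^ 2 < exclSq β a b ‖p‖ + δ * (bandConst β a c₀ * (1 + ‖p‖)) := by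
  refine radius_sq_lt (h := H (z - β • p)) hβ (norm_nonneg p) h0 h1 hc₀ hc (norm_nonneg z) ?_ hz.2
  refine (hH0 _).trans ((norm_sub_le _ _).trans (le_of_eq ?_))
  rw [norm_smul, Real.norm_of_nonneg hβ.le]

include hβ hH0 h0 h1 hc₀ in
lemma band_subset_ball (hc : c ≤ c₀) :
    Bornology.IsBounded (band β (exclSq β a b ‖p‖) p H δ c) := by
  refine (Metric.isBounded_closedBall (x := (0 : Plane))
    (r := √(exclSq β a b ‖p‖ + δ * (bandConst β a c₀ * (1 + ‖p‖))))).subset fun z hz => ?_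
  rw [mem_closedBall_zero_iff]
  exact Real.le_sqrt_of_sq_le (band_norm_sq_lt hβ hH0 h0 h1 hc₀ hc hz).le

include hβ hH hH0 h0 h1 hc₀ in
lemma volume_band_le (hc : c ≤ c₀) :
    volume (band β (exclSq β a b ‖p‖) p H δ c) ≤
      ENNReal.ofReal (π * (δ * (bandConst β a c₀ * (1 + ‖p‖)))) := by
  have hK := bandConst_pos (a := a) hβ hc₀
  set w := δ * (bandConst β a c₀ * (1 + ‖p‖)) with hw
  have hw0 : 0 ≤ w := by positivity
  rw [volume_eq_lintegral_polar (measurableSet_band hH δ c)]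
  have : ∀ θ, ∫⁻ r in Ioi (0 : ℝ), ENNReal.ofReal r *
      (band β (exclSq β a b ‖p‖) p H δ c).indicator 1 (r • unitVec θ) ≤
      ENNReal.ofReal (w / 2) := by
    intro θ
    refine (indicator_polar_le (B := {r | exclSq β a b ‖p‖ < r ^ 2 ∧
      r ^ 2 < exclSq β a b ‖p‖ + w}) fun r hr h => ?_).trans ?_
    · have h2 := band_norm_sq_lt hβ hH0 h0 h1 hc₀ hc h
      have h3 := h.1
      rw [norm_smul_unitVec hr.le] at h2 h3
      exact ⟨h3, h2⟩
    · rw [lintegral_ring]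
      refine ENNReal.ofReal_le_ofReal ?_
      gcongr
      rw [sub_le_iff_le_add]
      refine max_le ?_ ?_
      · linarith [le_max_left (exclSq β a b ‖p‖) 0]
      · linarith [le_max_right (exclSq β a b ‖p‖) 0]
  refine (lintegral_mono this).trans (le_of_eq ?_)
  rw [setLIntegral_const, volume_angles, ← ENNReal.ofReal_mul (by positivity)]
  congr 1; ring

include hβ hH0 h0 h1 hc₀ in
lemma band_eq_empty (hc : c ≤ c₀)
    (h : exclSq β a b ‖p‖ + δ * (bandConst β a c₀ * (1 + ‖p‖)) ≤ 0) :
    band β (exclSq β a b ‖p‖) p H δ c = ∅ := by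
  refine Set.eq_empty_iff_forall_notMem.2 fun z hz => ?_
  have := band_norm_sq_lt hβ hH0 h0 h1 hc₀ hc hz
  nlinarith [sq_nonneg ‖z‖]

/-- The error in the area of a band. -/
noncomputable def bandError (β τ a c₀ r δ : ℝ) : ℝ :=
  2 * δ * (δ * (bandConst β a c₀ * (1 + r)) / √τ) + c₀ * δ ^ 2

variable (hH1 : ∀ w w', H w - H w' ≤ ‖w - w'‖) (hτ : 0 < exclSq β a b ‖p‖)

include hβ hH hH0 h0 h1 hc₀ hH1 hτ in
-- On each ray the band stays within w/√τ of the circle, and H is 1-Lipschitz, so H may be evaluated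
-- on the circle at the cost of the band error. Half the width in r² is the area per unit angle.
-- Rays with negative H contribute through `ENNReal.ofReal`, that is, through the positive part.
lemma volume_band_upper (hc : c ≤ c₀) :
    volume (band β (exclSq β a b ‖p‖) p H δ c) ≤
      ENNReal.ofReal δ * (∫⁻ θ in Ioo (-π) π,
        ENNReal.ofReal (H (√(exclSq β a b ‖p‖) • unitVec θ - β • p))) +
      ENNReal.ofReal (π * bandError β (exclSq β a b ‖p‖) a c₀ ‖p‖ δ) := by
  have hK := bandConst_pos (a := a) hβ hc₀
  set τ := exclSq β a b ‖p‖ with hτd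
  set w := δ * (bandConst β a c₀ * (1 + ‖p‖)) with hw
  have hw0 : 0 ≤ w := by positivity
  have hε : bandError β τ a c₀ ‖p‖ δ = 2 * δ * (w / √τ) + c₀ * δ ^ 2 := rfl
  set ε := bandError β τ a c₀ ‖p‖ δ
  have hε0 : 0 ≤ ε := by rw [hε]; positivity
  rw [volume_eq_lintegral_polar (measurableSet_band hH δ c)]
  have : ∀ θ, ∫⁻ r in Ioi (0 : ℝ), ENNReal.ofReal r *
      (band β τ p H δ c).indicator 1 (r • unitVec θ) ≤
      ENNReal.ofReal δ * ENNReal.ofReal (H (√τ • unitVec θ - β • p)) + ENNReal.ofReal (ε / 2) := by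
    intro θ
    refine (indicator_polar_le (B := {r | τ < r ^ 2 ∧
      r ^ 2 < τ + (2 * δ * H (√τ • unitVec θ - β • p) + ε)}) fun r hr h => ?_).trans ?_
    · have h2 := band_norm_sq_lt hβ hH0 h0 h1 hc₀ hc h
      have h3 := h.1
      have h4 := h.2
      rw [norm_smul_unitVec hr.le] at h2 h3 h4
      have h5 := abs_radius_sub_le hτ hr.le h3 h2
      have h6 := hH1 (r • unitVec θ - β • p) (√τ • unitVec θ - β • p)
      rw [sub_sub_sub_cancel_right, ← sub_smul, norm_smul, norm_unitVec, mul_one,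
        Real.norm_eq_abs] at h6
      refine ⟨h3, h4.trans_le ?_⟩
      rw [hε]
      have h7 : c * δ ^ 2 ≤ c₀ * δ ^ 2 := by gcongr
      have h8 : 2 * δ * H (r • unitVec θ - β • p) ≤
          2 * δ * (H (√τ • unitVec θ - β • p) + w / √τ) := by gcongr; linarith
      linarith
    · rw [lintegral_ring, max_eq_left hτ.le, ← ENNReal.ofReal_mul h0.le]
      refine le_trans (ENNReal.ofReal_le_ofReal_iff'.2 ?_) ENNReal.ofReal_add_le
      rcases le_total (τ + (2 * δ * H (√τ • unitVec θ - β • p) + ε)) 0 with h | h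
      · rw [max_eq_right h]; right; linarith
      · rw [max_eq_left h]; left; linarith
  refine (lintegral_mono this).trans (le_of_eq ?_)
  rw [lintegral_add_right _ measurable_const, setLIntegral_const, volume_angles,
    lintegral_const_mul' _ _ ENNReal.ofReal_ne_top, ← ENNReal.ofReal_mul (by positivity)]
  congr 2; ring

include hβ hH hH0 h0 hc₀ hH1 hτ in
lemma volume_band_lower (hc : -c₀ ≤ c) :
    ENNReal.ofReal δ * ∫⁻ θ in Ioo (-π) π,
        ENNReal.ofReal (H (√(exclSq β a b ‖p‖) • unitVec θ - β • p)) ≤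
      volume (band β (exclSq β a b ‖p‖) p H δ c) +
      ENNReal.ofReal (π * bandError β (exclSq β a b ‖p‖) a c₀ ‖p‖ δ) := by
  have hK := bandConst_pos (a := a) hβ hc₀
  have hw1 := sqrt_exclSq_add_le (a := a) (b := b) hβ hc₀ (norm_nonneg p)
  set τ := exclSq β a b ‖p‖ with hτd
  set w := δ * (bandConst β a c₀ * (1 + ‖p‖)) with hw
  have hw0 : 0 ≤ w := by positivity
  have hε : bandError β τ a c₀ ‖p‖ δ = 2 * δ * (w / √τ) + c₀ * δ ^ 2 := rfl
  set ε := bandError β τ a c₀ ‖p‖ δ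
  have hε0 : 0 ≤ ε := by rw [hε]; positivity
  rw [volume_eq_lintegral_polar (measurableSet_band hH δ c),
    ← lintegral_const_mul' _ _ ENNReal.ofReal_ne_top]
  have : ∀ θ, ENNReal.ofReal δ * ENNReal.ofReal (H (√τ • unitVec θ - β • p)) ≤
      (∫⁻ r in Ioi (0 : ℝ), ENNReal.ofReal r *
      (band β τ p H δ c).indicator 1 (r • unitVec θ)) + ENNReal.ofReal (ε / 2) := by
    intro θ
    refine le_trans ?_ (add_le_add_left (le_indicator_polar (B := {r | τ < r ^ 2 ∧
      r ^ 2 < τ + (2 * δ * H (√τ • unitVec θ - β • p) - ε)}) fun r hr h => ?_) _)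
    · rw [lintegral_ring, max_eq_left hτ.le, ← ENNReal.ofReal_mul h0.le]
      refine le_trans (ENNReal.ofReal_le_ofReal ?_) ENNReal.ofReal_add_le
      linarith [le_max_left (τ + (2 * δ * H (√τ • unitVec θ - β • p) - ε)) 0]
    · obtain ⟨h3, h4⟩ := h
      -- The band lemma does not apply yet to this point; the width bound comes from H ≤ √τ + β‖p‖
      -- on the circle.
      have h2 : r ^ 2 < τ + w := by
        have e1 := (hH0 (√τ • unitVec θ - β • p)).trans (norm_sub_le _ _)
        rw [norm_smul_unitVec (Real.sqrt_nonneg _), norm_smul, Real.norm_of_nonneg hβ.le] at e1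
        have e2 : 2 * δ * H (√τ • unitVec θ - β • p) ≤ w := by
          rw [hw]; nlinarith
        linarith
      have h5 := abs_radius_sub_le hτ hr.le h3 h2
      have h6 := hH1 (√τ • unitVec θ - β • p) (r • unitVec θ - β • p)
      rw [sub_sub_sub_cancel_right, ← sub_smul, norm_smul, norm_unitVec, mul_one,
        Real.norm_eq_abs, abs_sub_comm] at h6
      refine ⟨by rwa [norm_smul_unitVec hr.le], ?_⟩
      rw [norm_smul_unitVec hr.le]
      refine h4.trans_le ?_
      rw [hε]
      have h7 : -c₀ * δ ^ 2 ≤ c * δ ^ 2 := by gcongr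
      have h8 : 2 * δ * H (√τ • unitVec θ - β • p) ≤
          2 * δ * (H (r • unitVec θ - β • p) + w / √τ) := by gcongr; linarith
      linarith
  refine (lintegral_mono this).trans (le_of_eq ?_)
  rw [lintegral_add_right _ measurable_const, setLIntegral_const, volume_angles,
    ← ENNReal.ofReal_mul (by positivity)]
  congr 2; ring

end BandVolume

/-! ### An empty disc and an occupied band -/

/-- The disc `‖z‖² ≤ τ`, empty for negative `τ`. -/
def discSq (τ : ℝ) : Set Plane := {z | ‖z‖ ^ 2 ≤ τ}

lemma measurableSet_discSq (τ : ℝ) : MeasurableSet (discSq τ) :=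
  (isClosed_le (f := fun z : Plane => ‖z‖ ^ 2) (by fun_prop) continuous_const).measurableSet

lemma discSq_eq (τ : ℝ) : discSq τ = if 0 ≤ τ then Metric.closedBall 0 √τ else ∅ := by
  ext z
  split_ifs with h
  · rw [mem_closedBall_zero_iff, Real.le_sqrt (norm_nonneg z) h]; rfl
  · simp only [mem_empty_iff_false, iff_false]
    intro hz
    exact h ((sq_nonneg ‖z‖).trans hz)

lemma isBounded_discSq (τ : ℝ) : Bornology.IsBounded (discSq τ) := by
  rw [discSq_eq]
  split_ifs
  exacts [Metric.isBounded_closedBall, Bornology.isBounded_empty]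

lemma volume_discSq (τ : ℝ) : (volume (discSq τ)).toReal = π * max τ 0 := by
  rw [discSq_eq]
  split_ifs with h
  · rw [EuclideanSpace.volume_closedBall_fin_two, ENNReal.toReal_mul, ENNReal.toReal_pow,
      ENNReal.toReal_ofReal (Real.sqrt_nonneg _), ENNReal.toReal_ofReal Real.pi_pos.le,
      Real.sq_sqrt h, max_eq_left h, mul_comm]
  · rw [max_eq_right (not_le.1 h).le]; simp

namespace IsPoissonPointProcess

variable {Ω : Type*} {Φ : Ω → Set Plane} [MeasurableSpace Ω] {P : Measure Ω} {lam : ℝ}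

lemma void_discSq (h : IsPoissonPointProcess P Φ lam) (hl : 0 < lam) (τ : ℝ) :
    P {ω | Φ ω ∩ discSq τ = ∅} = ENNReal.ofReal (Real.exp (-(π * lam * max τ 0))) := by
  rw [h.void_prob hl (measurableSet_discSq τ) (isBounded_discSq τ), volume_discSq]
  ring_nf

/-- The event is a difference of two void events, for the disc and for its union with V, so void
probabilities suffice. -/
lemma void_and_hit [IsProbabilityMeasure P] (h : IsPoissonPointProcess P Φ lam) (hl : 0 < lam)
    {τ : ℝ} {V : Set Plane} (hV : MeasurableSet V) (hb : Bornology.IsBounded V)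
    (hd : ∀ z ∈ V, τ < ‖z‖ ^ 2) :
    P {ω | Φ ω ∩ discSq τ = ∅ ∧ (Φ ω ∩ V).Nonempty} =
      ENNReal.ofReal (Real.exp (-(π * lam * max τ 0)) *
        (1 - Real.exp (-(lam * (volume V).toReal)))) := by
  have hdisj : Disjoint (discSq τ) V := Set.disjoint_left.2 fun z hz hz' => not_lt.2 hz (hd z hz')
  have e : {ω | Φ ω ∩ discSq τ = ∅ ∧ (Φ ω ∩ V).Nonempty} =
      {ω | Φ ω ∩ discSq τ = ∅} \ {ω | Φ ω ∩ (discSq τ ∪ V) = ∅} := by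
    ext ω
    simp only [mem_ofPred_eq, Set.mem_sdiff, inter_union_distrib_left, union_empty_iff, not_and,
      nonempty_iff_ne_empty]
    tauto
  have hsub : {ω | Φ ω ∩ (discSq τ ∪ V) = ∅} ⊆ {ω | Φ ω ∩ discSq τ = ∅} := fun ω hω =>
    Set.subset_eq_empty (by gcongr; exact subset_union_left) hω
  rw [e, measure_sdiff hsub
    (h.measurableSet_void ((measurableSet_discSq τ).union hV)).nullMeasurableSet
    (measure_ne_top _ _), h.void_discSq hl,
    h.void_prob hl ((measurableSet_discSq τ).union hV) ((isBounded_discSq τ).union hb),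
    measure_union hdisj hV, ENNReal.toReal_add (isBounded_discSq τ).measure_lt_top.ne
      hb.measure_lt_top.ne, volume_discSq, ← ENNReal.ofReal_sub _ (by positivity)]
  congr 1
  rw [mul_sub, mul_one, ← Real.exp_add]
  ring_nf

lemma void_and_hit_le [IsProbabilityMeasure P] (h : IsPoissonPointProcess P Φ lam) (hl : 0 < lam)
    {τ : ℝ} {V : Set Plane} (hV : MeasurableSet V) (hb : Bornology.IsBounded V)
    (hd : ∀ z ∈ V, τ < ‖z‖ ^ 2) :
    P {ω | Φ ω ∩ discSq τ = ∅ ∧ (Φ ω ∩ V).Nonempty} ≤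
      ENNReal.ofReal (Real.exp (-(π * lam * max τ 0)) * lam) * volume V := by
  rw [h.void_and_hit hl hV hb hd]
  nth_rw 2 [← ENNReal.ofReal_toReal hb.measure_lt_top.ne]
  rw [← ENNReal.ofReal_mul (by positivity)]
  refine ENNReal.ofReal_le_ofReal ?_
  rw [mul_assoc (Real.exp _)]
  refine mul_le_mul_of_nonneg_left ?_ (Real.exp_nonneg _)
  linarith [Real.add_one_le_exp (-(lam * (volume V).toReal))]

lemma le_void_and_hit [IsProbabilityMeasure P] (h : IsPoissonPointProcess P Φ lam) (hl : 0 < lam)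
    {τ : ℝ} {V : Set Plane} (hV : MeasurableSet V) (hb : Bornology.IsBounded V)
    (hd : ∀ z ∈ V, τ < ‖z‖ ^ 2) {w : ℝ} (hw : volume V ≤ ENNReal.ofReal w) (hw0 : 0 ≤ w) :
    ENNReal.ofReal (Real.exp (-(π * lam * max τ 0)) * lam) * volume V ≤
      P {ω | Φ ω ∩ discSq τ = ∅ ∧ (Φ ω ∩ V).Nonempty} + ENNReal.ofReal ((lam * w) ^ 2) := by
  rw [h.void_and_hit hl hV hb hd]
  nth_rw 1 [← ENNReal.ofReal_toReal hb.measure_lt_top.ne]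
  rw [← ENNReal.ofReal_mul (by positivity)]
  refine le_trans (ENNReal.ofReal_le_ofReal ?_) ENNReal.ofReal_add_le
  have hvw : (volume V).toReal ≤ w := ENNReal.toReal_le_of_le_ofReal hw0 hw
  set x := lam * (volume V).toReal with hx
  have hx0 : 0 ≤ x := by positivity
  have hxw : x ^ 2 ≤ (lam * w) ^ 2 := by
    rw [hx]
    gcongr
  set E := Real.exp (-(π * lam * max τ 0))
  have hE0 : 0 ≤ E := Real.exp_nonneg _
  have hE1 : E ≤ 1 := Real.exp_le_one_iff.2 (by
    have : 0 ≤ max τ 0 := le_max_right _ _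
    have : 0 ≤ π * lam * max τ 0 := by positivity
    linarith)
  -- This follows from exp(−x) ≤ 1/(1 + x) and (1 + x)(1 − x + x²) = 1 + x³ ≥ 1.
  have h1 : Real.exp (-x) ≤ 1 - x + x ^ 2 := by
    have h2 : Real.exp (-x) ≤ 1 / (1 + x) := by
      rw [Real.exp_neg, inv_eq_one_div]
      exact one_div_le_one_div_of_le (by positivity) (by linarith [Real.add_one_le_exp x])
    refine h2.trans ?_
    rw [div_le_iff₀ (by positivity)]
    nlinarith [pow_nonneg hx0 3]
  calc E * lam * (volume V).toReal = E * x := by rw [hx]; ring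
    _ ≤ E * (1 - Real.exp (-x) + x ^ 2) := by gcongr; linarith
    _ = E * (1 - Real.exp (-x)) + E * x ^ 2 := by ring
    _ ≤ E * (1 - Real.exp (-x)) + (lam * w) ^ 2 := by
      gcongr
      calc E * x ^ 2 ≤ 1 * x ^ 2 := by gcongr
        _ ≤ _ := by rw [one_mul]; exact hxw

end IsPoissonPointProcess

/-! ### Conditional crossing probabilities to first order -/

/-- The uniform distribution on the angles. -/
noncomputable def angleLaw : Measure ℝ :=
  (ENNReal.ofReal (2 * π))⁻¹ • volume.restrict (Ioo (-π) π)

instance : IsProbabilityMeasure angleLaw := ⟨by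
  rw [angleLaw, Measure.smul_apply, Measure.restrict_apply_univ, volume_angles, smul_eq_mul]
  exact ENNReal.inv_mul_cancel (by simp [Real.pi_pos]) ENNReal.ofReal_ne_top⟩

/-- A bound for the second order terms in the probability of a cell boundary near the user. -/
noncomputable def crossError (K β a b δ r : ℝ) : ℝ :=
  if 0 < exclSq β a b r then
    K * δ ^ 2 * (1 + r) ^ 2 * (1 + 1 / √(exclSq β a b r))
  else if 0 < exclSq β a b r + K * δ * (1 + r) then K * δ * (1 + r) else 0

/-- The first order term: void probability times the rate of crossings. -/
noncomputable def crossRate (lam β a b : ℝ) (Θ : ℝ) (r : ℝ) : ℝ :=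
  if 0 < exclSq β a b r then Real.exp (-(π * lam * exclSq β a b r)) * lam * Θ else 0

/-- Replacing the cells by bands, the conditional crossing probability has the expected
first order. -/
lemma exists_cross_bounds {lam β a b c₀ : ℝ} (hl : 0 < lam) (hβ : 0 < β) (hc₀ : 0 ≤ c₀) :
    ∃ K : ℝ, 0 < K ∧ ∀ {Ω : Type*} [MeasurableSpace Ω] {P : Measure Ω} [IsProbabilityMeasure P]
      {Φ : Ω → Set Plane} (_ : IsPoissonPointProcess P Φ lam) {δ : ℝ} (_ : 0 < δ) (_ : δ ≤ 1)
      {p : Plane} {H : ℝ → Plane → ℝ} (_ : ∀ φ, Continuous (H φ)) (_ : ∀ φ w, H φ w ≤ ‖w‖)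
      (_ : ∀ φ w w', H φ w - H φ w' ≤ ‖w - w'‖) {Θ : ℝ}
      (_ : ∫⁻ φ, (∫⁻ θ in Ioo (-π) π, ENNReal.ofReal
        (H φ (√(exclSq β a b ‖p‖) • unitVec θ - β • p))) ∂angleLaw = ENNReal.ofReal Θ)
      {F : ℝ → ℝ≥0∞}
      (_ : ∀ φ, F φ ≤ P {ω | Φ ω ∩ discSq (exclSq β a b ‖p‖) = ∅ ∧
        (Φ ω ∩ band β (exclSq β a b ‖p‖) p (H φ) δ c₀).Nonempty}) {far : Prop}
      (_ : far → ∀ φ, P {ω | Φ ω ∩ discSq (exclSq β a b ‖p‖) = ∅ ∧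
        (Φ ω ∩ band β (exclSq β a b ‖p‖) p (H φ) δ (-c₀)).Nonempty} ≤ F φ),
      (∫⁻ φ, F φ ∂angleLaw ≤ ENNReal.ofReal (δ * crossRate lam β a b Θ ‖p‖) +
        ENNReal.ofReal (crossError K β a b δ ‖p‖)) ∧
      (far → ENNReal.ofReal (δ * crossRate lam β a b Θ ‖p‖) ≤
        ∫⁻ φ, F φ ∂angleLaw + ENNReal.ofReal (crossError K β a b δ ‖p‖)) ∧
      ENNReal.ofReal (δ * crossRate lam β a b Θ ‖p‖) ≤
        ENNReal.ofReal (K * δ) * ENNReal.ofReal (1 + ‖p‖) := by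
  set B := bandConst β a c₀ with hB
  have hB0 : 0 < B := bandConst_pos hβ hc₀
  -- The first two summands serve the second order error for τ > 0, the third the a priori bound of
  -- the rate and the range τ ≤ 0, and the last decides when the band is empty.
  set K := lam * π * (2 * B + c₀) + (lam * (π * B)) ^ 2 + lam * (π * B) + B with hK
  have hK1 : lam * π * (2 * B + c₀) + (lam * (π * B)) ^ 2 ≤ K := by
    have : 0 < lam * (π * B) := by positivity
    linarith
  have hK2 : lam * (π * B) ≤ K := by
    have : 0 ≤ lam * π * (2 * B + c₀) + (lam * (π * B)) ^ 2 := by positivity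
    linarith
  have hK3 : B ≤ K := by
    have : 0 ≤ lam * π * (2 * B + c₀) + (lam * (π * B)) ^ 2 := by positivity
    have : 0 < lam * (π * B) := by positivity
    linarith
  have hK0 : 0 < K := hB0.trans_le hK3
  refine ⟨K, hK0, ?_⟩
  intro Ω _ P _ Φ hP δ h0 h1 p H hHc hH0 hH1 Θ hΘ F hup far hlow
  set r := ‖p‖ with hr
  have hr0 : 0 ≤ r := norm_nonneg p
  set τ := exclSq β a b r with hτ
  have hsq := sqrt_exclSq_add_le (a := a) (b := b) hβ hc₀ hr0
  rw [← hτ, ← hB] at hsq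
  set E := Real.exp (-(π * lam * max τ 0)) with hE
  have hE0 : 0 < E := Real.exp_pos _
  have hE1 : E ≤ 1 := Real.exp_le_one_iff.2 (by
    have : 0 ≤ max τ 0 := le_max_right _ _
    have : 0 ≤ π * lam * max τ 0 := by positivity
    linarith)
  have hcneg : -c₀ ≤ c₀ := by linarith
  have hmeas : ∀ φ c, MeasurableSet (band β τ p (H φ) δ c) := fun φ c =>
    measurableSet_band (hHc φ) δ c
  have hbd : ∀ φ c, c ≤ c₀ → Bornology.IsBounded (band β τ p (H φ) δ c) := fun φ c hc =>
    band_subset_ball hβ (hH0 φ) h0 h1 hc₀ hc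
  have hout : ∀ φ c, ∀ z ∈ band β τ p (H φ) δ c, τ < ‖z‖ ^ 2 := fun φ c z hz => hz.1
  have hvol : ∀ φ c, c ≤ c₀ → volume (band β τ p (H φ) δ c) ≤
      ENNReal.ofReal (π * (δ * (B * (1 + r)))) := fun φ c hc =>
    volume_band_le hβ (hHc φ) (hH0 φ) h0 h1 hc₀ hc
  have hF : ∀ φ, F φ ≤ ENNReal.ofReal (E * lam) * volume (band β τ p (H φ) δ c₀) := fun φ =>
    (hup φ).trans (hP.void_and_hit_le hl (hmeas φ c₀) (hbd φ c₀ le_rfl) (hout φ c₀))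
  set Θf : ℝ → ℝ≥0∞ := fun φ => ∫⁻ θ in Ioo (-π) π, ENNReal.ofReal (H φ (√τ • unitVec θ - β • p))
    with hΘf
  -- For τ > 0 the band follows a genuine circle. For τ ≤ 0 the rate is 0, and the band is empty
  -- unless τ > −Kδ(1 + r), where the crude area bound suffices.
  by_cases hpos : 0 < τ
  · have hmax : max τ 0 = τ := max_eq_left hpos.le
    have hrate : ENNReal.ofReal (δ * crossRate lam β a b Θ r) =
        ENNReal.ofReal (E * lam) * (ENNReal.ofReal δ * ENNReal.ofReal Θ) := by
      rw [crossRate, if_pos hpos, ← ENNReal.ofReal_mul h0.le, ← ENNReal.ofReal_mul (by positivity),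
        hE, hmax, ← hτ]
      ring_nf
    have hber : π * bandError β τ a c₀ r δ ≤
        π * (2 * B + c₀) * δ ^ 2 * (1 + r) ^ 2 * (1 + 1 / √τ) := by
      unfold bandError
      rw [← hB]
      have hs := Real.sqrt_pos.2 hpos
      have i1 : 2 * δ * (δ * (B * (1 + r)) / √τ) ≤ 2 * B * δ ^ 2 * (1 + r) ^ 2 * (1 + 1 / √τ) := by
        calc 2 * δ * (δ * (B * (1 + r)) / √τ) = 2 * B * δ ^ 2 * (1 + r) * (1 / √τ) := by ring
          _ ≤ 2 * B * δ ^ 2 * (1 + r) ^ 2 * (1 + 1 / √τ) := by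
            gcongr
            · nlinarith
            · linarith
      have i2 : c₀ * δ ^ 2 ≤ c₀ * δ ^ 2 * ((1 + r) ^ 2 * (1 + 1 / √τ)) := by
        refine le_mul_of_one_le_right (by positivity) ?_
        have : 0 < 1 / √τ := by positivity
        nlinarith [mul_nonneg (by positivity : 0 ≤ 2 * r + r ^ 2) this.le]
      calc _ ≤ π * (2 * B * δ ^ 2 * (1 + r) ^ 2 * (1 + 1 / √τ) +
          c₀ * δ ^ 2 * ((1 + r) ^ 2 * (1 + 1 / √τ))) := by gcongr
        _ = _ := by ring
    have herr : lam * (π * bandError β τ a c₀ r δ) + (lam * (π * (δ * (B * (1 + r))))) ^ 2 ≤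
        crossError K β a b δ r := by
      rw [crossError, if_pos hpos]
      have j1 : (lam * (π * (δ * (B * (1 + r))))) ^ 2 ≤
          (lam * (π * B)) ^ 2 * (δ ^ 2 * (1 + r) ^ 2 * (1 + 1 / √τ)) := by
        rw [show (lam * (π * (δ * (B * (1 + r))))) ^ 2 =
          (lam * (π * B)) ^ 2 * (δ ^ 2 * (1 + r) ^ 2 * 1) by ring]
        gcongr
        have : 0 ≤ 1 / √τ := by positivity
        linarith
      calc _ ≤ lam * (π * (2 * B + c₀) * δ ^ 2 * (1 + r) ^ 2 * (1 + 1 / √τ)) +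
            (lam * (π * B)) ^ 2 * (δ ^ 2 * (1 + r) ^ 2 * (1 + 1 / √τ)) := by gcongr
        _ = (lam * π * (2 * B + c₀) + (lam * (π * B)) ^ 2) *
            (δ ^ 2 * (1 + r) ^ 2 * (1 + 1 / √τ)) := by ring
        _ ≤ K * (δ ^ 2 * (1 + r) ^ 2 * (1 + 1 / √τ)) := by gcongr
        _ = _ := by ring
    have hbe0 : 0 ≤ bandError β τ a c₀ r δ := by unfold bandError; positivity
    have hEl : E * lam ≤ lam := by nlinarith
    refine ⟨?_, ?_, ?_⟩
    · calc ∫⁻ φ, F φ ∂angleLaw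
          ≤ ∫⁻ φ, ENNReal.ofReal (E * lam) * (ENNReal.ofReal δ * Θf φ +
              ENNReal.ofReal (π * bandError β τ a c₀ r δ)) ∂angleLaw := by
            refine lintegral_mono fun φ => (hF φ).trans ?_
            gcongr
            exact volume_band_upper hβ (hHc φ) (hH0 φ) h0 h1 hc₀ (hH1 φ) hpos le_rfl
        _ = ENNReal.ofReal (δ * crossRate lam β a b Θ r) +
            ENNReal.ofReal (E * lam) * ENNReal.ofReal (π * bandError β τ a c₀ r δ) := by
            rw [lintegral_const_mul' _ _ ENNReal.ofReal_ne_top, lintegral_add_right _ measurable_const,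
              lintegral_const_mul' _ _ ENNReal.ofReal_ne_top, lintegral_const, measure_univ, mul_one,
              hΘ, mul_add, hrate]
        _ ≤ _ := by
            gcongr
            rw [← ENNReal.ofReal_mul (by positivity)]
            refine ENNReal.ofReal_le_ofReal (le_trans ?_ herr)
            have : 0 ≤ (lam * (π * (δ * (B * (1 + r))))) ^ 2 := by positivity
            have : E * lam * (π * bandError β τ a c₀ r δ) ≤ lam * (π * bandError β τ a c₀ r δ) := by
              gcongr
            linarith
    · intro hfar
      have hpt : ∀ φ, ENNReal.ofReal (E * lam) * (ENNReal.ofReal δ * Θf φ) ≤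
          F φ + ENNReal.ofReal (crossError K β a b δ r) := by
        intro φ
        have k1 := volume_band_lower (b := b) hβ (hHc φ) (hH0 φ) h0 hc₀ (hH1 φ) hpos (le_refl (-c₀))
        have k2 := hP.le_void_and_hit hl (hmeas φ (-c₀)) (hbd φ _ hcneg) (hout φ _)
          (hvol φ _ hcneg) (by positivity)
        calc ENNReal.ofReal (E * lam) * (ENNReal.ofReal δ * Θf φ)
            ≤ ENNReal.ofReal (E * lam) * (volume (band β τ p (H φ) δ (-c₀)) +
              ENNReal.ofReal (π * bandError β τ a c₀ r δ)) := by gcongr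
          _ ≤ (F φ + ENNReal.ofReal ((lam * (π * (δ * (B * (1 + r))))) ^ 2)) +
              ENNReal.ofReal (lam * (π * bandError β τ a c₀ r δ)) := by
              rw [mul_add, ← ENNReal.ofReal_mul (by positivity : 0 ≤ E * lam)]
              gcongr
              exact k2.trans (by gcongr; exact hlow hfar φ)
          _ ≤ _ := by
              rw [add_assoc, ← ENNReal.ofReal_add (by positivity) (by positivity)]
              gcongr
              linarith
      calc ENNReal.ofReal (δ * crossRate lam β a b Θ r)
          = ∫⁻ φ, ENNReal.ofReal (E * lam) * (ENNReal.ofReal δ * Θf φ) ∂angleLaw := by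
            rw [lintegral_const_mul' _ _ ENNReal.ofReal_ne_top,
              lintegral_const_mul' _ _ ENNReal.ofReal_ne_top, hΘ, hrate]
        _ ≤ ∫⁻ φ, (F φ + ENNReal.ofReal (crossError K β a b δ r)) ∂angleLaw := lintegral_mono hpt
        _ = _ := by
            rw [lintegral_add_right _ measurable_const, lintegral_const, measure_univ, mul_one]
    · have hΘle : ∀ φ, Θf φ ≤ ENNReal.ofReal (π * (B * (1 + r))) := by
        intro φ
        calc Θf φ ≤ ∫⁻ θ in Ioo (-π) π, ENNReal.ofReal (√τ + β * r) := by
              refine lintegral_mono fun θ => ENNReal.ofReal_le_ofReal ?_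
              have e1 := (hH0 φ (√τ • unitVec θ - β • p)).trans (norm_sub_le _ _)
              rwa [norm_smul_unitVec (Real.sqrt_nonneg _), norm_smul,
                Real.norm_of_nonneg hβ.le] at e1
          _ ≤ _ := by
              rw [setLIntegral_const, volume_angles, ← ENNReal.ofReal_mul (by positivity)]
              refine ENNReal.ofReal_le_ofReal ?_
              nlinarith [Real.pi_pos]
      have hΘ2 : ENNReal.ofReal Θ ≤ ENNReal.ofReal (π * (B * (1 + r))) := by
        rw [← hΘ]
        refine (lintegral_mono hΘle).trans ?_
        rw [lintegral_const, measure_univ, mul_one]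
      rw [hrate]
      calc _ ≤ ENNReal.ofReal lam * (ENNReal.ofReal δ * ENNReal.ofReal (π * (B * (1 + r)))) := by
            gcongr
        _ = ENNReal.ofReal (lam * (π * B) * δ) * ENNReal.ofReal (1 + r) := by
            rw [← ENNReal.ofReal_mul h0.le, ← ENNReal.ofReal_mul hl.le,
              ← ENNReal.ofReal_mul (by positivity)]
            ring_nf
        _ ≤ _ := by gcongr
  · have hrate : crossRate lam β a b Θ r = 0 := by rw [crossRate, if_neg hpos]
    rw [hrate, mul_zero, ENNReal.ofReal_zero]
    refine ⟨?_, fun _ => zero_le, zero_le⟩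
    rw [zero_add, crossError, if_neg hpos]
    split_ifs with hc
    · refine (lintegral_mono hF).trans ?_
      calc ∫⁻ φ, ENNReal.ofReal (E * lam) * volume (band β τ p (H φ) δ c₀) ∂angleLaw
          ≤ ∫⁻ φ, ENNReal.ofReal (K * δ * (1 + r)) ∂angleLaw := by
            refine lintegral_mono fun φ => ?_
            refine (mul_le_mul_right (hvol φ c₀ le_rfl) _).trans ?_
            rw [← ENNReal.ofReal_mul (by positivity)]
            refine ENNReal.ofReal_le_ofReal ?_
            calc E * lam * (π * (δ * (B * (1 + r)))) ≤ 1 * lam * (π * (δ * (B * (1 + r)))) := by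
                  gcongr
              _ = lam * (π * B) * δ * (1 + r) := by ring
              _ ≤ K * δ * (1 + r) := by gcongr
        _ = _ := by rw [lintegral_const, measure_univ, mul_one]
    · have hemp : ∀ φ, band β τ p (H φ) δ c₀ = ∅ := fun φ =>
        band_eq_empty hβ (hH0 φ) h0 h1 hc₀ le_rfl (by
          have : δ * (B * (1 + r)) ≤ K * δ * (1 + r) := by
            calc δ * (B * (1 + r)) = B * δ * (1 + r) := by ring
              _ ≤ _ := by gcongr
          rw [← hr, ← hτ]
          linarith)
      refine (lintegral_mono hF).trans ?_
      simp [hemp]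

/-! ### From displaced users to bands -/

section Geometry

variable {β a b δ : ℝ} {p : Plane} {S : Set Plane}

/-- An exact expansion: the linear term in v produces the band, and the quadratic remainder is
absorbed by the constant |1 − β| + 1 used below. -/
lemma sq_dist_sub_exclSq (β a b : ℝ) (v z p : Plane) :
    dist v z ^ 2 - exclSq β a b (dist v p) =
      ‖z‖ ^ 2 - exclSq β a b ‖p‖ - 2 * inner ℝ v (z - β • p) + (1 - β) * ‖v‖ ^ 2 := by
  unfold exclSq
  rw [dist_eq_norm, dist_eq_norm, norm_sub_sq_real, norm_sub_sq_real, inner_sub_right,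
    inner_smul_right]
  ring

lemma exclSq_mono (hβ : 0 < β) {r s : ℝ} (hr : 0 ≤ r) (h : r ≤ s) :
    exclSq β a b r ≤ exclSq β a b s := by
  unfold exclSq; gcongr

/-- If all points of `S` but `p` are farther from the origin than `p` by at least `2 δ`, then `p`
is the nearest point of `S` from each location at distance at most `δ`. -/
lemma infDist_eq_of_far (hp : p ∈ S) (hfar : ∀ p' ∈ S, p' ≠ p → ‖p‖ + 2 * δ ≤ ‖p'‖) {v : Plane}
    (hv : ‖v‖ ≤ δ) : Metric.infDist v S = dist v p := by
  refine le_antisymm (Metric.infDist_le_dist_of_mem hp) ((Metric.le_infDist ⟨p, hp⟩).2 ?_)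
  intro p' hp'
  by_cases h : p' = p
  · rw [h]
  · have h1 := hfar p' hp' h
    have h2 : ‖p'‖ - ‖v‖ ≤ dist v p' := by
      rw [dist_comm, dist_eq_norm]; exact norm_sub_norm_le _ _
    have h3 : dist v p ≤ ‖v‖ + ‖p‖ := by rw [dist_eq_norm]; exact norm_sub_le _ _
    linarith

/-- Cauchy–Schwarz bounds the linear term. No separation of p from the other stations is required:
the nearest station is at most as far as p, and `exclSq` is monotone. -/
lemma mem_band_of_ball (hβ : 0 < β) (hp : p ∈ S) {v z : Plane} (hv : ‖v‖ < δ)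
    (hz : exclSq β a b ‖p‖ < ‖z‖ ^ 2)
    (h : dist v z ^ 2 ≤ exclSq β a b (Metric.infDist v S)) :
    z ∈ band β (exclSq β a b ‖p‖) p norm δ (|1 - β| + 1) := by
  refine ⟨hz, ?_⟩
  have h1 := h.trans (exclSq_mono hβ Metric.infDist_nonneg (Metric.infDist_le_dist_of_mem hp))
  have h2 := sq_dist_sub_exclSq β a b v z p
  have h3 := real_inner_le_norm v (z - β • p)
  have h4 : ‖v‖ * ‖z - β • p‖ ≤ δ * ‖z - β • p‖ := by gcongr
  have hv0 := norm_nonneg v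
  -- The additional 1 in the constant makes this strict even for β = 1.
  have h5 : -(1 - β) * ‖v‖ ^ 2 < (|1 - β| + 1) * δ ^ 2 := by
    have : ‖v‖ ^ 2 < δ ^ 2 := by gcongr
    have h6 := neg_abs_le (1 - β)
    have h7 := abs_nonneg (1 - β)
    nlinarith [sq_nonneg ‖v‖]
  linarith

lemma exists_unit_inner_eq (w : Plane) : ∃ u : Plane, ‖u‖ = 1 ∧ inner ℝ u w = ‖w‖ := by
  obtain ⟨α, hα⟩ := exists_eq_smul_unitVec w
  refine ⟨unitVec α, norm_unitVec α, ?_⟩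
  nth_rw 1 [hα]
  rw [inner_smul_right, inner_unitVec]
  simp

/-- The best displacement points along z − βp, which turns Cauchy–Schwarz into an equality. Here p
has to remain the nearest station, hence the separation by 2δ. -/
lemma exists_ball_of_mem_band (h0 : 0 < δ) (hp : p ∈ S)
    (hfar : ∀ p' ∈ S, p' ≠ p → ‖p‖ + 2 * δ ≤ ‖p'‖) {z : Plane}
    (hz : z ∈ band β (exclSq β a b ‖p‖) p norm δ (-(|1 - β| + 1))) :
    ∃ v : Plane, ‖v‖ < δ ∧ dist v z ^ 2 ≤ exclSq β a b (Metric.infDist v S) := by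
  obtain ⟨u, hu, hu'⟩ := exists_unit_inner_eq (z - β • p)
  have hcont : Continuous fun t : ℝ =>
      ‖z‖ ^ 2 - exclSq β a b ‖p‖ - 2 * (t * ‖z - β • p‖) + (1 - β) * t ^ 2 := by fun_prop
  have hneg : ‖z‖ ^ 2 - exclSq β a b ‖p‖ - 2 * (δ * ‖z - β • p‖) + (1 - β) * δ ^ 2 < 0 := by
    have := hz.2
    have h6 := le_abs_self (1 - β)
    nlinarith [sq_nonneg δ]
  -- Displacements of length exactly δ are not allowed, but the inequality at δ is strict and
  -- persists for slightly shorter ones.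
  have hev : ∀ᶠ t in 𝓝[<] δ,
      ‖z‖ ^ 2 - exclSq β a b ‖p‖ - 2 * (t * ‖z - β • p‖) + (1 - β) * t ^ 2 < 0 :=
    ((hcont.tendsto δ).eventually (gt_mem_nhds hneg)).filter_mono nhdsWithin_le_nhds
  have hev2 : ∀ᶠ t in 𝓝[<] δ, t ∈ Ioo 0 δ := Ioo_mem_nhdsLT h0
  obtain ⟨t, ht, ht0, ht1⟩ := (hev.and hev2).exists
  have hn : ‖t • u‖ = t := by rw [norm_smul, hu, mul_one, Real.norm_of_nonneg ht0.le]
  refine ⟨t • u, by rwa [hn], ?_⟩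
  rw [infDist_eq_of_far hp hfar (by rw [hn]; exact ht1.le)]
  have h2 := sq_dist_sub_exclSq β a b (t • u) z p
  rw [hn, inner_smul_left, hu'] at h2
  simp only [conj_trivial] at h2
  linarith

lemma mem_band_of_vec (hβ : 0 < β) (hp : p ∈ S) {u z : Plane} (h0 : 0 < δ) (hu : ‖u‖ = 1)
    (hz : exclSq β a b ‖p‖ < ‖z‖ ^ 2)
    (h : dist (δ • u) z ^ 2 < exclSq β a b (Metric.infDist (δ • u) S)) :
    z ∈ band β (exclSq β a b ‖p‖) p (fun w => inner ℝ u w) δ (|1 - β| + 1) := by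
  refine ⟨hz, ?_⟩
  have h1 := h.trans_le (exclSq_mono hβ Metric.infDist_nonneg (Metric.infDist_le_dist_of_mem hp))
  have h2 := sq_dist_sub_exclSq β a b (δ • u) z p
  rw [norm_smul, hu, mul_one, Real.norm_of_nonneg h0.le, inner_smul_left] at h2
  simp only [conj_trivial] at h2
  have h6 := neg_abs_le (1 - β)
  nlinarith [sq_nonneg δ]

lemma vec_of_mem_band (hp : p ∈ S) (hfar : ∀ p' ∈ S, p' ≠ p → ‖p‖ + 2 * δ ≤ ‖p'‖)
    {u z : Plane} (h0 : 0 < δ) (hu : ‖u‖ = 1)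
    (hz : z ∈ band β (exclSq β a b ‖p‖) p (fun w => inner ℝ u w) δ (-(|1 - β| + 1))) :
    dist (δ • u) z ^ 2 < exclSq β a b (Metric.infDist (δ • u) S) := by
  have hn : ‖δ • u‖ = δ := by rw [norm_smul, hu, mul_one, Real.norm_of_nonneg h0.le]
  rw [infDist_eq_of_far hp hfar hn.le]
  have h2 := sq_dist_sub_exclSq β a b (δ • u) z p
  rw [hn, inner_smul_left] at h2
  simp only [conj_trivial] at h2
  have := hz.2
  have h6 := le_abs_self (1 - β)
  nlinarith [sq_nonneg δ]

end Geometry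

namespace Network

variable (N : Network)

lemma beta_mul_gap (k : Tier) (r r' : ℝ) : N.beta k.other k * N.gap k r r' =
    exclSq (N.beta k.other k) (N.hdiff k) (N.hdiff k.other) r - r' ^ 2 := by
  unfold gap exclSq
  linear_combination (-(r' ^ 2 + N.hdiff k.other ^ 2)) * N.beta_mul_beta k.other k

lemma gap_neg_iff (k : Tier) (r r' : ℝ) : N.gap k r r' < 0 ↔
    exclSq (N.beta k.other k) (N.hdiff k) (N.hdiff k.other) r < r' ^ 2 := by
  have := N.beta_pos k.other k
  rw [← sub_neg (a := exclSq _ _ _ _), ← beta_mul_gap]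
  constructor <;> intro h <;> nlinarith

lemma gap_pos_iff (k : Tier) (r r' : ℝ) : 0 < N.gap k r r' ↔
    r' ^ 2 < exclSq (N.beta k.other k) (N.hdiff k) (N.hdiff k.other) r := by
  rw [← sub_pos (a := exclSq _ _ _ _), ← beta_mul_gap, mul_pos_iff_of_pos_left (N.beta_pos _ _)]

lemma gap_nonneg_iff (k : Tier) (r r' : ℝ) : 0 ≤ N.gap k r r' ↔
    r' ^ 2 ≤ exclSq (N.beta k.other k) (N.hdiff k) (N.hdiff k.other) r := by
  rw [← not_lt, gap_neg_iff, not_lt]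

lemma _root_.lt_sq_infDist_iff {S : Set Plane} (hS : IsClosed S) (hne : S.Nonempty) (v : Plane) (τ : ℝ) :
    τ < Metric.infDist v S ^ 2 ↔ ∀ z ∈ S, τ < dist v z ^ 2 := by
  constructor
  · intro h z hz
    refine h.trans_le ?_
    gcongr
    · exact Metric.infDist_nonneg
    · exact Metric.infDist_le_dist_of_mem hz
  · intro h
    obtain ⟨z, hz, e⟩ := hS.exists_infDist_eq_dist hne v
    rw [e]; exact h z hz

lemma _root_.le_sq_infDist_iff {S : Set Plane} (hS : IsClosed S) (hne : S.Nonempty) (v : Plane) (τ : ℝ) :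
    τ ≤ Metric.infDist v S ^ 2 ↔ ∀ z ∈ S, τ ≤ dist v z ^ 2 := by
  constructor
  · intro h z hz
    refine h.trans ?_
    gcongr
    · exact Metric.infDist_nonneg
    · exact Metric.infDist_le_dist_of_mem hz
  · intro h
    obtain ⟨z, hz, e⟩ := hS.exists_infDist_eq_dist hne v
    rw [e]; exact h z hz

lemma mem_servedBy_zero_iff {S : Tier → Set Plane} (hS : IsGood S) (k : Tier) :
    (0 : Plane) ∈ N.servedBy S k ↔ S k.other ∩ discSq (exclSq (N.beta k.other k) (N.hdiff k)
      (N.hdiff k.other) (Metric.infDist 0 (S k))) = ∅ := by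
  rw [N.mem_servedBy_iff hS, gap_neg_iff, lt_sq_infDist_iff (hS _).1 (hS _).2,
    Set.eq_empty_iff_forall_notMem]
  simp [discSq]

lemma mem_servedBy_other_iff_exists {S : Tier → Set Plane} (hS : IsGood S) (k : Tier) (v : Plane) :
    v ∈ N.servedBy S k.other ↔ ∃ z ∈ S k.other, dist v z ^ 2 <
      exclSq (N.beta k.other k) (N.hdiff k) (N.hdiff k.other) (Metric.infDist v (S k)) := by
  rw [N.mem_servedBy_other_iff hS, gap_pos_iff, ← not_le, le_sq_infDist_iff (hS _).1 (hS _).2]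
  simp

lemma mem_servedBy_and_extBoundary_iff {S : Tier → Set Plane} (hS : IsGood S) (k : Tier) {δ : ℝ}
    (hδ : 0 < δ) :
    ((0 : Plane) ∈ N.servedBy S k ∧ 0 ∈ N.extBoundary S δ) ↔
      S k.other ∩ discSq (exclSq (N.beta k.other k) (N.hdiff k)
        (N.hdiff k.other) (Metric.infDist 0 (S k))) = ∅ ∧
      ∃ v : Plane, ‖v‖ < δ ∧ ∃ z ∈ S k.other, dist v z ^ 2 ≤
        exclSq (N.beta k.other k) (N.hdiff k) (N.hdiff k.other) (Metric.infDist v (S k)) := by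
  rw [← N.mem_servedBy_zero_iff hS]
  refine and_congr_right fun h0 => ?_
  rw [N.mem_servedBy_iff hS] at h0
  rw [N.mem_extBoundary_iff hS k, and_iff_left ⟨0, Metric.mem_ball_self hδ, h0.le⟩]
  refine exists_congr fun v => ?_
  rw [mem_ball_zero_iff, gap_nonneg_iff, ← not_lt, lt_sq_infDist_iff (hS _).1 (hS _).2]
  simp

end Network

/-! ### Integrability of the first and second order terms -/

/-- The distance beyond which the exclusion disc is nonempty. -/
noncomputable def critRadius (β a b : ℝ) : ℝ := √(b ^ 2 / β - a ^ 2)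

section Analysis

variable {β a b : ℝ}

lemma exclSq_eq_mul (hβ : 0 < β) (r : ℝ) :
    exclSq β a b r = β * (r ^ 2 - (b ^ 2 / β - a ^ 2)) := by
  unfold exclSq; field_simp; ring

lemma exclSq_pos_iff (hβ : 0 < β) {r : ℝ} (hr : 0 < r) :
    0 < exclSq β a b r ↔ critRadius β a b < r := by
  rw [exclSq_eq_mul hβ, mul_pos_iff_of_pos_left hβ, sub_pos, critRadius, Real.sqrt_lt' hr]

lemma continuous_exclSq (β a b : ℝ) : Continuous (exclSq β a b) := by
  unfold exclSq; fun_prop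

/-- With c the critical radius, `exclSq` is at least β(r² − c²) ≥ β(r − c)r. So its inverse root has
at most an inverse square root singularity at c, which is integrable. -/
lemma le_sqrt_exclSq (hβ : 0 < β) {r : ℝ} (hr : critRadius β a b < r) :
    √β * √(r - critRadius β a b) * √r ≤ √(exclSq β a b r) := by
  have hc : 0 ≤ critRadius β a b := Real.sqrt_nonneg _
  have h1 : b ^ 2 / β - a ^ 2 ≤ critRadius β a b ^ 2 := by
    rcases le_total (b ^ 2 / β - a ^ 2) 0 with h | h
    · exact h.trans (sq_nonneg _)
    · rw [critRadius, Real.sq_sqrt h]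
  rw [← Real.sqrt_mul hβ.le, ← Real.sqrt_mul (by have := sub_pos.2 hr; positivity),
    exclSq_eq_mul hβ, mul_assoc]
  refine Real.sqrt_le_sqrt ?_
  gcongr
  nlinarith [mul_nonneg hc (sub_pos.2 hr).le]

lemma integrableOn_exp_mul_one_add (c C : ℝ) :
    IntegrableOn (fun r => Real.exp (-(r - c)) * (1 + C / √(r - c))) (Ioi c) := by
  -- After the shift by c, the two summands are Gamma integrals with parameters 1 and 1/2.
  have h1 : IntegrableOn (fun r : ℝ => Real.exp (-r) * r ^ ((1 : ℝ) - 1) +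
      C * (Real.exp (-r) * r ^ ((1 / 2 : ℝ) - 1))) (Ioi 0) :=
    (Real.GammaIntegral_convergent one_pos).add
      ((Real.GammaIntegral_convergent (by norm_num)).const_mul C)
  have h2 : IntegrableOn (fun r : ℝ => Real.exp (-r) * (1 + C / √r)) (Ioi 0) := by
    refine h1.congr_fun (fun r hr => ?_) measurableSet_Ioi
    have hr0 : (0 : ℝ) < r := hr
    have e : r ^ ((1 / 2 : ℝ) - 1) = 1 / √r := by
      rw [show (1 / 2 : ℝ) - 1 = -(1 / 2) by norm_num, Real.rpow_neg hr0.le, Real.sqrt_eq_rpow,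
        one_div (r ^ (1 / 2 : ℝ))]
    simp only [sub_self, Real.rpow_zero, e]
    ring
  have := (measurePreserving_sub_right volume c).integrableOn_comp_preimage
    (MeasurableEquiv.subRight c).measurableEmbedding (f := fun r : ℝ => Real.exp (-r) * (1 + C / √r))
    (s := Ioi 0)
  have h3 := this.2 h2
  simpa [Function.comp_def] using h3

/-- The principal second order term is integrable. -/
lemma lintegral_crossError_main_lt_top {lam : ℝ} (hl : 0 < lam) (hβ : 0 < β) :
    ∫⁻ r in Ioi (critRadius β a b), ENNReal.ofReal (2 * π * lam * r * Real.exp (-(π * lam * r ^ 2)) *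
      ((1 + r) ^ 2 * (1 + 1 / √(exclSq β a b r)))) < ∞ := by
  obtain ⟨K, hK, hKy⟩ := exists_pow_mul_exp_neg_sq_le 3 (c := π * lam) (by positivity)
  set c := critRadius β a b with hc
  have hc0 : 0 ≤ c := Real.sqrt_nonneg _
  have hint : IntegrableOn (fun r => 2 * π * lam * K *
      (Real.exp (-(r - c)) * (1 + (1 / √β) / √(r - c)))) (Ioi c) :=
    (integrableOn_exp_mul_one_add c (1 / √β)).const_mul _
  refine lt_of_le_of_lt ?_ hint.lintegral_lt_top
  refine setLIntegral_mono' measurableSet_Ioi fun r hr => ENNReal.ofReal_le_ofReal ?_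
  have hcr : c < r := hr
  have hr0 : 0 < r := hc0.trans_lt hcr
  have hsβ := Real.sqrt_pos.2 hβ
  have hsr := Real.sqrt_pos.2 hr0
  have hsd := Real.sqrt_pos.2 (sub_pos.2 hcr)
  have h1 : r / √(exclSq β a b r) ≤ (1 + r) * ((1 / √β) / √(r - c)) := by
    calc r / √(exclSq β a b r) ≤ r / (√β * √(r - c) * √r) := by
          gcongr; exact le_sqrt_exclSq hβ hcr
      _ = √r * ((1 / √β) / √(r - c)) := by
          have : r = √r * √r := (Real.mul_self_sqrt hr0.le).symm
          nth_rw 1 [this]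
          field_simp
      _ ≤ _ := by
          gcongr
          rw [Real.sqrt_le_iff]
          constructor <;> nlinarith
  have h2 : r * (1 + 1 / √(exclSq β a b r)) ≤ (1 + r) * (1 + (1 / √β) / √(r - c)) := by
    have : r * (1 + 1 / √(exclSq β a b r)) = r + r / √(exclSq β a b r) := by ring
    rw [this]; linarith
  calc 2 * π * lam * r * Real.exp (-(π * lam * r ^ 2)) *
        ((1 + r) ^ 2 * (1 + 1 / √(exclSq β a b r)))
      = 2 * π * lam * Real.exp (-(π * lam * r ^ 2)) * (1 + r) ^ 2 *
        (r * (1 + 1 / √(exclSq β a b r))) := by ring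
    _ ≤ 2 * π * lam * Real.exp (-(π * lam * r ^ 2)) * (1 + r) ^ 2 *
        ((1 + r) * (1 + (1 / √β) / √(r - c))) := by gcongr
    _ = 2 * π * lam * ((1 + r) ^ 3 * Real.exp (-(π * lam * r ^ 2))) *
        (1 + (1 / √β) / √(r - c)) := by ring
    _ ≤ 2 * π * lam * (K * Real.exp (-(r - c))) * (1 + (1 / √β) / √(r - c)) := by
        refine mul_le_mul_of_nonneg_right (mul_le_mul_of_nonneg_left ?_ (by positivity))
          (by positivity)
        refine (hKy r hr0.le).trans ?_
        gcongr
        linarith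
    _ = _ := by ring

lemma measurable_crossError (K β a b δ : ℝ) : Measurable (crossError K β a b δ) := by
  have := (continuous_exclSq β a b).measurable
  unfold crossError
  refine Measurable.ite (measurableSet_lt measurable_const this) (by fun_prop) ?_
  exact Measurable.ite (measurableSet_lt measurable_const (by fun_prop)) (by fun_prop)
    measurable_const

lemma lintegral_contactLaw {lam : ℝ} {f : ℝ → ℝ≥0∞} (hf : Measurable f) :
    ∫⁻ r, f r ∂contactLaw lam = ∫⁻ r in Ioi 0,
      ENNReal.ofReal (2 * π * lam * r * Real.exp (-(π * lam * r ^ 2))) * f r := by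
  rw [contactLaw, lintegral_withDensity_eq_lintegral_mul _ (by fun_prop) hf]
  rfl

/-- Beyond the critical radius the error is δ² times an integrable function. Below it the error is
only O(δ), but it lives on a range of r² of length O(δ). -/
lemma exists_lintegral_crossError_le {lam K : ℝ} (hl : 0 < lam) (hβ : 0 < β) (hK : 0 < K) :
    ∃ K' : ℝ, 0 < K' ∧ ∀ δ : ℝ, 0 < δ → δ ≤ 1 →
      ∫⁻ r, ENNReal.ofReal (crossError K β a b δ r) ∂contactLaw lam ≤ ENNReal.ofReal (K' * δ ^ 2) := by
  set c := critRadius β a b with hc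
  have hc0 : 0 ≤ c := Real.sqrt_nonneg _
  set I := ∫⁻ r in Ioi c, ENNReal.ofReal (2 * π * lam * r * Real.exp (-(π * lam * r ^ 2)) *
      ((1 + r) ^ 2 * (1 + 1 / √(exclSq β a b r)))) with hI
  have hIfin : I ≠ ∞ := (lintegral_crossError_main_lt_top hl hβ).ne
  set s := b ^ 2 / β - a ^ 2 with hs
  refine ⟨K * I.toReal + K * (1 + c) * (2 * π * lam) * ((K * (1 + c) / β + 1) / 2), by positivity,
    fun δ h0 h1 => ?_⟩
  rw [lintegral_contactLaw (measurable_crossError K β a b δ).ennreal_ofReal]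
  -- For r ≤ c, positivity of β(r² − s) + Kδ(1 + r) forces r² > s − w.
  set w := K * δ * (1 + c) / β with hw
  have hw0 : 0 < w := by positivity
  have hmain : Measurable fun r => (Ioi c).indicator (fun r => ENNReal.ofReal
      (2 * π * lam * r * Real.exp (-(π * lam * r ^ 2)) *
      ((1 + r) ^ 2 * (1 + 1 / √(exclSq β a b r))))) r := by
    have := (continuous_exclSq β a b).measurable
    exact Measurable.indicator (by fun_prop) measurableSet_Ioi
  have hpt : ∀ r ∈ Ioi (0 : ℝ), ENNReal.ofReal (2 * π * lam * r * Real.exp (-(π * lam * r ^ 2))) *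
      ENNReal.ofReal (crossError K β a b δ r) ≤
      ENNReal.ofReal (K * δ ^ 2) * (Ioi c).indicator (fun r => ENNReal.ofReal
        (2 * π * lam * r * Real.exp (-(π * lam * r ^ 2)) *
        ((1 + r) ^ 2 * (1 + 1 / √(exclSq β a b r))))) r +
      ENNReal.ofReal (K * δ * (1 + c) * (2 * π * lam)) * (ENNReal.ofReal r *
        {r : ℝ | s - w < r ^ 2 ∧ r ^ 2 < s - w + (w + δ)}.indicator 1 r) := by
    intro r hr
    have hr0 : 0 < r := hr
    have hiff := exclSq_pos_iff (a := a) (b := b) hβ hr0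
    rw [crossError]
    by_cases hpos : 0 < exclSq β a b r
    · rw [if_pos hpos, indicator_of_mem (mem_Ioi.2 (hiff.1 hpos)), ← ENNReal.ofReal_mul (by positivity),
        ← ENNReal.ofReal_mul (by positivity)]
      refine le_add_right (le_of_eq ?_)
      ring_nf
    · rw [if_neg hpos]
      split_ifs with hcl
      · refine le_add_left ?_
        have hrc : r ≤ c := not_lt.1 fun h => hpos (hiff.2 h)
        -- Below the critical radius r² ≤ s, possibly with equality; the additional δ in the width
        -- makes the upper bound strict.
        have hmem : r ∈ {r : ℝ | s - w < r ^ 2 ∧ r ^ 2 < s - w + (w + δ)} := by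
          rw [exclSq_eq_mul hβ] at hpos hcl
          have g1 : r ^ 2 - s ≤ 0 := by
            by_contra! hcon
            exact hpos (mul_pos hβ hcon)
          refine ⟨?_, by linarith⟩
          have g2 : K * δ * (1 + r) ≤ β * w := by
            rw [hw, mul_div_cancel₀ _ hβ.ne']; gcongr
          have g3 : 0 < β * (r ^ 2 - s + w) := by rw [mul_add]; linarith
          have := pos_of_mul_pos_right g3 hβ.le
          linarith
        rw [indicator_of_mem hmem, Pi.one_apply, mul_one, ← ENNReal.ofReal_mul (by positivity),
          ← ENNReal.ofReal_mul (by positivity)]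
        refine ENNReal.ofReal_le_ofReal ?_
        have he : Real.exp (-(π * lam * r ^ 2)) ≤ 1 := Real.exp_le_one_iff.2 (by
          have : 0 ≤ π * lam * r ^ 2 := by positivity
          linarith)
        calc 2 * π * lam * r * Real.exp (-(π * lam * r ^ 2)) * (K * δ * (1 + r))
            ≤ 2 * π * lam * r * 1 * (K * δ * (1 + c)) := by gcongr
          _ = _ := by ring
      · simp
  refine (setLIntegral_mono' measurableSet_Ioi hpt).trans ?_
  rw [lintegral_add_left (hmain.const_mul _), lintegral_const_mul _ hmain,
    lintegral_const_mul' _ _ ENNReal.ofReal_ne_top, lintegral_ring, lintegral_indicator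
    measurableSet_Ioi, Measure.restrict_restrict measurableSet_Ioi, Ioi_inter_Ioi,
    max_eq_left hc0, ← hI, ← ENNReal.ofReal_toReal hIfin, ← ENNReal.ofReal_mul (by positivity),
    ← ENNReal.ofReal_mul (by positivity)]
  refine (add_le_add_right (ENNReal.ofReal_le_ofReal
    (q := K * δ * (1 + c) * (2 * π * lam) * ((w + δ) / 2)) ?_) _).trans ?_
  · refine mul_le_mul_of_nonneg_left ?_ (by positivity)
    gcongr
    rw [sub_le_iff_le_add]
    refine max_le ?_ ?_
    · linarith [le_max_left (s - w) 0]
    · linarith [le_max_right (s - w) 0]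
  rw [← ENNReal.ofReal_add (by positivity) (by positivity)]
  refine ENNReal.ofReal_le_ofReal (le_of_eq ?_)
  rw [hw, ENNReal.toReal_ofReal ENNReal.toReal_nonneg]
  ring

/-- Half the integral of the distance between `β p`, for `‖p‖ = r`, and the points of the
exclusion circle. -/
noncomputable def circleDist (β a b r : ℝ) : ℝ :=
  ∫ θ in (0 : ℝ)..π, √(√(exclSq β a b r) ^ 2 + (β * r) ^ 2 -
    2 * √(exclSq β a b r) * (β * r) * Real.cos θ)

lemma continuous_circleDist (β a b : ℝ) : Continuous (circleDist β a b) := by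
  have := continuous_exclSq β a b
  unfold circleDist
  refine intervalIntegral.continuous_parametric_intervalIntegral_of_continuous' ?_ _ _
  fun_prop

lemma circleDist_nonneg (β a b r : ℝ) : 0 ≤ circleDist β a b r :=
  intervalIntegral.integral_nonneg Real.pi_pos.le fun _ _ => Real.sqrt_nonneg _

lemma circleDist_le (hβ : 0 < β) {r : ℝ} (hr : 0 ≤ r) :
    circleDist β a b r ≤ π * (bandConst β a 0 * (1 + r)) := by
  have h1 := sqrt_exclSq_add_le (a := a) (b := b) hβ le_rfl hr
  set t := √(exclSq β a b r)
  have ht : 0 ≤ t := Real.sqrt_nonneg _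
  have h2 : circleDist β a b r ≤ ∫ θ in (0 : ℝ)..π, (t + β * r) := by
    refine intervalIntegral.integral_mono_on Real.pi_pos.le
      (Continuous.intervalIntegrable (by fun_prop) _ _)
      (Continuous.intervalIntegrable (by fun_prop) _ _) fun θ _ => ?_
    rw [Real.sqrt_le_iff]
    refine ⟨by positivity, ?_⟩
    have := Real.neg_one_le_cos θ
    have : 0 ≤ t * (β * r) := by positivity
    nlinarith
  rw [intervalIntegral.integral_const, smul_eq_mul, sub_zero] at h2
  refine h2.trans ?_
  gcongr
  have : 0 ≤ β * r := by positivity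
  linarith

lemma lintegral_circle_norm {p : Plane} (hβ : 0 < β) :
    ∫⁻ θ in Ioo (-π) π, ENNReal.ofReal ‖√(exclSq β a b ‖p‖) • unitVec θ - β • p‖ =
      ENNReal.ofReal (2 * circleDist β a b ‖p‖) := by
  rw [lintegral_norm_circle_sub, norm_smul, Real.norm_of_nonneg hβ.le]
  rfl

/-- After exchanging the integrals, the positive part of ⟨e_φ, w⟩ has mean 2‖w‖/(2π) = ‖w‖/π. What
remains is the mean distance of the norm case, divided by π. -/
lemma lintegral_circle_inner {p : Plane} (hβ : 0 < β) :
    ∫⁻ φ, (∫⁻ θ in Ioo (-π) π, ENNReal.ofReal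
        (inner ℝ (unitVec φ) (√(exclSq β a b ‖p‖) • unitVec θ - β • p))) ∂angleLaw =
      ENNReal.ofReal (2 / π * circleDist β a b ‖p‖) := by
  have hu := continuous_unitVec
  rw [angleLaw, lintegral_smul_measure, lintegral_lintegral_swap (Measurable.aemeasurable (by
    refine Measurable.ennreal_ofReal (Continuous.measurable ?_)
    fun_prop))]
  simp_rw [lintegral_inner_unitVec]
  simp_rw [ENNReal.ofReal_mul (zero_le_two (α := ℝ))]
  rw [lintegral_const_mul' _ _ ENNReal.ofReal_ne_top, lintegral_circle_norm hβ, smul_eq_mul,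
    ← ENNReal.ofReal_mul zero_le_two, ← ENNReal.ofReal_inv_of_pos (by positivity),
    ← ENNReal.ofReal_mul (by positivity), ← ENNReal.ofReal_mul (by positivity)]
  congr 1
  field_simp

lemma measurable_crossRate (lam κ β a b : ℝ) :
    Measurable fun r => crossRate lam β a b (κ * circleDist β a b r) r := by
  have := (continuous_exclSq β a b).measurable
  have := (continuous_circleDist β a b).measurable
  unfold crossRate
  exact Measurable.ite (measurableSet_lt measurable_const (by fun_prop)) (by fun_prop)
    measurable_const

lemma crossRate_nonneg {lam κ : ℝ} (hl : 0 < lam) (hκ : 0 ≤ κ) (r : ℝ) :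
    0 ≤ crossRate lam β a b (κ * circleDist β a b r) r := by
  have := circleDist_nonneg β a b r
  unfold crossRate
  split_ifs <;> positivity

lemma integrable_crossRate {lam lam' κ : ℝ} (hl : 0 < lam) (hl' : 0 < lam') (hκ : 0 ≤ κ)
    (hβ : 0 < β) :
    Integrable (fun r => crossRate lam' β a b (κ * circleDist β a b r) r) (contactLaw lam) := by
  obtain ⟨K, hK, hKy⟩ := exists_pow_mul_exp_neg_sq_le 2 (c := π * lam) (by positivity)
  refine ⟨(measurable_crossRate lam' κ β a b).aestronglyMeasurable, ?_⟩
  rw [hasFiniteIntegral_iff_ofReal (Eventually.of_forall (crossRate_nonneg hl' hκ)),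
    lintegral_contactLaw (measurable_crossRate lam' κ β a b).ennreal_ofReal]
  have hB := bandConst_pos (a := a) hβ le_rfl
  have hint : IntegrableOn (fun r => 2 * π * lam * (lam' * (κ * (π * bandConst β a 0))) *
      (K * Real.exp (-r))) (Ioi 0) :=
    ((integrableOn_exp_neg_Ioi 0).const_mul _).const_mul _
  refine lt_of_le_of_lt (setLIntegral_mono' measurableSet_Ioi fun r hr => ?_) hint.lintegral_lt_top
  have hr0 : 0 < r := hr
  rw [← ENNReal.ofReal_mul (by positivity)]
  refine ENNReal.ofReal_le_ofReal ?_
  have h1 : crossRate lam' β a b (κ * circleDist β a b r) r ≤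
      lam' * (κ * (π * (bandConst β a 0 * (1 + r)))) := by
    unfold crossRate
    have hle := circleDist_le (a := a) (b := b) hβ hr0.le
    have hn := circleDist_nonneg β a b r
    split_ifs with hpos
    · have he : Real.exp (-(π * lam' * exclSq β a b r)) ≤ 1 := Real.exp_le_one_iff.2 (by
        have : 0 ≤ π * lam' * exclSq β a b r := by positivity
        linarith)
      calc _ ≤ 1 * lam' * (κ * (π * (bandConst β a 0 * (1 + r)))) := by gcongr
        _ = _ := by ring
    · positivity
  calc 2 * π * lam * r * Real.exp (-(π * lam * r ^ 2)) *
        crossRate lam' β a b (κ * circleDist β a b r) r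
      ≤ 2 * π * lam * (1 + r) * Real.exp (-(π * lam * r ^ 2)) *
        (lam' * (κ * (π * (bandConst β a 0 * (1 + r))))) := by
        have := crossRate_nonneg (a := a) (b := b) (β := β) hl' hκ r
        gcongr
        linarith
    _ = 2 * π * lam * (lam' * (κ * (π * bandConst β a 0))) *
        ((1 + r) ^ 2 * Real.exp (-(π * lam * r ^ 2))) := by ring
    _ ≤ _ := mul_le_mul_of_nonneg_left (hKy r hr0.le) (by positivity)

lemma integral_crossRate {lam lam' κ : ℝ} (hl : 0 < lam) (hβ : 0 < β) :
    ∫ r, crossRate lam' β a b (κ * circleDist β a b r) r ∂contactLaw lam =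
      κ * ∫ r in Ioi (critRadius β a b), lam' * circleDist β a b r *
        (2 * π * lam * r * Real.exp (-(π * lam * r ^ 2)) *
          Real.exp (-(π * lam' * exclSq β a b r))) := by
  have hc0 : 0 ≤ critRadius β a b := Real.sqrt_nonneg _
  rw [contactLaw, integral_withDensity_eq_integral_toReal_smul (by fun_prop)
    (Eventually.of_forall fun _ => ENNReal.ofReal_lt_top)]
  have h1 : ∀ r ∈ Ioi (0 : ℝ), (ENNReal.ofReal (2 * π * lam * r *
      Real.exp (-(π * lam * r ^ 2)))).toReal • crossRate lam' β a b (κ * circleDist β a b r) r =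
      (Ioi (critRadius β a b)).indicator (fun r => κ * (lam' * circleDist β a b r *
        (2 * π * lam * r * Real.exp (-(π * lam * r ^ 2)) *
          Real.exp (-(π * lam' * exclSq β a b r))))) r := by
    intro r hr
    have hr0 : 0 < r := hr
    have hiff := exclSq_pos_iff (a := a) (b := b) hβ hr0
    rw [ENNReal.toReal_ofReal (by positivity), crossRate, smul_eq_mul]
    split_ifs with h
    · rw [indicator_of_mem (mem_Ioi.2 (hiff.1 h))]; ring
    · rw [indicator_of_notMem (fun h' => h (hiff.2 (mem_Ioi.1 h'))), mul_zero]
  rw [setIntegral_congr_fun measurableSet_Ioi h1, setIntegral_indicator measurableSet_Ioi,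
    Ioi_inter_Ioi, max_eq_right hc0, integral_const_mul]

end Analysis

/-! ### Averaging over the nearest station -/

/-- Integration of the conditional crossing probabilities over the nearest station. -/
lemma IsPoissonPointProcess.exists_first_order {Ω : Type*} [MeasurableSpace Ω] {P : Measure Ω}
    [IsProbabilityMeasure P] {Φ : Ω → Set Plane} {lam lam' κ K β a b : ℝ}
    (h : IsPoissonPointProcess P Φ lam) (hl : 0 < lam) (hl' : 0 < lam') (hκ : 0 ≤ κ) (hK : 0 < K)
    (hβ : 0 < β) : ∃ C : ℝ, 0 < C ∧ ∀ δ : ℝ, 0 < δ → δ ≤ 1 → ∀ f : Ω → ℝ≥0∞,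
      (∀ᵐ ω ∂P, ∃ p ∈ Φ ω, ‖p‖ = Metric.infDist 0 (Φ ω) ∧
        (f ω ≤ ENNReal.ofReal (δ * crossRate lam' β a b (κ * circleDist β a b ‖p‖) ‖p‖) +
          ENNReal.ofReal (crossError K β a b δ ‖p‖)) ∧
        ((∀ p' ∈ Φ ω, p' ≠ p → ‖p‖ + 2 * δ ≤ ‖p'‖) →
          ENNReal.ofReal (δ * crossRate lam' β a b (κ * circleDist β a b ‖p‖) ‖p‖) ≤
            f ω + ENNReal.ofReal (crossError K β a b δ ‖p‖)) ∧
        ENNReal.ofReal (δ * crossRate lam' β a b (κ * circleDist β a b ‖p‖) ‖p‖) ≤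
          ENNReal.ofReal (K * δ) * ENNReal.ofReal (1 + ‖p‖)) →
      |(∫⁻ ω, f ω ∂P).toReal - δ * (κ * ∫ r in Ioi (critRadius β a b), lam' * circleDist β a b r *
        (2 * π * lam * r * Real.exp (-(π * lam * r ^ 2)) *
          Real.exp (-(π * lam' * exclSq β a b r))))| ≤ C * δ ^ 2 := by
  obtain ⟨K', hK', herr⟩ := exists_lintegral_crossError_le (a := a) (b := b) hl hβ hK
  obtain ⟨Kg, hKg, hpair⟩ := h.exists_lintegral_close_pair_le hl
  refine ⟨K' + K * Kg, by positivity, fun δ h0 h1 f hf => ?_⟩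
  obtain ⟨g, hgm, hgint, hg⟩ := hpair δ h0 h1
  rw [← integral_crossRate hl hβ]
  set rate : ℝ → ℝ := fun r => crossRate lam' β a b (κ * circleDist β a b r) r with hrate
  set R : Ω → ℝ := fun ω => Metric.infDist 0 (Φ ω) with hR
  have hRm : Measurable R := h.measurable_infDist 0
  have hlaw : P.map R = contactLaw lam := h.map_infDist hl 0
  have hratem : Measurable rate := measurable_crossRate lam' κ β a b
  have hrate0 : ∀ r, 0 ≤ rate r := crossRate_nonneg hl' hκ
  have hM0 : 0 ≤ ∫ r, rate r ∂contactLaw lam := integral_nonneg hrate0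
  have hrateint : ∫⁻ ω, ENNReal.ofReal (δ * rate (R ω)) ∂P =
      ENNReal.ofReal (δ * ∫ r, rate r ∂contactLaw lam) := by
    rw [← integral_const_mul, ofReal_integral_eq_lintegral_ofReal
      ((integrable_crossRate hl hl' hκ hβ).const_mul δ)
      (Eventually.of_forall fun r => mul_nonneg h0.le (hrate0 r)), ← hlaw,
      lintegral_map (hratem.const_mul δ).ennreal_ofReal hRm]
  have herrint : ∫⁻ ω, ENNReal.ofReal (crossError K β a b δ (R ω)) ∂P ≤
      ENNReal.ofReal (K' * δ ^ 2) := by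
    rw [← lintegral_map (f := fun r => ENNReal.ofReal (crossError K β a b δ r))
      (measurable_crossError K β a b δ).ennreal_ofReal hRm, hlaw]
    exact herr δ h0 h1
  have herrm : Measurable fun ω => ENNReal.ofReal (crossError K β a b δ (R ω)) :=
    ((measurable_crossError K β a b δ).comp hRm).ennreal_ofReal
  have hup : ∫⁻ ω, f ω ∂P ≤ ENNReal.ofReal (δ * ∫ r, rate r ∂contactLaw lam + K' * δ ^ 2) := by
    calc ∫⁻ ω, f ω ∂P ≤ ∫⁻ ω, (ENNReal.ofReal (δ * rate (R ω)) +
          ENNReal.ofReal (crossError K β a b δ (R ω))) ∂P := by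
          refine lintegral_mono_ae ?_
          filter_upwards [hf] with ω hω
          obtain ⟨p, hp, hpR, hb, -⟩ := hω
          rw [hpR] at hb
          exact hb
      _ ≤ _ := by
          rw [lintegral_add_right _ herrm, hrateint,
            ENNReal.ofReal_add (by positivity) (by positivity)]
          gcongr
  have hlow : ENNReal.ofReal (δ * ∫ r, rate r ∂contactLaw lam) ≤
      ∫⁻ ω, f ω ∂P + ENNReal.ofReal ((K' + K * Kg) * δ ^ 2) := by
    calc ENNReal.ofReal (δ * ∫ r, rate r ∂contactLaw lam)
        = ∫⁻ ω, ENNReal.ofReal (δ * rate (R ω)) ∂P := hrateint.symm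
      _ ≤ ∫⁻ ω, (f ω + (ENNReal.ofReal (crossError K β a b δ (R ω)) +
            ENNReal.ofReal (K * δ) * g ω)) ∂P := by
          refine lintegral_mono_ae ?_
          filter_upwards [hf] with ω hω
          obtain ⟨p, hp, hpR, -, hb1, hb2⟩ := hω
          have hgp := hg ω p hp
          rw [← hpR] at hgp
          simp only [hR, hrate, ← hpR]
          -- Without a competitor the conditional lower bound holds. With one, the rate is at most
          -- Kδ(1 + ‖p‖) ≤ Kδ g, and g has integral O(δ), so the loss is O(δ²).
          by_cases hfar : ∀ p' ∈ Φ ω, p' ≠ p → ‖p‖ + 2 * δ ≤ ‖p'‖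
          · rw [← add_assoc]
            exact le_add_right (hb1 hfar)
          · push Not at hfar
            obtain ⟨p', hp', hne, hlt⟩ := hfar
            refine hb2.trans (le_add_left (le_add_left ?_))
            gcongr
            exact hgp p' hp' hne.symm rfl hlt
      _ = ∫⁻ ω, f ω ∂P + (∫⁻ ω, ENNReal.ofReal (crossError K β a b δ (R ω)) ∂P +
            ENNReal.ofReal (K * δ) * ∫⁻ ω, g ω ∂P) := by
          -- Measurability of f is not assumed; the integral is split off through the measurable
          -- summand.
          have hm : Measurable fun ω => ENNReal.ofReal (crossError K β a b δ (R ω)) +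
              ENNReal.ofReal (K * δ) * g ω := herrm.add (hgm.const_mul _)
          rw [lintegral_add_right _ hm, lintegral_add_left herrm, lintegral_const_mul _ hgm]
      _ ≤ ∫⁻ ω, f ω ∂P + (ENNReal.ofReal (K' * δ ^ 2) +
            ENNReal.ofReal (K * δ) * ENNReal.ofReal (Kg * δ)) := by gcongr
      _ = _ := by
          rw [← ENNReal.ofReal_mul (by positivity), ← ENNReal.ofReal_add (by positivity)
            (by positivity)]
          ring_nf
  have hfin : ∫⁻ ω, f ω ∂P ≠ ∞ := ne_top_of_le_ne_top ENNReal.ofReal_ne_top hup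
  have hup' := ENNReal.toReal_le_of_le_ofReal (by positivity) hup
  have hlow' : δ * ∫ r, rate r ∂contactLaw lam ≤
      (∫⁻ ω, f ω ∂P).toReal + (K' + K * Kg) * δ ^ 2 := by
    rw [← ENNReal.ofReal_toReal hfin, ← ENNReal.ofReal_add ENNReal.toReal_nonneg
      (by positivity)] at hlow
    exact (ENNReal.ofReal_le_ofReal_iff (by positivity)).1 hlow
  rw [abs_le]
  have : 0 ≤ K * Kg * δ ^ 2 := by positivity
  constructor <;> nlinarith

namespace IsPoissonPointProcess

variable {Ω : Type*} [MeasurableSpace Ω] {P : Measure Ω} {Φ : Ω → Set Plane} {lam : ℝ}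

lemma measurable_infDist_uncurry (h : IsPoissonPointProcess P Φ lam) :
    Measurable (Function.uncurry fun (x : Plane) (ω : Ω) => Metric.infDist x (Φ ω)) :=
  measurable_uncurry_of_continuous_of_measurable
    (u := fun (x : Plane) (ω : Ω) => Metric.infDist x (Φ ω))
    (fun _ => Metric.continuous_infDist_pt _) (fun x => h.measurable_infDist x)

lemma measurable_infDist_comp (h : IsPoissonPointProcess P Φ lam) {Z : Type*} [MeasurableSpace Z]
    {u : Z → Plane} {w : Z → Ω} (hu : Measurable u) (hw : Measurable w) :
    Measurable fun z => Metric.infDist (u z) (Φ (w z)) := by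
  have h1 : Measurable fun z => (u z, w z) := hu.prodMk hw
  have h2 := h.measurable_infDist_uncurry
  unfold Function.uncurry at h2
  generalize hg : (fun (p : Plane × Ω) => Metric.infDist p.1 (Φ p.2)) = g at h2
  have h3 := h2.comp h1
  subst hg
  exact h3

end IsPoissonPointProcess

namespace Network

variable (N : Network)

/-- The part of the length term contributed by users of tier `k`. -/
noncomputable def halfLength (k : Tier) : ℝ :=
  ∫ r in Ioi (critRadius (N.beta k.other k) (N.hdiff k) (N.hdiff k.other)),
    N.lam k.other * circleDist (N.beta k.other k) (N.hdiff k) (N.hdiff k.other) r *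
      (2 * π * N.lam k * r * Real.exp (-(π * N.lam k * r ^ 2)) *
        Real.exp (-(π * N.lam k.other *
          exclSq (N.beta k.other k) (N.hdiff k) (N.hdiff k.other) r)))

lemma IsDeployment.measurableSet_pair_gap {N : Network} {Ω : Type*} [MeasurableSpace Ω]
    {P : Measure Ω} {Φ : Tier → Ω → Set Plane} (hΦ : N.IsDeployment P Φ) (k : Tier) {v : ℝ → Plane}
    (hv : Measurable v) : MeasurableSet ({z : (ℝ × Ω) × Ω |
      N.gap k (Metric.infDist 0 (Φ k z.1.2)) (Metric.infDist 0 (Φ k.other z.2)) < 0} ∩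
    {z | 0 < N.gap k (Metric.infDist (v z.1.1) (Φ k z.1.2))
      (Metric.infDist (v z.1.1) (Φ k.other z.2))}) := by
  have h0 : Measurable fun _ : (ℝ × Ω) × Ω => (0 : Plane) := measurable_const
  have hw1 : Measurable fun z : (ℝ × Ω) × Ω => z.1.2 := measurable_snd.comp measurable_fst
  have hw2 : Measurable fun z : (ℝ × Ω) × Ω => z.2 := measurable_snd
  have hv1 : Measurable fun z : (ℝ × Ω) × Ω => v z.1.1 :=
    hv.comp (measurable_fst.comp measurable_fst)
  have e1 := (hΦ.poisson k).measurable_infDist_comp h0 hw1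
  have e2 := (hΦ.poisson k.other).measurable_infDist_comp h0 hw2
  have e3 := (hΦ.poisson k).measurable_infDist_comp hv1 hw1
  have e4 := (hΦ.poisson k.other).measurable_infDist_comp hv1 hw2
  have hgap := (N.continuous_gap_uncurry k).measurable
  have m1 := hgap.comp (e1.prodMk e2)
  have m2 := hgap.comp (e3.prodMk e4)
  exact (m1 measurableSet_Iio).inter (m2 measurableSet_Ioi)

namespace IsDeployment

variable {N} {Ω : Type*} [MeasurableSpace Ω] {P : Measure Ω} [IsProbabilityMeasure P]
  {Φ : Tier → Ω → Set Plane}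

/-- The case H = norm, κ = 2: every displacement of length below δ is allowed, so the largest first
order gain counts. -/
lemma exists_prob_near_boundary (hΦ : N.IsDeployment P Φ) (k : Tier) :
    ∃ C : ℝ, 0 < C ∧ ∀ δ : ℝ, 0 < δ → δ ≤ 1 →
      |(P {ω | (0 : Plane) ∈ N.servedBy (fun i => Φ i ω) k ∧
        0 ∈ N.extBoundary (fun i => Φ i ω) δ}).toReal - δ * (2 * N.halfLength k)| ≤ C * δ ^ 2 := by
  set β := N.beta k.other k with hβd
  have hβ : 0 < β := N.beta_pos _ _
  obtain ⟨K, hK, hcross⟩ := exists_cross_bounds (a := N.hdiff k) (b := N.hdiff k.other)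
    (c₀ := |1 - β| + 1) (N.lam_pos k.other) hβ (by positivity)
  obtain ⟨C, hC, hfirst⟩ := (hΦ.poisson k).exists_first_order (a := N.hdiff k)
    (b := N.hdiff k.other) (κ := 2) (N.lam_pos k) (N.lam_pos k.other) zero_le_two hK hβ
  refine ⟨C, hC, fun δ h0 h1 => ?_⟩
  have hT : MeasurableSet {ξ | N.pathGap k 0 ξ < 0 ∧ ((0 : Plane), ξ) ∈ N.extPath k δ} := by
    have : {ξ | N.pathGap k 0 ξ < 0 ∧ ((0 : Plane), ξ) ∈ N.extPath k δ} =
      {ξ | N.pathGap k 0 ξ < 0} ∩ Prod.mk (0 : Plane) ⁻¹' N.extPath k δ := by ext; simp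
    rw [this]
    exact (measurableSet_lt (N.measurable_pathGap k 0) measurable_const).inter
      (measurable_prodMk_left (N.measurableSet_extPath k δ))
  rw [hΦ.prob_eq_lintegral_split k
    (p := fun S => (0 : Plane) ∈ N.servedBy S k ∧ 0 ∈ N.extBoundary S δ) hT fun S hS =>
    and_congr (N.mem_servedBy_iff hS k 0) (N.mem_extBoundary_iff_extPath hS k 0 δ)]
  refine hfirst δ h0 h1 _ ?_
  filter_upwards [hΦ.ae_isGood] with ω hω
  obtain ⟨p, hp, hpR⟩ := (hω k).1.exists_infDist_eq_dist (hω k).2 0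
  rw [dist_zero_left] at hpR
  refine ⟨p, hp, hpR.symm, ?_⟩
  have hnorm1 : ∀ w w' : Plane, ‖w‖ - ‖w'‖ ≤ ‖w - w'‖ := norm_sub_norm_le
  have hΘ : ∫⁻ _, (∫⁻ θ in Ioo (-π) π, ENNReal.ofReal
        ‖√(exclSq β (N.hdiff k) (N.hdiff k.other) ‖p‖) • unitVec θ - β • p‖) ∂angleLaw =
      ENNReal.ofReal (2 * circleDist β (N.hdiff k) (N.hdiff k.other) ‖p‖) := by
    rw [lintegral_const, measure_univ, mul_one, lintegral_circle_norm hβ]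
  -- Nothing depends on the direction φ here; the average over the probability measure `angleLaw` is
  -- trivial.
  have := hcross (hΦ.poisson k.other) h0 h1 (H := fun _ => norm) (fun _ => continuous_norm)
    (fun _ _ => le_rfl) (fun _ => hnorm1) hΘ
    (F := fun _ => P {ω' | (0 : Plane) ∈ N.servedBy
      (splitConfig k (fun i => Φ i ω) fun i => Φ i ω') k ∧
      0 ∈ N.extBoundary (splitConfig k (fun i => Φ i ω) fun i => Φ i ω') δ})
    (fun _ => by
      refine measure_mono_ae ?_
      filter_upwards [hΦ.ae_isGood] with ω' hω' hev
      obtain ⟨hv, v, hvδ, z, hz, hd⟩ :=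
        (N.mem_servedBy_and_extBoundary_iff (hω.splitConfig hω' k) k h0).1 hev
      simp only [splitConfig_self, splitConfig_other, hpR] at hv hz hd
      refine ⟨hv, z, hz, mem_band_of_ball hβ hp hvδ ?_ hd⟩
      by_contra! hcon
      exact (Set.eq_empty_iff_forall_notMem.1 hv) z ⟨hz, hcon⟩)
    (far := ∀ p' ∈ Φ k ω, p' ≠ p → ‖p‖ + 2 * δ ≤ ‖p'‖)
    (fun hfar _ => by
      refine measure_mono_ae ?_
      filter_upwards [hΦ.ae_isGood] with ω' hω' hev
      obtain ⟨hv, z, hz, hzb⟩ := hev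
      obtain ⟨v, hvδ, hd⟩ := exists_ball_of_mem_band h0 hp hfar hzb
      refine (N.mem_servedBy_and_extBoundary_iff (hω.splitConfig hω' k) k h0).2 ?_
      simp only [splitConfig_self, splitConfig_other, hpR]
      exact ⟨hv, v, hvδ, z, hz, hd⟩)
  simp only [lintegral_const, measure_univ, mul_one] at this
  exact this

/-- Decoupling of the tiers and averaging over the directions. -/
lemma prob_servedBy_pair_eq_lintegral (hΦ : N.IsDeployment P Φ) (k : Tier) {δ : ℝ} (h0 : 0 < δ)
    (φ₀ : ℝ) : P {ω | (0 : Plane) ∈ N.servedBy (fun i => Φ i ω) k ∧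
      δ • unitVec φ₀ ∈ N.servedBy (fun i => Φ i ω) k.other} =
    ∫⁻ ω, ∫⁻ φ, P {ω' | (0 : Plane) ∈ N.servedBy
        (splitConfig k (fun i => Φ i ω) fun i => Φ i ω') k ∧
      δ • unitVec φ ∈ N.servedBy (splitConfig k (fun i => Φ i ω) fun i => Φ i ω') k.other}
      ∂angleLaw ∂P := by
  have hEm := hΦ.measurableSet_pair_gap k (v := fun φ => δ • unitVec φ)
    (continuous_unitVec.const_smul δ).measurable
  set E := ({z : (ℝ × Ω) × Ω |
      N.gap k (Metric.infDist 0 (Φ k z.1.2)) (Metric.infDist 0 (Φ k.other z.2)) < 0} ∩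
    {z | 0 < N.gap k (Metric.infDist (δ • unitVec z.1.1) (Φ k z.1.2))
      (Metric.infDist (δ • unitVec z.1.1) (Φ k.other z.2))}) with hE
  have hmemE : ∀ φ ω, IsGood (fun i => Φ i ω) → P (Prod.mk (φ, ω) ⁻¹' E) = P {ω' |
      (0 : Plane) ∈ N.servedBy (splitConfig k (fun i => Φ i ω) fun i => Φ i ω') k ∧
      δ • unitVec φ ∈ N.servedBy (splitConfig k (fun i => Φ i ω) fun i => Φ i ω') k.other} := by
    intro φ ω hω
    refine measure_congr ?_
    filter_upwards [hΦ.ae_isGood] with ω' hω'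
    refine propext ?_
    change ((φ, ω), ω') ∈ E ↔ _ ∧ _
    rw [N.mem_servedBy_iff (hω.splitConfig hω' k),
      N.mem_servedBy_other_iff (hω.splitConfig hω' k)]
    simp [hE]
  have hGm : Measurable fun y => P (Prod.mk y ⁻¹' E) := measurable_measure_prodMk_left hEm
  clear_value E
  have hφ : ∀ φ, P {ω | (0 : Plane) ∈ N.servedBy (fun i => Φ i ω) k ∧
      δ • unitVec φ ∈ N.servedBy (fun i => Φ i ω) k.other} =
      ∫⁻ ω, P (Prod.mk (φ, ω) ⁻¹' E) ∂P := by
    intro φ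
    have hT : MeasurableSet {ξ | N.pathGap k 0 ξ < 0 ∧
        N.pathGap k.other (δ • unitVec φ) ξ < 0} :=
      (measurableSet_lt (N.measurable_pathGap k 0) measurable_const).inter
        (measurableSet_lt (N.measurable_pathGap _ _) measurable_const)
    rw [hΦ.prob_eq_lintegral_split k
      (p := fun S => (0 : Plane) ∈ N.servedBy S k ∧ δ • unitVec φ ∈ N.servedBy S k.other) hT
      fun S hS => and_congr (N.mem_servedBy_iff hS k 0) (N.mem_servedBy_iff hS _ _)]
    refine lintegral_congr_ae ?_
    filter_upwards [hΦ.ae_isGood] with ω hω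
    exact (hmemE φ ω hω).symm
  have hswap : ∫⁻ ω, ∫⁻ φ, P (Prod.mk (φ, ω) ⁻¹' E) ∂angleLaw ∂P =
      ∫⁻ φ, ∫⁻ ω, P (Prod.mk (φ, ω) ⁻¹' E) ∂P ∂angleLaw :=
    lintegral_lintegral_swap (f := fun ω φ => P (Prod.mk (φ, ω) ⁻¹' E))
      (hGm.comp measurable_swap).aemeasurable
  have hnv : ∀ φ, ‖δ • unitVec φ‖ = δ := norm_smul_unitVec h0.le
  -- By isotropy the probability equals its average over all directions. The exchange of integrals
  -- then puts this average inside, with the stations of tier k held fixed, as the crossing bounds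
  -- require.
  calc _ = ∫⁻ φ, P {ω | (0 : Plane) ∈ N.servedBy (fun i => Φ i ω) k ∧
        δ • unitVec φ ∈ N.servedBy (fun i => Φ i ω) k.other} ∂angleLaw := by
        rw [lintegral_congr fun φ => hΦ.prob_servedBy_pair_congr k (x := 0) (y := δ • unitVec φ)
          (x' := 0) (y' := δ • unitVec φ₀) (by rw [dist_zero_left, dist_zero_left, hnv, hnv]),
          lintegral_const, measure_univ, mul_one]
    _ = ∫⁻ ω, ∫⁻ φ, P (Prod.mk (φ, ω) ⁻¹' E) ∂angleLaw ∂P := by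
        rw [hswap]
        exact lintegral_congr hφ
    _ = _ := by
        refine lintegral_congr_ae ?_
        filter_upwards [hΦ.ae_isGood] with ω hω
        exact lintegral_congr fun φ => hmemE φ ω hω

/-- The case H = ⟨e_φ, ·⟩, κ = 2/π: for a fixed displacement only the positive part of the
projection counts, and its average over φ yields the factor 1/π relative to the boundary estimate.
-/
lemma exists_prob_servedBy_pair (hΦ : N.IsDeployment P Φ) (k : Tier) :
    ∃ C : ℝ, 0 < C ∧ ∀ δ : ℝ, 0 < δ → δ ≤ 1 → ∀ φ₀ : ℝ,
      |(P {ω | (0 : Plane) ∈ N.servedBy (fun i => Φ i ω) k ∧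
        δ • unitVec φ₀ ∈ N.servedBy (fun i => Φ i ω) k.other}).toReal -
          δ * (2 / π * N.halfLength k)| ≤ C * δ ^ 2 := by
  set β := N.beta k.other k with hβd
  have hβ : 0 < β := N.beta_pos _ _
  obtain ⟨K, hK, hcross⟩ := exists_cross_bounds (a := N.hdiff k) (b := N.hdiff k.other)
    (c₀ := |1 - β| + 1) (N.lam_pos k.other) hβ (by positivity)
  obtain ⟨C, hC, hfirst⟩ := (hΦ.poisson k).exists_first_order (a := N.hdiff k)
    (b := N.hdiff k.other) (κ := 2 / π) (N.lam_pos k) (N.lam_pos k.other) (by positivity) hK hβ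
  refine ⟨C, hC, fun δ h0 h1 φ₀ => ?_⟩
  rw [hΦ.prob_servedBy_pair_eq_lintegral k h0]
  refine hfirst δ h0 h1 _ ?_
  filter_upwards [hΦ.ae_isGood] with ω hω
  obtain ⟨p, hp, hpR⟩ := (hω k).1.exists_infDist_eq_dist (hω k).2 0
  rw [dist_zero_left] at hpR
  refine ⟨p, hp, hpR.symm, ?_⟩
  refine hcross (hΦ.poisson k.other) h0 h1 (p := p) (H := fun φ w => inner ℝ (unitVec φ) w)
    (fun _ => by fun_prop) (fun φ w => ?_) (fun φ w w' => ?_) (lintegral_circle_inner hβ)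
    (F := fun φ => P {ω' | (0 : Plane) ∈ N.servedBy
        (splitConfig k (fun i => Φ i ω) fun i => Φ i ω') k ∧
      δ • unitVec φ ∈ N.servedBy (splitConfig k (fun i => Φ i ω) fun i => Φ i ω') k.other})
    (fun φ => ?_)
    (far := ∀ p' ∈ Φ k ω, p' ≠ p → ‖p‖ + 2 * δ ≤ ‖p'‖) (fun hfar φ => ?_)
  · simpa [norm_unitVec] using real_inner_le_norm (unitVec φ) w
  · rw [← inner_sub_right]
    simpa [norm_unitVec] using real_inner_le_norm (unitVec φ) (w - w')
  · refine measure_mono_ae ?_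
    filter_upwards [hΦ.ae_isGood] with ω' hω' hev
    have hgood := hω.splitConfig hω' k
    obtain ⟨hv, hv2⟩ := hev
    rw [N.mem_servedBy_zero_iff hgood] at hv
    obtain ⟨z, hz, hd⟩ := (N.mem_servedBy_other_iff_exists hgood k _).1 hv2
    simp only [splitConfig_self, splitConfig_other, hpR] at hv hz hd
    refine ⟨hv, z, hz, mem_band_of_vec hβ hp h0 (norm_unitVec φ) ?_ hd⟩
    by_contra! hcon
    exact (Set.eq_empty_iff_forall_notMem.1 hv) z ⟨hz, hcon⟩
  · refine measure_mono_ae ?_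
    filter_upwards [hΦ.ae_isGood] with ω' hω' hev
    have hgood := hω.splitConfig hω' k
    obtain ⟨hv, z, hz, hzb⟩ := hev
    have hd := vec_of_mem_band hp hfar h0 (norm_unitVec φ) hzb
    refine ⟨?_, ?_⟩
    · rw [N.mem_servedBy_zero_iff hgood]
      simpa only [splitConfig_self, splitConfig_other, hpR] using hv
    · rw [N.mem_servedBy_other_iff_exists hgood]
      simp only [splitConfig_self, splitConfig_other]
      exact ⟨z, hz, hd⟩

end IsDeployment

end Network

/-! ### Association probabilities and the explicit formulas -/

namespace Network

variable (N : Network)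

/-- Density of the distance to the nearest station of tier `k`, on the event that this station
serves the user. -/
noncomputable def serviceDensity (k : Tier) (r : ℝ) : ℝ :=
  2 * π * N.lam k * r * Real.exp (-(π * N.lam k * r ^ 2)) *
    Real.exp (-(π * N.lam k.other *
      max (exclSq (N.beta k.other k) (N.hdiff k) (N.hdiff k.other) r) 0))

lemma continuous_serviceDensity (k : Tier) : Continuous (N.serviceDensity k) := by
  have := continuous_exclSq (N.beta k.other k) (N.hdiff k) (N.hdiff k.other)
  unfold serviceDensity
  fun_prop

lemma critDist_eq (k : Tier) :
    N.critDist k = critRadius (N.beta k.other k) (N.hdiff k) (N.hdiff k.other) := by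
  rw [critDist, critRadius, N.beta_eq_inv k k.other, div_eq_mul_inv]

lemma serviceDensity_of_le (k : Tier) {r : ℝ} (h0 : 0 < r) (h : r ≤ N.critDist k) :
    N.serviceDensity k r = 2 * (π * N.lam k) * r * Real.exp (-(π * N.lam k * r ^ 2)) := by
  rw [serviceDensity, max_eq_right]
  · rw [mul_zero, neg_zero, Real.exp_zero, mul_one]; ring
  · rw [← not_lt, exclSq_pos_iff (N.beta_pos _ _) h0, ← critDist_eq]
    exact h.not_gt

lemma serviceDensity_of_lt (k : Tier) {r : ℝ} (h : N.critDist k < r) :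
    N.serviceDensity k r = 2 * π * N.lam k * r * Real.exp (-(π * N.lam k * r ^ 2)) *
      Real.exp (-(π * N.lam k.other *
        exclSq (N.beta k.other k) (N.hdiff k) (N.hdiff k.other) r)) := by
  rw [serviceDensity, max_eq_left]
  rw [critDist_eq] at h
  exact ((exclSq_pos_iff (N.beta_pos _ _) ((Real.sqrt_nonneg _).trans_lt h)).2 h).le

lemma serviceDensity_nonneg (k : Tier) {r : ℝ} (hr : 0 ≤ r) : 0 ≤ N.serviceDensity k r := by
  have := N.lam_pos k
  unfold serviceDensity
  positivity

lemma assocProb_pos (k : Tier) : 0 < N.assocProb k := by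
  have h1 := N.lam_pos k
  have h2 := N.lam_pos k.other
  have h3 := N.beta_pos k.other k
  simp only [assocProb]
  split_ifs with h
  · have : Real.exp (π * N.lam k * (N.hdiff k ^ 2 - N.beta k k.other * N.hdiff k.other ^ 2)) ≤ 1 := by
      rw [Real.exp_le_one_iff]
      exact mul_nonpos_of_nonneg_of_nonpos (by positivity) (by linarith)
    have : 0 < N.lam k / (N.lam k + N.lam k.other * N.beta k.other k) *
      Real.exp (π * N.lam k * (N.hdiff k ^ 2 - N.beta k k.other * N.hdiff k.other ^ 2)) := by
      positivity
    linarith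
  · positivity

lemma assocProb_mul_servicePDF (k : Tier) {r : ℝ} (hr : 0 < r) :
    N.assocProb k * N.servicePDF k r = N.serviceDensity k r := by
  have hA := (N.assocProb_pos k).ne'
  simp only [servicePDF, not_lt.2 hr.le, if_false]
  split_ifs with h
  · rw [N.serviceDensity_of_le k hr h]
    field_simp
  · rw [N.serviceDensity_of_lt k (not_le.1 h), mul_assoc (2 * π * N.lam k * r), ← Real.exp_add]
    have : -(π * N.lam k * r ^ 2) + -(π * N.lam k.other *
        exclSq (N.beta k.other k) (N.hdiff k) (N.hdiff k.other) r) =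
        -π * r ^ 2 * (N.lam k + N.lam k.other * N.beta k.other k) -
        π * N.lam k.other * (N.hdiff k ^ 2 * N.beta k.other k - N.hdiff k.other ^ 2) := by
      unfold exclSq; ring
    rw [this]
    field_simp

lemma servicePDF_of_nonpos (k : Tier) {r : ℝ} (hr : r ≤ 0) : N.servicePDF k r = 0 := by
  rcases hr.lt_or_eq with h | rfl
  · simp [servicePDF, h]
  · simp [servicePDF]

/-- Beyond the critical distance both exponents are quadratic in r and merge into one Gaussian with
intensity λ_k + λ_j β_{jk}, whose primitive is explicit. -/
lemma integral_serviceDensity_tail (k : Tier) :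
    IntegrableOn (N.serviceDensity k) (Ioi (N.critDist k)) ∧
    ∫ r in Ioi (N.critDist k), N.serviceDensity k r =
      N.lam k / (N.lam k + N.lam k.other * N.beta k.other k) *
      (Real.exp (-(π * (N.lam k + N.lam k.other * N.beta k.other k) * N.critDist k ^ 2)) *
        Real.exp (-(π * N.lam k.other * (N.hdiff k ^ 2 * N.beta k.other k - N.hdiff k.other ^ 2)))) := by
  have h1 := N.lam_pos k
  have h2 := N.lam_pos k.other
  have h3 := N.beta_pos k.other k
  set s := N.lam k + N.lam k.other * N.beta k.other k with hs
  have hs0 : 0 < s := by positivity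
  set D := Real.exp (-(π * N.lam k.other *
    (N.hdiff k ^ 2 * N.beta k.other k - N.hdiff k.other ^ 2))) with hD
  have hc0 : 0 ≤ N.critDist k := Real.sqrt_nonneg _
  have heq : EqOn (N.serviceDensity k) (fun r => N.lam k / s * D *
      (2 * (π * s) * r * Real.exp (-(π * s * r ^ 2)))) (Ioi (N.critDist k)) := by
    intro r hr
    rw [N.serviceDensity_of_lt k hr, mul_assoc, ← Real.exp_add]
    have : -(π * N.lam k * r ^ 2) + -(π * N.lam k.other *
        exclSq (N.beta k.other k) (N.hdiff k) (N.hdiff k.other) r) =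
        -(π * s * r ^ 2) + -(π * N.lam k.other *
          (N.hdiff k ^ 2 * N.beta k.other k - N.hdiff k.other ^ 2)) := by
      unfold exclSq; rw [hs]; ring
    rw [this, Real.exp_add, ← hD]
    field_simp
  have hπ : 0 < π * s := by positivity
  constructor
  · have := (integrableOn_mul_exp_neg_sq hπ hc0).const_mul (N.lam k / s * D)
    exact IntegrableOn.congr_fun this heq.symm measurableSet_Ioi
  · rw [setIntegral_congr_fun measurableSet_Ioi heq, integral_const_mul,
      integral_mul_exp_neg_sq hπ hc0]
    ring

lemma integral_serviceDensity_head (k : Tier) :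
    ∫ r in Ioc 0 (N.critDist k), N.serviceDensity k r =
      1 - Real.exp (-(π * N.lam k * N.critDist k ^ 2)) := by
  have hc0 : 0 ≤ N.critDist k := Real.sqrt_nonneg _
  rw [setIntegral_congr_fun measurableSet_Ioc fun r hr => N.serviceDensity_of_le k hr.1 hr.2,
    ← intervalIntegral.integral_of_le hc0,
    intervalIntegral.integral_eq_sub_of_hasDerivAt (fun x _ => hasDerivAt_exp_neg_sq (π * N.lam k) x)
      (Continuous.intervalIntegrable (by fun_prop) _ _)]
  simp
  ring

lemma integral_serviceDensity (k : Tier) : IntegrableOn (N.serviceDensity k) (Ioi 0) ∧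
    ∫ r in Ioi 0, N.serviceDensity k r = N.assocProb k := by
  have hc0 : 0 ≤ N.critDist k := Real.sqrt_nonneg _
  obtain ⟨hi, ht⟩ := N.integral_serviceDensity_tail k
  have hh : IntegrableOn (N.serviceDensity k) (Ioc 0 (N.critDist k)) :=
    (N.continuous_serviceDensity k).integrableOn_Ioc
  have hβ := N.beta_mul_beta k.other k
  rw [← Ioc_union_Ioi_eq_Ioi hc0]
  refine ⟨hh.union hi, ?_⟩
  rw [setIntegral_union (Ioc_disjoint_Ioi le_rfl) measurableSet_Ioi hh hi, ht,
    integral_serviceDensity_head, ← Real.exp_add]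
  simp only [assocProb]
  split_ifs with h
  · have hsq : N.critDist k ^ 2 = N.hdiff k.other ^ 2 * N.beta k k.other - N.hdiff k ^ 2 :=
      Real.sq_sqrt (by linarith)
    rw [hsq]
    congr 4
    · ring
    · linear_combination (-π * N.lam k.other * N.hdiff k.other ^ 2) * hβ
  · have hz : N.critDist k = 0 := Real.sqrt_eq_zero_of_nonpos (by linarith)
    rw [hz]
    simp
    left
    ring

/-- Since 1/β_{kj} = β_{jk}, the prefactor enters the root as its square. Beyond the critical
distance the inner radicand is the positive number `exclSq`, so its root squares back to it. -/
lemma vartheta_eq (k : Tier) {r : ℝ} (hr : N.critDist k < r) :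
    N.vartheta k k.other r = circleDist (N.beta k.other k) (N.hdiff k) (N.hdiff k.other) r := by
  have hβ := N.beta_pos k.other k
  rw [critDist_eq] at hr
  have he := ((exclSq_pos_iff hβ ((Real.sqrt_nonneg _).trans_lt hr)).2 hr).le
  rw [vartheta, circleDist, ← intervalIntegral.integral_const_mul, N.beta_eq_inv k k.other]
  refine intervalIntegral.integral_congr fun θ _ => ?_
  set β := N.beta k.other k
  have h1 : (r ^ 2 + N.hdiff k ^ 2) / β⁻¹ - N.hdiff k.other ^ 2 =
      exclSq β (N.hdiff k) (N.hdiff k.other) r := by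
    unfold exclSq; field_simp
  simp only [h1, Real.sq_sqrt he]
  have h2 : 1 / β⁻¹ = √(β ^ 2) := by rw [Real.sqrt_sq hβ.le]; simp
  rw [h2, ← Real.sqrt_mul (by positivity)]
  congr 1
  set t := √(exclSq β (N.hdiff k) (N.hdiff k.other) r)
  unfold exclSq
  field_simp
  ring

lemma halfLength_eq (k : Tier) : ∫ x in Ioi (N.critDist k),
    N.lam k.other * N.vartheta k k.other x * (N.assocProb k * N.servicePDF k x) =
      N.halfLength k := by
  rw [halfLength, ← critDist_eq]
  refine setIntegral_congr_fun measurableSet_Ioi fun r hr => ?_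
  rw [N.vartheta_eq k hr, N.assocProb_mul_servicePDF k ((Real.sqrt_nonneg _).trans_lt hr),
    N.serviceDensity_of_lt k hr]

lemma critDist_eq_zero_of_le {k : Tier}
    (h : N.beta k k.other * N.hdiff k.other ^ 2 ≤ N.hdiff k ^ 2) : N.critDist k = 0 :=
  Real.sqrt_eq_zero_of_nonpos (by linarith)

lemma critDist_sbs_of_le (h : N.hdiff .mbs ^ 2 ≤ N.beta .mbs .sbs * N.hdiff .sbs ^ 2) :
    N.critDist .sbs = 0 := by
  refine N.critDist_eq_zero_of_le ?_
  have hβ := N.beta_pos .sbs .mbs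
  have := N.beta_mul_beta .sbs .mbs
  change N.beta .sbs .mbs * N.hdiff .mbs ^ 2 ≤ N.hdiff .sbs ^ 2
  calc _ ≤ N.beta .sbs .mbs * (N.beta .mbs .sbs * N.hdiff .sbs ^ 2) := by gcongr
    _ = _ := by rw [← mul_assoc, this, one_mul]

/-- At most one of the two critical distances is nonzero, and the case distinction of the lower
limits records which one. So each integral starts at the critical distance of its own tier. -/
lemma lengthTerm_eq : N.lengthTerm = N.halfLength .mbs + N.halfLength .sbs := by
  rw [← halfLength_eq, ← halfLength_eq, lengthTerm]
  split_ifs with h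
  · rw [N.critDist_sbs_of_le h]; rfl
  · rw [N.critDist_eq_zero_of_le (k := .mbs) (not_le.1 h).le]; rfl

lemma areaLeadingTerm_eq (δ : ℝ) : N.areaLeadingTerm δ = 2 * δ * N.lengthTerm := by
  have e : ∀ (c l : ℝ) (f g : ℝ → ℝ), ∫ x in Ioi c, 2 * l * δ * f x * g x =
      2 * δ * ∫ x in Ioi c, l * f x * g x := by
    intro c l f g
    rw [← integral_const_mul]
    congr 1 with x
    ring
  rw [areaLeadingTerm, lengthTerm]
  split_ifs
  · rw [e, e, mul_add]
  · rw [e, e, mul_add]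

lemma lengthTerm_nonneg : 0 ≤ N.lengthTerm := by
  have : ∀ k, 0 ≤ N.halfLength k := fun k => by
    refine setIntegral_nonneg measurableSet_Ioi fun r hr => ?_
    have hr0 : 0 < r := (Real.sqrt_nonneg _).trans_lt hr
    have := circleDist_nonneg (N.beta k.other k) (N.hdiff k) (N.hdiff k.other) r
    have := N.lam_pos k
    have := N.lam_pos k.other
    positivity
  rw [lengthTerm_eq]
  exact add_nonneg (this _) (this _)

namespace IsDeployment

variable {N} {Ω : Type*} [MeasurableSpace Ω] {P : Measure Ω} [IsProbabilityMeasure P]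
  {Φ : Tier → Ω → Set Plane}

/-- With the nearest tier-k station at distance r, service by tier k means a void disc for the other
tier; this probability is integrated against the contact law. -/
lemma prob_infDist_mem_and_servedBy (hΦ : N.IsDeployment P Φ) (k : Tier) {B : Set ℝ}
    (hB : MeasurableSet B) :
    P {ω | Metric.infDist 0 (Φ k ω) ∈ B ∧ (0 : Plane) ∈ N.servedBy (fun i => Φ i ω) k} =
      ∫⁻ r in Ioi 0 ∩ B, ENNReal.ofReal (N.serviceDensity k r) := by
  have hT : MeasurableSet {ξ : Tier × Plane → ℝ≥0∞ |
      (ξ (k, 0)).toReal ∈ B ∧ N.pathGap k 0 ξ < 0} :=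
    MeasurableSet.inter (((measurable_pi_apply _).ennreal_toReal) hB)
      (measurableSet_lt (N.measurable_pathGap k 0) measurable_const)
  rw [hΦ.prob_eq_lintegral_split k
    (p := fun S => Metric.infDist 0 (S k) ∈ B ∧ (0 : Plane) ∈ N.servedBy S k) hT
    fun S hS => and_congr Iff.rfl (N.mem_servedBy_iff hS k 0)]
  set G : ℝ → ℝ≥0∞ := B.indicator fun r => ENNReal.ofReal (Real.exp (-(π * N.lam k.other *
      max (exclSq (N.beta k.other k) (N.hdiff k) (N.hdiff k.other) r) 0))) with hG
  have hGm : Measurable G := by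
    have := (continuous_exclSq (N.beta k.other k) (N.hdiff k) (N.hdiff k.other)).measurable
    exact Measurable.indicator (by fun_prop) hB
  have hRm := (hΦ.poisson k).measurable_infDist 0
  calc _ = ∫⁻ ω, G (Metric.infDist 0 (Φ k ω)) ∂P := by
        refine lintegral_congr_ae ?_
        filter_upwards [hΦ.ae_isGood] with ω hω
        by_cases hmem : Metric.infDist 0 (Φ k ω) ∈ B
        · rw [hG, indicator_of_mem hmem, ← (hΦ.poisson k.other).void_discSq (N.lam_pos _)]
          refine measure_congr ?_
          filter_upwards [hΦ.ae_isGood] with ω' hω'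
          refine propext ?_
          change (_ ∧ _) ↔ _
          rw [N.mem_servedBy_zero_iff (hω.splitConfig hω' k)]
          simp only [splitConfig_self, splitConfig_other, hmem, true_and]
          rfl
        · rw [hG, indicator_of_notMem hmem]
          simp [hmem]
    _ = ∫⁻ r, G r ∂contactLaw (N.lam k) := by
        rw [← (hΦ.poisson k).map_infDist (N.lam_pos k) 0, lintegral_map hGm hRm]
    _ = _ := by
        rw [lintegral_contactLaw hGm, inter_comm, ← Measure.restrict_restrict hB,
          ← lintegral_indicator hB]
        refine setLIntegral_congr_fun measurableSet_Ioi fun r hr => ?_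
        have hr' : 0 < r := hr
        have := N.lam_pos k
        simp only [hG]
        by_cases hmem : r ∈ B
        · rw [indicator_of_mem hmem, indicator_of_mem hmem, ← ENNReal.ofReal_mul (by positivity)]
          rfl
        · rw [indicator_of_notMem hmem, indicator_of_notMem hmem, mul_zero]

lemma prob_zero_mem_servedBy (hΦ : N.IsDeployment P Φ) (k : Tier) :
    P {ω | (0 : Plane) ∈ N.servedBy (fun i => Φ i ω) k} = ENNReal.ofReal (N.assocProb k) := by
  have := hΦ.prob_infDist_mem_and_servedBy k MeasurableSet.univ
  simp only [mem_univ, true_and, inter_univ] at this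
  obtain ⟨hi, hv⟩ := N.integral_serviceDensity k
  rw [this, ← hv, ofReal_integral_eq_lintegral_ofReal hi]
  exact (ae_restrict_mem measurableSet_Ioi).mono fun r hr => N.serviceDensity_nonneg k (le_of_lt hr)

lemma map_cond_infDist (hΦ : N.IsDeployment P Φ) (k : Tier) :
    (P[|{ω | (0 : Plane) ∈ N.servedBy (fun j => Φ j ω) k}]).map
        (fun ω => Metric.infDist 0 (Φ k ω)) =
      volume.withDensity (fun x => ENNReal.ofReal (N.servicePDF k x)) := by
  have hA := N.assocProb_pos k
  have hRm := (hΦ.poisson k).measurable_infDist 0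
  ext B hB
  -- Only the preimage of B has to be measurable here; the service event itself is known to be
  -- measurable only up to null sets.
  rw [Measure.map_apply hRm hB, ProbabilityTheory.cond, Measure.smul_apply,
    Measure.restrict_apply (hRm hB), hΦ.prob_zero_mem_servedBy k, smul_eq_mul,
    withDensity_apply _ hB]
  have h1 := hΦ.prob_infDist_mem_and_servedBy k hB
  have h2 : ((fun ω => Metric.infDist 0 (Φ k ω)) ⁻¹' B ∩
      {ω | (0 : Plane) ∈ N.servedBy (fun j => Φ j ω) k}) =
      {ω | Metric.infDist 0 (Φ k ω) ∈ B ∧ (0 : Plane) ∈ N.servedBy (fun i => Φ i ω) k} := by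
    ext; simp
  rw [h2, h1]
  have h3 : ∫⁻ r in Ioi 0 ∩ B, ENNReal.ofReal (N.serviceDensity k r) =
      ENNReal.ofReal (N.assocProb k) * ∫⁻ r in Ioi 0 ∩ B, ENNReal.ofReal (N.servicePDF k r) := by
    rw [← lintegral_const_mul' _ _ ENNReal.ofReal_ne_top]
    refine setLIntegral_congr_fun (measurableSet_Ioi.inter hB) fun r hr => ?_
    rw [← N.assocProb_mul_servicePDF k hr.1, ENNReal.ofReal_mul hA.le]
  rw [h3, ← mul_assoc, ENNReal.inv_mul_cancel (by simpa using hA) ENNReal.ofReal_ne_top, one_mul,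
    ← Measure.restrict_restrict measurableSet_Ioi, ← lintegral_indicator measurableSet_Ioi]
  refine lintegral_congr fun r => ?_
  rcases lt_or_ge 0 r with hr | hr
  · rw [indicator_of_mem (mem_Ioi.2 hr)]
  · rw [indicator_of_notMem (notMem_Ioi.2 hr), N.servicePDF_of_nonpos k hr, ENNReal.ofReal_zero]

/-- Almost surely a given point does not lie on the cell boundaries. -/
lemma ae_notMem_boundary (hΦ : N.IsDeployment P Φ) (x : Plane) :
    ∀ᵐ ω ∂P, x ∉ N.boundary fun k => Φ k ω := by
  have hT : MeasurableSet {ξ | N.pathGap .mbs x ξ = 0} :=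
    (N.measurable_pathGap .mbs x) (measurableSet_singleton 0)
  rw [ae_iff]
  simp only [not_not]
  rw [hΦ.prob_eq_lintegral_split .mbs (p := fun S => x ∈ N.boundary S) hT
    fun S hS => N.mem_boundary_iff hS .mbs x, lintegral_eq_zero_of_ae_eq_zero]
  filter_upwards [hΦ.ae_isGood] with ω hω
  have hRm := (hΦ.poisson .sbs).measurable_infDist x
  -- Given the macro stations, a tie prescribes one value for the distance to the nearest small
  -- station, and the contact law has no atoms.
  set c := (Metric.infDist x (Φ .mbs ω) ^ 2 + N.hdiff .mbs ^ 2) / N.beta .mbs .sbs -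
    N.hdiff .sbs ^ 2 with hc
  have hnull : P ((fun ω => Metric.infDist x (Φ .sbs ω)) ⁻¹' {√c}) = 0 := by
    rw [← Measure.map_apply hRm (measurableSet_singleton _),
      (hΦ.poisson .sbs).map_infDist (N.lam_pos _)]
    exact contactLaw_ac _ (measure_singleton _)
  refine le_antisymm (le_trans (measure_mono_ae ?_) hnull.le) zero_le
  filter_upwards [hΦ.ae_isGood] with ω' hω' hb
  have hb' := (N.mem_boundary_iff (hω.splitConfig hω' .mbs) .mbs x).1 hb
  rw [splitConfig_self, splitConfig_other, gap] at hb'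
  have hβ := N.beta_pos .mbs .sbs
  change Metric.infDist x (Φ .sbs ω') = √c
  have : Metric.infDist x (Φ .sbs ω') ^ 2 = c := by
    rw [hc, eq_sub_iff_add_eq, eq_div_iff hβ.ne', mul_comm]
    exact (sub_eq_zero.1 hb').symm
  rw [← this, Real.sqrt_sq Metric.infDist_nonneg]

end IsDeployment

end Network

/-! ### Area intensity, length intensity and two-point probabilities -/

namespace Network

namespace IsDeployment

variable {N : Network} {Ω : Type*} [MeasurableSpace Ω] {P : Measure Ω} [IsProbabilityMeasure P]
  {Φ : Tier → Ω → Set Plane}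

lemma nullMeasurableSet_mem_servedBy (hΦ : N.IsDeployment P Φ) (k : Tier) (x : Plane) :
    NullMeasurableSet {ω | x ∈ N.servedBy (fun i => Φ i ω) k} P := by
  have hm : MeasurableSet {ω | N.pathGap k x (distPath fun i => Φ i ω) < 0} :=
    hΦ.hasPoissonVoids.measurable_distPath
      (measurableSet_lt (N.measurable_pathGap k x) measurable_const)
  refine hm.nullMeasurableSet.congr ?_
  filter_upwards [hΦ.ae_isGood] with ω hω
  exact propext (N.mem_servedBy_iff_pathGap hω k x).symm

/-- Almost surely the origin is on no boundary, so not being served by one tier means being served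
by the other. -/
lemma areaIntensity_eq_add (hΦ : N.IsDeployment P Φ) (δ : ℝ) :
    N.areaIntensity P Φ δ =
      P {ω | (0 : Plane) ∈ N.servedBy (fun i => Φ i ω) .mbs ∧
        0 ∈ N.extBoundary (fun i => Φ i ω) δ} +
      P {ω | (0 : Plane) ∈ N.servedBy (fun i => Φ i ω) .sbs ∧
        0 ∈ N.extBoundary (fun i => Φ i ω) δ} := by
  rw [hΦ.areaIntensity_eq, ← measure_inter_add_sdiff₀ _ (hΦ.nullMeasurableSet_mem_servedBy .mbs 0)]
  congr 1
  · congr 1; ext ω; exact and_comm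
  · refine measure_congr ?_
    filter_upwards [hΦ.ae_notMem_boundary 0] with ω hω
    rw [N.mem_boundary_iff_not .mbs] at hω
    have hd : (0 : Plane) ∈ N.servedBy (fun i => Φ i ω) .mbs →
        (0 : Plane) ∉ N.servedBy (fun i => Φ i ω) .sbs :=
      fun h => Set.disjoint_left.1 (N.disjoint_servedBy (fun i => Φ i ω) .mbs) h
    refine propext ?_
    change (_ ∧ ¬ _) ↔ (_ ∧ _)
    change ¬ (_ ∧ _ ∉ N.servedBy _ .sbs) at hω
    constructor
    · rintro ⟨h1, h2⟩
      exact ⟨by_contra fun h => hω ⟨h2, h⟩, h1⟩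
    · rintro ⟨h1, h2⟩
      exact ⟨h2, fun h => hd h h1⟩

lemma exists_areaIntensity (hΦ : N.IsDeployment P Φ) : ∃ C : ℝ, ∀ δ : ℝ, 0 < δ → δ ≤ 1 →
    |(N.areaIntensity P Φ δ).toReal - N.areaLeadingTerm δ| ≤ C * δ ^ 2 := by
  obtain ⟨C, hC, h⟩ := hΦ.exists_prob_near_boundary .mbs
  obtain ⟨C', hC', h'⟩ := hΦ.exists_prob_near_boundary .sbs
  refine ⟨C + C', fun δ h0 h1 => ?_⟩
  rw [hΦ.areaIntensity_eq_add, ENNReal.toReal_add (measure_ne_top _ _) (measure_ne_top _ _),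
    N.areaLeadingTerm_eq, N.lengthTerm_eq]
  have e := abs_le.1 (h δ h0 h1)
  have e' := abs_le.1 (h' δ h0 h1)
  rw [abs_le]
  constructor <;> linarith [e.1, e.2, e'.1, e'.2]

lemma isBigO_areaIntensity (hΦ : N.IsDeployment P Φ) :
    (fun δ : ℝ => (N.areaIntensity P Φ δ).toReal - N.areaLeadingTerm δ)
      =O[𝓝[>] 0] fun δ : ℝ => δ ^ 2 := by
  obtain ⟨C, h⟩ := hΦ.exists_areaIntensity
  refine IsBigO.of_bound C ?_
  filter_upwards [Ioc_mem_nhdsGT one_pos] with δ hδ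
  rw [Real.norm_eq_abs, Real.norm_of_nonneg (sq_nonneg _)]
  exact h δ hδ.1 hδ.2

lemma hasLengthIntensity (hΦ : N.IsDeployment P Φ) : N.HasLengthIntensity P Φ N.lengthTerm := by
  obtain ⟨C, h⟩ := hΦ.exists_areaIntensity
  have hlim : Tendsto (fun δ : ℝ => C / 2 * δ) (𝓝[>] 0) (𝓝 0) := by
    have : Tendsto (fun δ : ℝ => C / 2 * δ) (𝓝 0) (𝓝 (C / 2 * 0)) := tendsto_id.const_mul _
    rw [mul_zero] at this
    exact this.mono_left nhdsWithin_le_nhds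
  rw [HasLengthIntensity, tendsto_iff_dist_tendsto_zero]
  refine squeeze_zero' (Eventually.of_forall fun _ => dist_nonneg) ?_ hlim
  filter_upwards [Ioc_mem_nhdsGT one_pos] with δ hδ
  have h0 : 0 < δ := hδ.1
  have := h δ hδ.1 hδ.2
  rw [N.areaLeadingTerm_eq] at this
  rw [Real.dist_eq, ← mul_le_mul_iff_right₀ (show 0 < 2 * δ by positivity)]
  calc 2 * δ * |(N.areaIntensity P Φ δ).toReal / (2 * δ) - N.lengthTerm|
      = |(N.areaIntensity P Φ δ).toReal - 2 * δ * N.lengthTerm| := by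
        rw [← abs_of_pos (show 0 < 2 * δ by positivity), ← abs_mul, abs_of_pos (show 0 < 2 * δ by positivity)]
        congr 1
        field_simp
    _ ≤ _ := this.trans (le_of_eq (by ring))

/-- Interchanging the two endpoints turns a change from k to the other tier into the reverse change,
and the probability depends on their distance only. So the first order coefficients agree, although
the two integrals look different. -/
lemma halfLength_other (hΦ : N.IsDeployment P Φ) (k : Tier) :
    N.halfLength k.other = N.halfLength k := by
  obtain ⟨C, hC, h⟩ := hΦ.exists_prob_servedBy_pair k
  obtain ⟨C', hC', h'⟩ := hΦ.exists_prob_servedBy_pair k.other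
  have hb : ∀ δ : ℝ, 0 < δ → δ ≤ 1 →
      |2 / π * (N.halfLength k.other - N.halfLength k)| ≤ (C + C') * δ := by
    intro δ h0 h1
    have e := h δ h0 h1 0
    have e' := h' δ h0 h1 0
    have hs : P {ω | (0 : Plane) ∈ N.servedBy (fun i => Φ i ω) k.other ∧
        δ • unitVec 0 ∈ N.servedBy (fun i => Φ i ω) k.other.other} =
        P {ω | (0 : Plane) ∈ N.servedBy (fun i => Φ i ω) k ∧
          δ • unitVec 0 ∈ N.servedBy (fun i => Φ i ω) k.other} := by
      rw [hΦ.prob_servedBy_pair_congr k (dist_comm 0 (δ • unitVec 0)), Tier.other_other]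
      congr 1; ext ω; exact and_comm
    rw [hs] at e'
    rw [← mul_le_mul_iff_right₀ h0]
    calc δ * |2 / π * (N.halfLength k.other - N.halfLength k)|
        = |δ * (2 / π * (N.halfLength k.other - N.halfLength k))| := by
          rw [abs_mul δ, abs_of_pos h0]
      _ ≤ _ := by
          have e1 := abs_le.1 e
          have e2 := abs_le.1 e'
          rw [abs_le]
          constructor <;> linarith [e1.1, e1.2, e2.1, e2.2]
  have h0 : |2 / π * (N.halfLength k.other - N.halfLength k)| ≤ 0 := by
    have hlim : Tendsto (fun δ : ℝ => (C + C') * δ) (𝓝[>] 0) (𝓝 0) := by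
      have : Tendsto (fun δ : ℝ => (C + C') * δ) (𝓝 0) (𝓝 ((C + C') * 0)) := tendsto_id.const_mul _
      rw [mul_zero] at this
      exact this.mono_left nhdsWithin_le_nhds
    refine ge_of_tendsto hlim ?_
    filter_upwards [Ioc_mem_nhdsGT one_pos] with δ hδ using hb δ hδ.1 hδ.2
  have h1 := abs_nonpos_iff.1 h0
  have hπ : (2 / π : ℝ) ≠ 0 := by positivity
  linarith [(mul_eq_zero.1 h1).resolve_left hπ]

/-- The probability of a change of the serving tier along a short segment. -/
lemma exists_prob_servedBy_pair_dist (hΦ : N.IsDeployment P Φ) (k : Tier) :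
    ∃ C : ℝ, 0 < C ∧ ∀ x y : Plane, dist x y ≤ 1 →
      |(P {ω | x ∈ N.servedBy (fun i => Φ i ω) k ∧
        y ∈ N.servedBy (fun i => Φ i ω) k.other}).toReal -
          1 / π * N.lengthTerm * dist x y| ≤ C * dist x y ^ 2 := by
  obtain ⟨C, hC, h⟩ := hΦ.exists_prob_servedBy_pair k
  refine ⟨C, hC, fun x y hxy => ?_⟩
  have hL : N.lengthTerm = 2 * N.halfLength k := by
    have := hΦ.halfLength_other k
    rw [lengthTerm_eq]
    cases k <;> · simp only [Tier.other] at this; linarith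
  rcases (dist_nonneg (x := x) (y := y)).eq_or_lt with h0 | h0
  · rw [← h0]
    have : {ω | x ∈ N.servedBy (fun i => Φ i ω) k ∧
        y ∈ N.servedBy (fun i => Φ i ω) k.other} = ∅ := by
      rw [← dist_eq_zero.1 h0.symm]
      ext ω
      exact iff_of_false
        (fun h => Set.disjoint_left.1 (N.disjoint_servedBy (fun i => Φ i ω) k) h.1 h.2) id
    rw [this]
    simp
  · rw [hΦ.prob_servedBy_pair_congr k (x' := 0) (y' := dist x y • unitVec 0)
      (by rw [dist_zero_left, norm_smul_unitVec h0.le]), hL]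
    convert h _ h0 hxy 0 using 2
    ring

end IsDeployment

end Network

/-! ### Counting changes along a sequence of sample points -/

section Crossings

open scoped Classical in
/-- The number of `i < n` such that `p` holds at `i` and `q` at `i + 1`. -/
noncomputable def stepCount (p q : ℕ → Prop) (n : ℕ) : ℕ :=
  ((Finset.range n).filter fun i => p i ∧ q (i + 1)).card

variable {p q : ℕ → Prop}

lemma exists_step {a b : ℕ} (hab : a < b) (ha : p a) (hb : q b) (hpq : ∀ i ≤ b, p i ∨ q i) :
    ∃ j, a ≤ j ∧ j < b ∧ p j ∧ q (j + 1) := by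
  by_contra! hcon
  have : ∀ j, a ≤ j → j < b → p j := by
    intro j hj
    induction j, hj using Nat.le_induction with
    | base => exact fun _ => ha
    | succ j hj ih =>
      intro hjb
      exact (hpq (j + 1) hjb.le).resolve_right (hcon j hj (by omega) (ih (by omega)))
  refine hcon (b - 1) (by omega) (by omega) (this _ (by omega) (by omega)) ?_
  rwa [Nat.sub_add_cancel (by omega)]

/-- Each index interval from `a i` to `b i` contains a step from p to q, because every index
satisfies p or q. The intervals do not overlap, so these steps are distinct. -/
lemma le_stepCount {m n : ℕ} {a b : ℕ → ℕ} (hab : ∀ i < m, a i < b i ∧ b i ≤ n)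
    (hba : ∀ i, i + 1 < m → b i ≤ a (i + 1)) (ha : ∀ i < m, p (a i)) (hb : ∀ i < m, q (b i))
    (hpq : ∀ i ≤ n, p i ∨ q i) : m ≤ stepCount p q n := by
  have hex : ∀ i, ∃ j, i < m → a i ≤ j ∧ j < b i ∧ p j ∧ q (j + 1) := by
    intro i
    by_cases hi : i < m
    · obtain ⟨j, hj⟩ := exists_step (hab i hi).1 (ha i hi) (hb i hi)
        fun l hl => hpq l (hl.trans (hab i hi).2)
      exact ⟨j, fun _ => hj⟩
    · exact ⟨0, fun h => absurd h hi⟩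
  choose j hj using hex
  have hmono : ∀ i i', i < i' → i' < m → b i ≤ a i' := by
    intro i i' hii'
    induction i', hii' using Nat.le_induction with
    | base => exact fun h => hba i h
    | succ l hl ih =>
      intro hlm
      exact (ih (by omega)).trans ((hab l (by omega)).1.le.trans (hba l hlm))
  have hlt : ∀ i i', i < i' → i' < m → j i < j i' := fun i i' h h' =>
    (hj i (h.trans h')).2.1.trans_le ((hmono i i' h h').trans (hj i' h').1)
  classical
  rw [stepCount, ← Finset.card_range m]
  refine Finset.card_le_card_of_injOn j (fun i hi => ?_) fun i hi i' hi' h => ?_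
  · have hi' : i < m := by simpa using hi
    have := hj i hi'
    have := (hab i hi').2
    simp only [Finset.coe_filter, Finset.mem_range, mem_ofPred_eq]
    refine ⟨by omega, (hj i hi').2.2⟩
  · simp only [Finset.coe_range, mem_Iio] at hi hi'
    rcases lt_trichotomy i i' with h1 | h1 | h1
    · exact absurd h (hlt _ _ h1 hi').ne
    · exact h1
    · exact absurd h (hlt _ _ h1 hi).ne'

lemma exists_strictMono_steps (p q : ℕ → Prop) (n : ℕ) : ∃ j : ℕ → ℕ,
    (∀ i < stepCount p q n, j i < n ∧ p (j i) ∧ q (j i + 1)) ∧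
    ∀ i, i + 1 < stepCount p q n → j i < j (i + 1) := by
  classical
  set F := (Finset.range n).filter fun i => p i ∧ q (i + 1) with hF
  have hc : stepCount p q n = F.card := by
    rw [stepCount]
  have hmem : ∀ i ∈ F, i < n ∧ p i ∧ q (i + 1) := by
    intro i hi
    simpa [hF] using hi
  rw [hc]
  refine ⟨fun i => if h : i < F.card then F.orderEmbOfFin rfl ⟨i, h⟩ else 0, fun i hi => ?_,
    fun i hi => ?_⟩
  · simp only [hi, dite_true]
    exact hmem _ (F.orderEmbOfFin_mem rfl _)
  · have hi' : i < F.card := by omega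
    simp only [hi, hi', dite_true]
    exact (F.orderEmbOfFin rfl).strictMono (by simp)

end Crossings

/-! ### Curves of constant speed and uniform grids -/

section Speed

variable {E : Type*} [PseudoEMetricSpace E]

lemma eVariationOn_nat_le (f : ℕ → E) (n : ℕ) :
    eVariationOn f (Iic n) ≤ ∑ i ∈ Finset.range n, edist (f i) (f (i + 1)) := by
  refine iSup_le fun ⟨m, u, hu, hun⟩ => ?_
  have key : ∀ m, ∑ i ∈ Finset.range m, edist (f (u (i + 1))) (f (u i)) ≤
      ∑ i ∈ Finset.Ico (u 0) (u m), edist (f i) (f (i + 1)) := by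
    intro m
    induction m with
    | zero => simp
    | succ m ih =>
      rw [Finset.sum_range_succ, ← Finset.sum_Ico_consecutive _ (hu (Nat.zero_le m))
        (hu (Nat.le_succ m)), edist_comm]
      exact add_le_add ih (edist_le_Ico_sum_edist f (hu (Nat.le_succ m)))
  refine (key m).trans (Finset.sum_le_sum_of_subset fun i hi => ?_)
  have : u m ≤ n := hun m
  simp only [Finset.mem_Ico, Finset.mem_range] at hi ⊢
  omega

lemma HasConstantSpeedOnWith.edist_le {γ : ℝ → E} {s : Set ℝ} {v : ℝ≥0}
    (h : HasConstantSpeedOnWith γ s v) {x y : ℝ} (hx : x ∈ s) (hy : y ∈ s) (hxy : x ≤ y) :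
    edist (γ x) (γ y) ≤ ENNReal.ofReal (v * (y - x)) := by
  rw [← h hx hy]
  exact eVariationOn.edist_le γ ⟨hx, le_rfl, hxy⟩ ⟨hy, hxy, le_rfl⟩

lemma HasConstantSpeedOnWith.continuousOn {γ : ℝ → E} {s : Set ℝ} {v : ℝ≥0}
    (h : HasConstantSpeedOnWith γ s v) : ContinuousOn γ s := by
  have : LipschitzOnWith v γ s := by
    intro x hx y hy
    rw [edist_dist x y, ← ENNReal.ofReal_coe_nnreal, ← ENNReal.ofReal_mul v.coe_nonneg, Real.dist_eq]
    rcases le_total x y with hxy | hxy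
    · rw [abs_sub_comm, abs_of_nonneg (by linarith)]
      exact h.edist_le hx hy hxy
    · rw [edist_comm, abs_of_nonneg (by linarith)]
      exact h.edist_le hy hx hxy
  exact this.continuousOn

lemma tendsto_floor_grid {T : ℝ} (hT : 0 < T) (x : ℝ) (hx : 0 ≤ x) :
    Tendsto (fun n : ℕ => (⌊x / (T / n)⌋₊ : ℝ) * (T / n)) atTop (𝓝 x) := by
  have hlim : Tendsto (fun n : ℕ => x - T / n) atTop (𝓝 x) := by
    simpa using tendsto_const_nhds.sub (tendsto_const_div_atTop_nhds_zero_nat T)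
  refine tendsto_of_tendsto_of_tendsto_of_le_of_le' hlim tendsto_const_nhds ?_ ?_
  · filter_upwards [eventually_gt_atTop 0] with n hn
    have hn' : (0 : ℝ) < n := by exact_mod_cast hn
    have hTn : 0 < T / n := by positivity
    have := Nat.lt_floor_add_one (x / (T / n))
    rw [div_lt_iff₀ hTn] at this
    linarith
  · filter_upwards [eventually_gt_atTop 0] with n hn
    have hn' : (0 : ℝ) < n := by exact_mod_cast hn
    have hTn : 0 < T / n := by positivity
    rw [← le_div_iff₀ hTn]
    exact Nat.floor_le (by positivity)

lemma floor_grid_le {T x : ℝ} {n : ℕ} (hT : 0 < T) (hn : 0 < n) (hx : x ≤ T) :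
    ⌊x / (T / n)⌋₊ ≤ n := by
  have hn' : (0 : ℝ) < n := by exact_mod_cast hn
  refine Nat.floor_le_of_le ?_
  rw [div_le_iff₀ (by positivity)]
  field_simp
  exact hx

lemma grid_mem {T : ℝ} {n i : ℕ} (hT : 0 < T) (hi : i ≤ n) : (i : ℝ) * (T / n) ∈ Icc 0 T := by
  have hi' : (i : ℝ) ≤ n := by exact_mod_cast hi
  refine ⟨by positivity, ?_⟩
  rcases Nat.eq_zero_or_pos n with rfl | hn
  · simp [hT.le]
  · have hn' : (0 : ℝ) < n := by exact_mod_cast hn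
    rw [mul_div_assoc', div_le_iff₀ hn']
    nlinarith

lemma HasConstantSpeedOnWith.dist_grid_le {E : Type*} [PseudoMetricSpace E] {γ : ℝ → E}
    {T : ℝ} {v : ℝ≥0} (hT : 0 < T) (h : HasConstantSpeedOnWith γ (Icc 0 T) v) {n i : ℕ}
    (hi : i < n) : dist (γ (i * (T / n))) (γ ((i + 1 : ℕ) * (T / n))) ≤ v * (T / n) := by
  have hTn : 0 ≤ T / n := by positivity
  have := h.edist_le (grid_mem hT hi.le) (grid_mem hT (Nat.succ_le_of_lt hi)) (by
    push_cast; gcongr; linarith)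
  rw [edist_dist, ENNReal.ofReal_le_ofReal_iff] at this
  · refine this.trans (le_of_eq ?_)
    push_cast; ring
  · push_cast
    refine mul_nonneg v.coe_nonneg ?_
    linarith

/-- Uniform grids compute the length of a curve of constant speed. -/
lemma HasConstantSpeedOnWith.tendsto_sum_dist {E : Type*} [PseudoMetricSpace E] {γ : ℝ → E}
    {T : ℝ} {v : ℝ≥0} (hT : 0 < T) (h : HasConstantSpeedOnWith γ (Icc 0 T) v) :
    Tendsto (fun n : ℕ => ∑ i ∈ Finset.range n,
      dist (γ (i * (T / n))) (γ ((i + 1 : ℕ) * (T / n)))) atTop (𝓝 (v * T)) := by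
  refine tendsto_order.2 ⟨fun a ha => ?_, fun a ha => ?_⟩
  · rcases lt_or_ge a 0 with h0 | h0
    · exact Eventually.of_forall fun n => h0.trans_le (Finset.sum_nonneg fun _ _ => dist_nonneg)
    have hlen : ENNReal.ofReal a < eVariationOn γ (Icc 0 T) := by
      have := h (left_mem_Icc.2 hT.le) (right_mem_Icc.2 hT.le)
      rw [inter_self, sub_zero] at this
      rw [this]
      exact (ENNReal.ofReal_lt_ofReal_iff (h0.trans_lt ha)).2 ha
    -- The samples, read as step functions of time, converge pointwise to γ. Lower semicontinuity of
    -- the variation then prevents any loss of length in the limit; the upper bound is immediate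
    -- from the speed.
    have hconv : ∀ x ∈ Icc 0 T, Tendsto (fun n : ℕ => γ ((⌊x / (T / n)⌋₊ : ℝ) * (T / n))) atTop
        (𝓝 (γ x)) := by
      intro x hx
      have h1 : Tendsto (fun n : ℕ => (⌊x / (T / n)⌋₊ : ℝ) * (T / n)) atTop (𝓝[Icc 0 T] x) := by
        refine tendsto_nhdsWithin_iff.2 ⟨tendsto_floor_grid hT x hx.1, ?_⟩
        filter_upwards [eventually_gt_atTop 0] with n hn
        exact grid_mem hT (floor_grid_le hT hn hx.2)
      exact (h.continuousOn x hx).tendsto.comp h1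
    filter_upwards [eVariationOn.lowerSemicontinuous_aux hconv hlen, eventually_gt_atTop 0]
      with n hn hn0
    have h2 : eVariationOn (fun x => γ ((⌊x / (T / n)⌋₊ : ℝ) * (T / n))) (Icc 0 T) ≤
        eVariationOn (fun i : ℕ => γ (i * (T / n))) (Iic n) :=
      eVariationOn.comp_le_of_monotoneOn (fun i : ℕ => γ (i * (T / n)))
        (fun x : ℝ => ⌊x / (T / n)⌋₊)
        (fun x _ y _ hxy => Nat.floor_mono (by gcongr)) fun x hx => floor_grid_le hT hn0 hx.2
    have h3 := hn.trans_le (h2.trans (eVariationOn_nat_le _ n))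
    simp only [edist_dist] at h3
    rw [← ENNReal.ofReal_sum_of_nonneg fun _ _ => dist_nonneg] at h3
    exact (ENNReal.ofReal_lt_ofReal_iff_of_nonneg h0).1 h3
  · filter_upwards [eventually_gt_atTop 0] with n hn
    have hn' : (0 : ℝ) < n := by exact_mod_cast hn
    refine lt_of_le_of_lt ((Finset.sum_le_sum fun i hi => h.dist_grid_le hT (Finset.mem_range.1 hi)).trans
      (le_of_eq ?_)) ha
    rw [Finset.sum_const, Finset.card_range, nsmul_eq_mul]
    field_simp

end Speed

/-! ### The handover rate -/

namespace Network

variable (N : Network)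

lemma stepCount_le_handoverCount (S : Tier → Set Plane) (k : Tier) {γ : ℝ → Plane} {T : ℝ}
    (hT : 0 < T) (n : ℕ) :
    (stepCount (fun i => γ (i * (T / n)) ∈ N.servedBy S k)
      (fun i => γ (i * (T / n)) ∈ N.servedBy S k.other) n : ℕ∞) ≤ N.handoverCount S k γ T := by
  obtain ⟨j, hj, hmono⟩ := exists_strictMono_steps (fun i => γ (i * (T / n)) ∈ N.servedBy S k)
      (fun i => γ (i * (T / n)) ∈ N.servedBy S k.other) n
  have hgrid : ∀ a b : ℕ, 0 < n → a < b → (a : ℝ) * (T / n) < b * (T / n) := by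
    intro a b hn hab
    have : (0 : ℝ) < n := by exact_mod_cast hn
    have hab' : (a : ℝ) < b := by exact_mod_cast hab
    gcongr
  refine le_iSup₂_of_le (stepCount _ _ n) ⟨fun i => j i * (T / n),
    fun i => (j i + 1 : ℕ) * (T / n), fun i hi => ?_, fun i hi => ?_, fun i hi => (hj i hi).2⟩ le_rfl
  · have h1 := (hj i hi).1
    exact ⟨(grid_mem hT h1.le).1, hgrid _ _ (by omega) (by omega), (grid_mem hT h1).2⟩
  · have h1 := hmono i hi
    have h2 := (hj i (by omega)).2.2
    have h3 := (hj (i + 1) hi).2.1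
    have h4 := (hj (i + 1) hi).1
    -- The end of one step and the start of the next cannot coincide, since that point would be
    -- served by both tiers. This gives the strict order of times in the handover count.
    refine hgrid _ _ (by omega) (lt_of_le_of_ne h1 fun h => ?_)
    rw [h] at h2
    exact Set.disjoint_left.1 (N.disjoint_servedBy S k) h3 h2

lemma eventually_grid_mem_of_isOpen {γ : ℝ → Plane} {T : ℝ} (hT : 0 < T)
    (hγ : ContinuousOn γ (Icc 0 T)) {U : Set Plane} (hU : IsOpen U) {x : ℝ} (hx : x ∈ Icc 0 T)
    (hxU : γ x ∈ U) : ∀ᶠ n : ℕ in atTop, γ ((⌊x / (T / n)⌋₊ : ℝ) * (T / n)) ∈ U := by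
  have h1 : Tendsto (fun n : ℕ => (⌊x / (T / n)⌋₊ : ℝ) * (T / n)) atTop (𝓝[Icc 0 T] x) := by
    refine tendsto_nhdsWithin_iff.2 ⟨tendsto_floor_grid hT x hx.1, ?_⟩
    filter_upwards [eventually_gt_atTop 0] with n hn
    exact grid_mem hT (floor_grid_le hT hn hx.2)
  exact ((hγ x hx).tendsto.comp h1).eventually (hU.mem_nhds hxU)

/-- The cells are open and γ is continuous, so the times of finitely many handovers can be rounded
down to a fine grid without a change of tier. Absence of ties at grid points ensures that every
intermediate sample is served by one of the tiers. -/
lemma handoverCount_le_liminf {S : Tier → Set Plane} (hS : IsGood S) (k : Tier) {γ : ℝ → Plane}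
    {T : ℝ} (hT : 0 < T) (hγ : ContinuousOn γ (Icc 0 T))
    (hties : ∀ n i : ℕ, γ (i * (T / n)) ∉ N.boundary S) :
    (N.handoverCount S k γ T : ℝ≥0∞) ≤ liminf (fun n : ℕ =>
      (stepCount (fun i => γ (i * (T / n)) ∈ N.servedBy S k)
        (fun i => γ (i * (T / n)) ∈ N.servedBy S k.other) n : ℝ≥0∞)) atTop := by
  -- Passing to the floor in `ℕ∞` allows the supremum to be tested on each finite number m of
  -- handovers.
  rw [← ENat.le_floor]
  refine iSup₂_le fun m ⟨s, t, h1, h2, h3⟩ => ?_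
  rw [ENat.le_floor]
  refine le_liminf_of_le (by isBoundedDefault) ?_
  have hst : ∀ i < m, s i ∈ Icc 0 T ∧ t i ∈ Icc 0 T := fun i hi =>
    ⟨⟨(h1 i hi).1, (h1 i hi).2.1.le.trans (h1 i hi).2.2⟩,
      (h1 i hi).1.trans (h1 i hi).2.1.le, (h1 i hi).2.2⟩
  have e1 : ∀ᶠ n : ℕ in atTop, ∀ i ∈ Finset.range m,
      γ ((⌊s i / (T / n)⌋₊ : ℝ) * (T / n)) ∈ N.servedBy S k :=
    (Finset.eventually_all _).2 fun i hi => eventually_grid_mem_of_isOpen hT hγ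
      (N.isOpen_servedBy hS k) (hst i (Finset.mem_range.1 hi)).1 (h3 i (Finset.mem_range.1 hi)).1
  have e2 : ∀ᶠ n : ℕ in atTop, ∀ i ∈ Finset.range m,
      γ ((⌊t i / (T / n)⌋₊ : ℝ) * (T / n)) ∈ N.servedBy S k.other :=
    (Finset.eventually_all _).2 fun i hi => eventually_grid_mem_of_isOpen hT hγ
      (N.isOpen_servedBy hS _) (hst i (Finset.mem_range.1 hi)).2 (h3 i (Finset.mem_range.1 hi)).2
  filter_upwards [e1, e2, eventually_gt_atTop 0] with n hn1 hn2 hn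
  have hTn : 0 ≤ T / n := by positivity
  rw [ENat.toENNReal_coe, Nat.cast_le]
  refine le_stepCount (a := fun i => ⌊s i / (T / n)⌋₊) (b := fun i => ⌊t i / (T / n)⌋₊)
    (fun i hi => ⟨lt_of_le_of_ne ?_ fun h => ?_, floor_grid_le hT hn (hst i hi).2.2⟩)
    (fun i hi => ?_) (fun i hi => hn1 i (Finset.mem_range.2 hi))
    (fun i hi => hn2 i (Finset.mem_range.2 hi)) fun i _ => ?_
  · exact Nat.floor_mono (div_le_div_of_nonneg_right (h1 i hi).2.1.le hTn)
  -- The rounded times differ because the tiers serving there differ.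
  · have h4 := hn2 i (Finset.mem_range.2 hi)
    rw [← h] at h4
    exact Set.disjoint_left.1 (N.disjoint_servedBy S k) (hn1 i (Finset.mem_range.2 hi)) h4
  · exact Nat.floor_mono (div_le_div_of_nonneg_right (h2 i hi).le hTn)
  · have := hties n i
    rw [N.mem_boundary_iff_not k] at this
    by_contra! hcon
    exact this hcon

namespace IsDeployment

variable {N} {Ω : Type*} [MeasurableSpace Ω] {P : Measure Ω} [IsProbabilityMeasure P]
  {Φ : Tier → Ω → Set Plane}

lemma lintegral_stepCount (hΦ : N.IsDeployment P Φ) (k : Tier) (x : ℕ → Plane) (n : ℕ) :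
    AEMeasurable (fun ω => (stepCount (fun i => x i ∈ N.servedBy (fun j => Φ j ω) k)
      (fun i => x i ∈ N.servedBy (fun j => Φ j ω) k.other) n : ℝ≥0∞)) P ∧
    ∫⁻ ω, (stepCount (fun i => x i ∈ N.servedBy (fun j => Φ j ω) k)
      (fun i => x i ∈ N.servedBy (fun j => Φ j ω) k.other) n : ℝ≥0∞) ∂P =
    ∑ i ∈ Finset.range n, P {ω | x i ∈ N.servedBy (fun j => Φ j ω) k ∧
      x (i + 1) ∈ N.servedBy (fun j => Φ j ω) k.other} := by
  classical
  set E : ℕ → Set Ω := fun i => {ω | x i ∈ N.servedBy (fun j => Φ j ω) k ∧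
      x (i + 1) ∈ N.servedBy (fun j => Φ j ω) k.other} with hE
  have hEm : ∀ i, NullMeasurableSet (E i) P := fun i =>
    (hΦ.nullMeasurableSet_mem_servedBy k (x i)).inter (hΦ.nullMeasurableSet_mem_servedBy _ _)
  have hfun : (fun ω => (stepCount (fun i => x i ∈ N.servedBy (fun j => Φ j ω) k)
      (fun i => x i ∈ N.servedBy (fun j => Φ j ω) k.other) n : ℝ≥0∞)) =
      fun ω => ∑ i ∈ Finset.range n, (E i).indicator 1 ω := by
    funext ω
    rw [stepCount, Finset.card_filter, Nat.cast_sum]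
    refine Finset.sum_congr rfl fun i _ => ?_
    simp only [indicator_apply, hE, mem_ofPred_eq, Pi.one_apply, Nat.cast_ite, Nat.cast_one,
      Nat.cast_zero]
  have hm : ∀ i, AEMeasurable ((E i).indicator (1 : Ω → ℝ≥0∞)) P := fun i =>
    aemeasurable_const.indicator₀ (hEm i)
  rw [hfun]
  refine ⟨Finset.aemeasurable_fun_sum _ fun i _ => hm i, ?_⟩
  rw [lintegral_finsetSum' _ fun i _ => hm i]
  exact Finset.sum_congr rfl fun i _ => lintegral_indicator_one₀ (hEm i)

/-- The n quadratic errors, each O(1/n²), vanish in the sum, while the linear terms add up to the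
length of the inscribed polygon. -/
lemma tendsto_sum_prob (hΦ : N.IsDeployment P Φ) (k : Tier) {γ : ℝ → Plane} {T : ℝ} {v : ℝ≥0}
    (hT : 0 < T) (hγ : HasConstantSpeedOnWith γ (Icc 0 T) v) :
    Tendsto (fun n : ℕ => ∑ i ∈ Finset.range n,
      P {ω | γ (i * (T / n)) ∈ N.servedBy (fun j => Φ j ω) k ∧
        γ ((i + 1 : ℕ) * (T / n)) ∈ N.servedBy (fun j => Φ j ω) k.other}) atTop
      (𝓝 (ENNReal.ofReal (1 / π * N.lengthTerm * (v * T)))) := by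
  obtain ⟨C, hC, hb⟩ := hΦ.exists_prob_servedBy_pair_dist k
  set p : ℕ → ℕ → ℝ≥0∞ := fun n i => P {ω | γ (i * (T / n)) ∈ N.servedBy (fun j => Φ j ω) k ∧
        γ ((i + 1 : ℕ) * (T / n)) ∈ N.servedBy (fun j => Φ j ω) k.other} with hp
  set d : ℕ → ℕ → ℝ := fun n i => dist (γ (i * (T / n))) (γ ((i + 1 : ℕ) * (T / n))) with hd
  have hpr : ∀ n, ∑ i ∈ Finset.range n, p n i =
      ENNReal.ofReal (∑ i ∈ Finset.range n, (p n i).toReal) := by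
    intro n
    rw [ENNReal.ofReal_sum_of_nonneg fun _ _ => ENNReal.toReal_nonneg]
    exact Finset.sum_congr rfl fun i _ => (ENNReal.ofReal_toReal (measure_ne_top _ _)).symm
  change Tendsto (fun n => ∑ i ∈ Finset.range n, p n i) atTop _
  simp only [hpr]
  refine ENNReal.tendsto_ofReal ?_
  have hlen : Tendsto (fun n => 1 / π * N.lengthTerm * ∑ i ∈ Finset.range n, d n i) atTop
      (𝓝 (1 / π * N.lengthTerm * (v * T))) := (hγ.tendsto_sum_dist hT).const_mul _
  have hd0 : ∀ n i, 0 ≤ d n i := fun _ _ => dist_nonneg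
  have hdle : ∀ n i : ℕ, i < n → d n i ≤ v * T / n := fun n i hi =>
    (hγ.dist_grid_le hT hi).trans (le_of_eq (by ring))
  have hz : Tendsto (fun n : ℕ => C * (v * T) ^ 2 / n) atTop (𝓝 0) :=
    tendsto_const_div_atTop_nhds_zero_nat _
  have hdiff : Tendsto (fun n => ∑ i ∈ Finset.range n, (p n i).toReal -
      1 / π * N.lengthTerm * ∑ i ∈ Finset.range n, d n i) atTop (𝓝 0) := by
    refine squeeze_zero_norm' ?_ hz
    -- The two-point estimate holds for distances up to 1, which n ≥ vT guarantees for every grid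
    -- step.
    filter_upwards [eventually_ge_atTop ⌈v * T⌉₊, eventually_gt_atTop 0] with n hn hn0
    have hn1 : (0 : ℝ) < n := by exact_mod_cast hn0
    have hn2 : v * T ≤ n := Nat.ceil_le.1 hn
    rw [Finset.mul_sum, ← Finset.sum_sub_distrib]
    calc _ ≤ ∑ i ∈ Finset.range n, C * (v * T / n) ^ 2 := by
          refine norm_sum_le_of_le _ fun i hi => ?_
          have h1 := hdle n i (Finset.mem_range.1 hi)
          have h2 : d n i ≤ 1 := h1.trans ((div_le_one hn1).2 hn2)
          refine (hb _ _ h2).trans ?_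
          have := hd0 n i
          gcongr
      _ = _ := by
          rw [Finset.sum_const, Finset.card_range, nsmul_eq_mul]
          field_simp
  simpa using hdiff.add hlen

lemma handoverRate_eq (hΦ : N.IsDeployment P Φ) (k : Tier) {γ : ℝ → Plane} {T : ℝ} {v : ℝ≥0}
    (hT : 0 < T) (hγ : HasConstantSpeedOnWith γ (Icc 0 T) v) :
    N.handoverRate P Φ k γ T = ENNReal.ofReal (1 / π * N.lengthTerm * v) := by
  have hlim := hΦ.tendsto_sum_prob k hT hγ
  have hE : ∀ n : ℕ, _ := fun n : ℕ => hΦ.lintegral_stepCount k (fun i => γ (i * (T / n))) n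
  simp only [← fun n => (hE n).2] at hlim
  have hcount : ∫⁻ ω, (N.handoverCount (fun j => Φ j ω) k γ T : ℝ≥0∞) ∂P =
      ENNReal.ofReal (1 / π * N.lengthTerm * (v * T)) := by
    -- Grid counts bound the handover count from below for every n; Fatou's lemma gives the upper
    -- bound. Only the grid counts have to be almost everywhere measurable.
    refine le_antisymm ?_ (le_of_tendsto' hlim fun n => lintegral_mono fun ω => ?_)
    · rw [← hlim.liminf_eq]
      refine le_trans (lintegral_mono_ae ?_) (lintegral_liminf_le' fun n => (hE n).1)
      have hties : ∀ᵐ ω ∂P, ∀ n i : ℕ, γ (i * (T / n)) ∉ N.boundary fun j => Φ j ω :=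
        ae_all_iff.2 fun n => ae_all_iff.2 fun i => hΦ.ae_notMem_boundary _
      filter_upwards [hΦ.ae_isGood, hties] with ω hω ht
      exact N.handoverCount_le_liminf hω k hT hγ.continuousOn ht
    · have := N.stepCount_le_handoverCount (fun j => Φ j ω) k (γ := γ) hT n
      rw [← ENat.toENNReal_le] at this
      simpa using this
  have hL := N.lengthTerm_nonneg
  rw [handoverRate, hcount, ← ENNReal.ofReal_div_of_pos hT]
  congr 1
  field_simp

end IsDeployment

end Network

theorem theorem1 {Ω : Type*} [MeasurableSpace Ω] (P : Measure Ω) [IsProbabilityMeasure P]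
    (N : Network) (Φ : Tier → Ω → Set Plane) (hΦ : N.IsDeployment P Φ) :
    -- the association probabilities and the densities of the service distances
    (∀ k : Tier,
      P {ω | (0 : Plane) ∈ N.servedBy (fun j => Φ j ω) k} = ENNReal.ofReal (N.assocProb k) ∧
      (P[|{ω | (0 : Plane) ∈ N.servedBy (fun j => Φ j ω) k}]).map
          (fun ω => Metric.infDist 0 (Φ k ω)) =
        volume.withDensity (fun x => ENNReal.ofReal (N.servicePDF k x))) ∧
    -- the area intensity is the probability that any given point is on the extended boundary
    (∀ δ : ℝ, 0 < δ → ∀ x : Plane,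
      P {ω | x ∈ N.extBoundary (fun k => Φ k ω) δ} = N.areaIntensity P Φ δ) ∧
    -- the area intensity up to second order
    ((fun δ : ℝ => (N.areaIntensity P Φ δ).toReal - N.areaLeadingTerm δ)
      =O[𝓝[>] 0] fun δ : ℝ => δ ^ 2) ∧
    -- the length intensity
    N.HasLengthIntensity P Φ N.lengthTerm ∧
    -- the handover rate along any trajectory of speed `v`
    (∀ (k : Tier) (v : ℝ≥0) (T : ℝ) (γ : ℝ → Plane), 0 < T →
      HasConstantSpeedOnWith γ (Icc 0 T) v →
      N.handoverRate P Φ k γ T = ENNReal.ofReal (1 / π * N.lengthTerm * v)) := by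
  exact ⟨fun k => ⟨hΦ.prob_zero_mem_servedBy k, hΦ.map_cond_infDist k⟩,
    fun δ _ x => by rw [hΦ.prob_mem_extBoundary, hΦ.areaIntensity_eq],
    hΦ.isBigO_areaIntensity, hΦ.hasLengthIntensity,
    fun k v T γ hT hγ => hΦ.handoverRate_eq k hT hγ⟩
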